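/- Let $k$ be a (discrete) field of characteristic $0$, $\mathfrak g$ a Tate Lie algebra over $k$ (a complete linearly topologized space with a base of neighbourhoods of $0$ consisting of pairwise commensurable subspaces, with a continuous Lie bracket), $\mathfrak b\subset\mathfrak g$ a Lie subalgebra that is a c-lattice (open and bounded), $\mathfrak c=\mathfrak g/\mathfrak b$, and fix a linear section of $\mathfrak g\to\mathfrak c$, so $\mathfrak g=\mathfrak b\oplus\mathfrak c$. Let $\mu_1:\mathfrak b\otimes\mathfrak c\to\mathfrak c$, $\mu_2:\mathfrak b\otimes\mathfrak c\to\mathfrak b$, $\mu_{\mathfrak c}:\Lambda^2\mathfrak c\to\mathfrak c$, $h^*:\Lambda^2\mathfrak c\to\mathfrak b$ be the components of the bracket. **CDG Lie algebroids.** A CDG Lie algebroid $(A,R,d_A,d_R,h)$ consists of a graded supercommutative algebra $R$, a graded super Lie algebroid $A$ over $R$, mutually compatible super derivations $d_R,d_A$ of degree $1$, and $h\in A_2$ with $d_R^2=h(-)$, $d_A^2=[h,-]$, $d_Ah=0$. A left (right) CDG-module is a graded module over $R$ and $A$ on the given side, with $ar-(-1)^{|a||r|}ra$ acting as $a(r)$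 and $ra$ acting as the product of $r$ and $a$, and with a degree $1$ map $d$ satisfying the Leibniz rules and $d^2m=hm$ (resp. $d^2m=-mh$). The pair $\mathfrak b\subset\mathfrak g$ gives $R=\Lambda^\bullet(\mathfrak c^*)$, $A=\mathfrak b\otimes\Lambda^\bullet(\mathfrak c^*)$ (completed: $R_n=\mathrm{Hom}(\Lambda^n\mathfrak c,k)$, $A_n=\mathrm{Hom}(\Lambda^n\mathfrak c,\mathfrak b)$), with bracket generated by that of $\mathfrak b$ and the action of $\mathfrak b$ on $\mathfrak c^*$ dual to $\mu_1$, with $d_R$ generated by the dual of $\mu_{\mathfrak c}$, $d_A$ generated by $d_R$ and the map $\mathfrak b\to\mathfrak b\otimes\mathfrak c^*$ given by $\mu_2$, and $h=h^*$. **Opposite.** A unital CDG Lie algebroid is a CDG Lie algebroid with a closed central element $1\in A_0$ acting by $0$ on $R$; it stands for the operators of order $\le1$ in an enveloping algebra, and in its modules the unit acts by the identity. A CDG Lie algebroid $A$ gives the unital one $R\oplus A$ (super commutator bracket, unit $1\in R$). The opposite of a unital CDG Lie algebroid has the same space, unit and $d$, the opposite bracket, anchor and curvature $-h$, and $R$-module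 structure $r\circ a=ra+(-1)^{|r||a|}a(r)\cdot 1$. $A^{\mathrm{opp}}$ denotes the opposite of $R\oplus A$. **Critical extension.** Writing $(\mathrm{ad}\,x)_{\mathfrak b\mathfrak c}:\mathfrak c\to\mathfrak b$ and $(\mathrm{ad}\,x)_{\mathfrak c\mathfrak b}:\mathfrak b\to\mathfrak c$ for the components of $\mathrm{ad}\,x$, let $$\omega_0(x,y)=\mathrm{tr}_{\mathfrak c}\big((\mathrm{ad}\,y)_{\mathfrak c\mathfrak b}(\mathrm{ad}\,x)_{\mathfrak b\mathfrak c}-(\mathrm{ad}\,x)_{\mathfrak c\mathfrak b}(\mathrm{ad}\,y)_{\mathfrak b\mathfrak c}\big)$$ (the trace of an operator of finite rank) and let $\mathfrak g^\sharp=\mathfrak g\oplus kK$ be the central extension with bracket $[x,y]^\sharp=[x,y]+\omega_0(x,y)K$. **Proposition.** $\mathfrak g^\sharp$ is a Tate Lie algebra and $\mathfrak b\oplus kK$ is a c-lattice and a subalgebra in it. Let $\tilde A^\sharp$ be the CDG Lie algebroid over $R^\sharp=R$ obtained from $\mathfrak b\oplus kK\subset\mathfrak g^\sharp$ with $\mathfrak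 g^\sharp=(\mathfrak b\oplus kK)\oplus\mathfrak c$. Then $K$ is central in $\tilde A^\sharp$; let $A^\sharp$ be the unital CDG Lie algebroid $\tilde A^\sharp$ with unit $K$, i.e. the quotient of $R\oplus\tilde A^\sharp$ by the $R$-submodule generated by $K-1$. Both $A$ and $\tilde A^\sharp$ are CDG Lie algebroids, and there is an isomorphism of unital CDG Lie algebroids $$\Phi:A^\sharp\;\xrightarrow{\ \sim\ }\;(A,R,d_A,d_R,h)^{\mathrm{opp}}$$ that is the identity on $R$ and sends $x\in\mathrm{Hom}(\Lambda^n\mathfrak c,\mathfrak b\oplus kK)$ to an element whose $A$-component is minus the $\mathfrak b$-component of $x$. Consequently every right CDG-module over $A^\sharp$ (with $K$ acting by $1$) becomes, with the same $d$ and with $r\cdot n=(-1)^{|r||n|}nr$, $a\cdot n=(-1)^{|a||n|}n\,\Phi^{-1}(a)$, a left CDG-module over $A$. In particular, let $M^\sharp$ be a discrete $\mathfrak g^\sharp$-module whose associated right module $m\cdot x=-xm$ has $K$ acting by $1$ (so $Km=-m$ for the left action). Then $M^\sharp\otimes\Lambda^\bullet(\mathfrak c)$, with $\Lambda^\bullet(\mathfrak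 c^*)$ acting by contractions, $\mathfrak b\oplus kK$ acting by minus the tensor product action, and $d(m\otimes\xi)=(-1)^{|\xi|+1}\big(m\otimes\partial\xi+\sum\xi'_1m\otimes\xi''\big)$ (where $\partial$ is the coderivation extending $\mu_{\mathfrak c}$ and $\sum\xi'_1\otimes\xi''$ is the $(1,\bullet)$-part of the coproduct of $\xi$), is a right CDG-module over $A^\sharp$, and so becomes a left CDG-module over $A$. -/

import Mathlib

open scoped TensorProduct
open Filter Topology

universe u v w w₁ w₂

set_option linter.checkUnivs false
set_option maxSynthPendingDepth 3

noncomputable section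

namespace Semiinf

/-! ### Tate vector spaces and Tate Lie algebras

The base field `k` is discrete: no topology on `k` is used, and all topologies are linear. -/

section Tate

variable (k : Type u) [Field k] {V : Type v} [AddCommGroup V] [Module k V]

/-- `dim U₁ / (U₁ ∩ U₂) < ∞`. -/
def FiniteIndexIn (U₁ U₂ : Submodule k V) : Prop :=
  Module.Finite k (↥U₁ ⧸ U₂.submoduleOf U₁)

/-- A Tate space: a complete (in particular separated) topological vector space with a base of
neighbourhoods of `0` consisting of pairwise commensurable subspaces. -/
structure IsTateSpace (V : Type v) [AddCommGroup V] [Module k V] [TopologicalSpace V] : Prop where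
  t2 : T2Space V
  addGroup : IsTopologicalAddGroup V
  /-- every Cauchy filter converges -/
  complete : ∀ F : Filter V, F.NeBot →
    Tendsto (fun p : V × V => p.1 - p.2) (F ×ˢ F) (𝓝 0) → ∃ x, F ≤ 𝓝 x
  base : ∃ 𝓑 : Set (Submodule k V),
    (∀ U ∈ 𝓑, IsOpen (U : Set V)) ∧
    (∀ N ∈ 𝓝 (0 : V), ∃ U ∈ 𝓑, (U : Set V) ⊆ N) ∧
    (∀ U₁ ∈ 𝓑, ∀ U₂ ∈ 𝓑, FiniteIndexIn k U₁ U₂)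

variable {k}

/-- A c-lattice: an open bounded subspace. -/
structure IsCLattice [TopologicalSpace V] (L : Submodule k V) : Prop where
  isOpen : IsOpen (L : Set V)
  bounded : ∀ U : Submodule k V, IsOpen (U : Set V) → FiniteIndexIn k L U

/-- `V` with the bracket `br` is a Tate Lie algebra. -/
structure IsTateLieAlgebra [TopologicalSpace V] (br : V →ₗ[k] V →ₗ[k] V) : Prop where
  tate : IsTateSpace k V
  self : ∀ x, br x x = 0
  jacobi : ∀ x y z, br x (br y z) = br (br x y) z + br y (br x z)
  continuous : Continuous fun p : V × V => br p.1 p.2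

variable (k) in
/-- The bracket of a Lie algebra as a bilinear map. -/
def lieBr (g : Type v) [LieRing g] [LieAlgebra k g] : g →ₗ[k] g →ₗ[k] g :=
  LinearMap.mk₂ k (fun x y => ⁅x, y⁆) add_lie smul_lie lie_add lie_smul

end Tate

/-! ### The trace of an operator of finite rank -/

section Trace

variable {k : Type u} [Field k] {V : Type v} [AddCommGroup V] [Module k V]

/-- The trace of an endomorphism of finite rank of a possibly infinite-dimensional space: the trace
of its restriction to its own (finite-dimensional) range. -/
def finiteRankTrace (f : V →ₗ[k] V) : k :=
  LinearMap.trace k (LinearMap.range f)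
    (f.restrict (p := LinearMap.range f) (q := LinearMap.range f) fun x _ => ⟨x, rfl⟩)

theorem finiteRankTrace_eq (f : V →ₗ[k] V) (W : Submodule k V) [Module.Finite k W]
    (h : ∀ x, f x ∈ W) :
    finiteRankTrace f = LinearMap.trace k W (f.restrict (p := W) (q := W) fun x _ => h x) := by
  have hle : LinearMap.range f ≤ W := by rintro _ ⟨x, rfl⟩; exact h x
  set F := f.restrict (p := W) (q := W) fun x _ => h x
  have key := LinearMap.trace_restrict_eq_of_forall_mem ((LinearMap.range f).submoduleOf W) F
    (fun x => ⟨x.1, rfl⟩)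
  rw [← key, ← LinearMap.trace_conj' _ (Submodule.submoduleOfEquivOfLe hle)]
  rfl

theorem finiteRankTrace_add (f g : V →ₗ[k] V) (hf : Module.Finite k (LinearMap.range f))
    (hg : Module.Finite k (LinearMap.range g)) :
    finiteRankTrace (f + g) = finiteRankTrace f + finiteRankTrace g := by
  set W := LinearMap.range f ⊔ LinearMap.range g
  have h1 : ∀ x, f x ∈ W := fun x => Submodule.mem_sup_left ⟨x, rfl⟩
  have h2 : ∀ x, g x ∈ W := fun x => Submodule.mem_sup_right ⟨x, rfl⟩
  have h3 : ∀ x, (f + g) x ∈ W := fun x => W.add_mem (h1 x) (h2 x)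
  rw [finiteRankTrace_eq f W h1, finiteRankTrace_eq g W h2, finiteRankTrace_eq _ W h3, ← map_add]
  rfl

theorem finiteRankTrace_smul (t : k) (f : V →ₗ[k] V) (hf : Module.Finite k (LinearMap.range f)) :
    finiteRankTrace (t • f) = t • finiteRankTrace f := by
  have h1 : ∀ x, f x ∈ LinearMap.range f := fun x => ⟨x, rfl⟩
  have h3 : ∀ x, (t • f) x ∈ LinearMap.range f := fun x => Submodule.smul_mem _ _ (h1 x)
  rw [finiteRankTrace_eq f _ h1, finiteRankTrace_eq _ _ h3, ← map_smul]
  rfl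

end Trace

/-! ### The critical cocycle and the central extension -/

section Critical

variable {k : Type u} [Field k] {g : Type v} [AddCommGroup g] [Module k g]

/-- The linear decomposition `g = b ⊕ g/b` given by a section `s` of the projection `g → g/b`. -/
def splitting (B : Submodule k g) (s : (g ⧸ B) →ₗ[k] g) (hs : ∀ x, B.mkQ (s x) = x) :
    g ≃ₗ[k] ↥B × (g ⧸ B) where
  toFun x := (⟨x - s (B.mkQ x), by
    have h : B.mkQ (x - s (B.mkQ x)) = 0 := by rw [map_sub, hs, sub_self]
    exact (Submodule.Quotient.mk_eq_zero B).1 h⟩, B.mkQ x)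
  map_add' x y := by
    ext
    · simp only [map_add, Prod.fst_add, Submodule.coe_add]; abel
    · simp
  map_smul' t x := by
    ext
    · simp [smul_sub]
    · simp
  invFun p := (p.1 : g) + s p.2
  left_inv x := by simp
  right_inv p := by
    have h : B.mkQ ((p.1 : g) + s p.2) = p.2 := by
      rw [map_add, hs, (by simp : B.mkQ (p.1 : g) = 0), zero_add]
    ext
    · simp only [h, add_sub_cancel_right]
    · exact h

variable (br : g →ₗ[k] g →ₗ[k] g) (B : Submodule k g) (s : (g ⧸ B) →ₗ[k] g)
  (hs : ∀ x, B.mkQ (s x) = x)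

/-- For `x ∈ g`, the component `c → b` of `[x, -]`, where `c = g/b` and `g = b ⊕ c` via `s`. -/
def adCB (x : g) : (g ⧸ B) →ₗ[k] B :=
  LinearMap.fst k B (g ⧸ B) ∘ₗ (splitting B s hs).toLinearMap ∘ₗ br x ∘ₗ s

/-- For `y ∈ g`, the component `b → c` of `[y, -]`, where `c = g/b`. -/
def adBC (y : g) : B →ₗ[k] (g ⧸ B) := B.mkQ ∘ₗ br y ∘ₗ B.subtype

variable {br B}

theorem adBC_finite [TopologicalSpace g] (hg : IsTateLieAlgebra br) (hB : IsCLattice B) (y : g) :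
    Module.Finite k (LinearMap.range (adBC br B y)) := by
  have hc : Continuous (br y) := hg.continuous.comp (Continuous.prodMk_right y)
  have hU : IsOpen ((B.comap (br y) : Submodule k g) : Set g) := hB.isOpen.preimage hc
  have hfin : Module.Finite k (↥B ⧸ (B.comap (br y)).submoduleOf B) := hB.bounded _ hU
  have hker : LinearMap.ker (adBC br B y) = (B.comap (br y)).submoduleOf B := by
    ext b
    simp [adBC, Submodule.submoduleOf]
  rw [← hker] at hfin
  exact Module.Finite.equiv (adBC br B y).quotKerEquivRange

theorem adBC_comp_finite [TopologicalSpace g] (hg : IsTateLieAlgebra br) (hB : IsCLattice B)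
    (x y : g) : Module.Finite k (LinearMap.range (adBC br B y ∘ₗ adCB br B s hs x)) := by
  have := adBC_finite hg hB y
  exact Submodule.finiteDimensional_of_le (LinearMap.range_comp_le_range _ _)

theorem adOp_finite [TopologicalSpace g] (hg : IsTateLieAlgebra br) (hB : IsCLattice B)
    (x y : g) : Module.Finite k (LinearMap.range
      (adBC br B y ∘ₗ adCB br B s hs x - adBC br B x ∘ₗ adCB br B s hs y)) := by
  have h1 := adBC_comp_finite s hs hg hB x y
  have h2 := adBC_comp_finite s hs hg hB y x
  refine Submodule.finiteDimensional_of_le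
    (S₂ := LinearMap.range (adBC br B y ∘ₗ adCB br B s hs x) ⊔
      LinearMap.range (adBC br B x ∘ₗ adCB br B s hs y)) ?_
  rintro _ ⟨z, rfl⟩
  exact Submodule.sub_mem _ (Submodule.mem_sup_left ⟨z, rfl⟩) (Submodule.mem_sup_right ⟨z, rfl⟩)

/-- The critical cocycle of a Tate Lie algebra `g` for the decomposition `g = b ⊕ c`:
`ω₀(x, y) = tr_c ((ad y)_{c←b} (ad x)_{b←c} - (ad x)_{c←b} (ad y)_{b←c})`,
the inverse image under `ad` of the Tate cocycle
`(X, Y) ↦ tr (P[X,Y]P - [PXP, PYP])`, `P` the projection to `b` along `c`. -/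
def criticalCocycle [TopologicalSpace g] (hg : IsTateLieAlgebra br) (hB : IsCLattice B) :
    g →ₗ[k] g →ₗ[k] k :=
  LinearMap.mk₂ k
    (fun x y => finiteRankTrace
      (adBC br B y ∘ₗ adCB br B s hs x - adBC br B x ∘ₗ adCB br B s hs y))
    (fun x x' y => by
      rw [← finiteRankTrace_add _ _ (adOp_finite s hs hg hB _ _) (adOp_finite s hs hg hB _ _)]
      congr 1; ext z; simp [adBC, adCB]; abel)
    (fun t x y => by
      rw [← finiteRankTrace_smul _ _ (adOp_finite s hs hg hB _ _)]
      congr 1; ext z; simp [adBC, adCB, smul_sub])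
    (fun x y y' => by
      rw [← finiteRankTrace_add _ _ (adOp_finite s hs hg hB _ _) (adOp_finite s hs hg hB _ _)]
      congr 1; ext z; simp [adBC, adCB]; abel)
    (fun t x y => by
      rw [← finiteRankTrace_smul _ _ (adOp_finite s hs hg hB _ _)]
      congr 1; ext z; simp [adBC, adCB, smul_sub])

theorem criticalCocycle_self [TopologicalSpace g] (hg : IsTateLieAlgebra br) (hB : IsCLattice B)
    (x : g) : criticalCocycle s hs hg hB x x = 0 := by
  have h : (criticalCocycle s hs hg hB x x) + (criticalCocycle s hs hg hB x x) =
      (criticalCocycle s hs hg hB x x) := by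
    simp only [criticalCocycle, LinearMap.mk₂_apply]
    rw [← finiteRankTrace_add _ _ (adOp_finite s hs hg hB _ _) (adOp_finite s hs hg hB _ _)]
    simp
  simpa using h

variable (k g) in
/-- The underlying space `g ⊕ k K` of a one-dimensional central extension of `g`, with the product
topology for the discrete topology on `k K`. -/
def CentralExt : Type max u v := g × k

instance : AddCommGroup (CentralExt k g) := inferInstanceAs (AddCommGroup (g × k))
instance : Module k (CentralExt k g) := inferInstanceAs (Module k (g × k))
instance [TopologicalSpace g] : TopologicalSpace (CentralExt k g) :=
  @instTopologicalSpaceProd g k _ ⊥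

variable (k g) in
/-- The central element `K`. -/
def centralK : CentralExt k g := ((0, 1) : g × k)

/-- The bracket `[(x, s), (y, t)] = ([x, y], ω(x, y))` of the central extension. -/
def centralBr (br : g →ₗ[k] g →ₗ[k] g) (ω : g →ₗ[k] g →ₗ[k] k) :
    CentralExt k g →ₗ[k] CentralExt k g →ₗ[k] CentralExt k g :=
  LinearMap.mk₂ k (fun p q => ((br p.1 q.1, ω p.1 q.1) : g × k))
    (fun p p' q => by
      change ((br (p.1 + p'.1) q.1, ω (p.1 + p'.1) q.1) : g × k) = (_, _)
      simp)
    (fun t p q => by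
      change ((br (t • p.1) q.1, ω (t • p.1) q.1) : g × k) = (_, _)
      simp)
    (fun p q q' => by
      change ((br p.1 (q.1 + q'.1), ω p.1 (q.1 + q'.1)) : g × k) = (_, _)
      simp)
    (fun t p q => by
      change ((br p.1 (t • q.1), ω p.1 (t • q.1)) : g × k) = (_, _)
      simp)

variable (k) in
/-- The subspace `b ⊕ k K` of the central extension. -/
def sharpSub (B : Submodule k g) : Submodule k (CentralExt k g) :=
  B.comap (LinearMap.fst k g k)

end Critical

/-! ### CDG Lie algebroids

Graded objects are families indexed by `ℤ`, and all signs follow the Koszul rule; an operation of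
degree `0` or `1` on homogeneous components is indexed by a proof that the degrees add up, so that
no transport between components is needed. -/

section CDG

/-- The data `(A, R, d_A, d_R, h)` of a CDG Lie algebroid: the product of `R`, the action of `R` on
`A`, the bracket of `A`, the action (anchor) of `A` on `R`, the two derivations, the curvature. -/
structure CDGData (k : Type u) [Field k] where
  R : ℤ → Type w₁
  A : ℤ → Type w₂
  [addR : ∀ n, AddCommGroup (R n)]
  [modR : ∀ n, Module k (R n)]
  [addA : ∀ n, AddCommGroup (A n)]
  [modA : ∀ n, Module k (A n)]
  one : R 0
  mul : ∀ {i j n : ℤ}, i + j = n → (R i →ₗ[k] R j →ₗ[k] R n)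
  smul : ∀ {i j n : ℤ}, i + j = n → (R i →ₗ[k] A j →ₗ[k] A n)
  bracket : ∀ {i j n : ℤ}, i + j = n → (A i →ₗ[k] A j →ₗ[k] A n)
  anchor : ∀ {i j n : ℤ}, i + j = n → (A i →ₗ[k] R j →ₗ[k] R n)
  dR : ∀ {i n : ℤ}, i + 1 = n → (R i →ₗ[k] R n)
  dA : ∀ {i n : ℤ}, i + 1 = n → (A i →ₗ[k] A n)
  h : A 2

attribute [instance] CDGData.addR CDGData.modR CDGData.addA CDGData.modA

variable {k : Type u} [Field k]

/-- The data form a CDG Lie algebroid: `R` is a graded supercommutative algebra, `A` is a graded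
super Lie algebroid over `R`, `d_R` and `d_A` are compatible super derivations of degree `1`,
`d_R² = h(-)`, `d_A² = [h, -]` and `d_A h = 0`. -/
structure IsCDGLieAlgebroid (X : CDGData k) : Prop where
  one_mul : ∀ {i : ℤ} (e : 0 + i = i) (r : X.R i), X.mul e X.one r = r
  mul_assoc : ∀ {i j l ij jl n : ℤ} (e₁ : i + j = ij) (e₂ : ij + l = n) (e₃ : j + l = jl)
    (e₄ : i + jl = n) (r : X.R i) (s : X.R j) (t : X.R l),
    X.mul e₂ (X.mul e₁ r s) t = X.mul e₄ r (X.mul e₃ s t)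
  mul_comm : ∀ {i j n : ℤ} (e : i + j = n) (e' : j + i = n) (r : X.R i) (s : X.R j),
    X.mul e r s = (i * j).negOnePow • X.mul e' s r
  one_smul : ∀ {i : ℤ} (e : 0 + i = i) (a : X.A i), X.smul e X.one a = a
  mul_smul : ∀ {i j l ij jl n : ℤ} (e₁ : i + j = ij) (e₂ : ij + l = n) (e₃ : j + l = jl)
    (e₄ : i + jl = n) (r : X.R i) (s : X.R j) (a : X.A l),
    X.smul e₂ (X.mul e₁ r s) a = X.smul e₄ r (X.smul e₃ s a)
  bracket_skew : ∀ {i j n : ℤ} (e : i + j = n) (e' : j + i = n) (a : X.A i) (b : X.A j),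
    X.bracket e a b = -((i * j).negOnePow • X.bracket e' b a)
  jacobi : ∀ {i j l ij jl il n : ℤ} (e₁ : j + l = jl) (e₂ : i + jl = n) (e₃ : i + j = ij)
    (e₄ : ij + l = n) (e₅ : i + l = il) (e₆ : j + il = n) (a : X.A i) (b : X.A j) (c : X.A l),
    X.bracket e₂ a (X.bracket e₁ b c) = X.bracket e₄ (X.bracket e₃ a b) c +
      (i * j).negOnePow • X.bracket e₆ b (X.bracket e₅ a c)
  anchor_bracket : ∀ {i j l ij jl il n : ℤ} (e₁ : j + l = jl) (e₂ : i + jl = n) (e₃ : i + j = ij)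
    (e₄ : ij + l = n) (e₅ : i + l = il) (e₆ : j + il = n) (a : X.A i) (b : X.A j) (r : X.R l),
    X.anchor e₂ a (X.anchor e₁ b r) = X.anchor e₄ (X.bracket e₃ a b) r +
      (i * j).negOnePow • X.anchor e₆ b (X.anchor e₅ a r)
  anchor_mul : ∀ {i j l ij jl il n : ℤ} (e₁ : j + l = jl) (e₂ : i + jl = n) (e₃ : i + j = ij)
    (e₄ : ij + l = n) (e₅ : i + l = il) (e₆ : j + il = n) (a : X.A i) (r : X.R j) (s : X.R l),
    X.anchor e₂ a (X.mul e₁ r s) = X.mul e₄ (X.anchor e₃ a r) s +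
      (i * j).negOnePow • X.mul e₆ r (X.anchor e₅ a s)
  smul_anchor : ∀ {i j l ij jl n : ℤ} (e₁ : i + j = ij) (e₂ : ij + l = n) (e₃ : j + l = jl)
    (e₄ : i + jl = n) (r : X.R i) (a : X.A j) (s : X.R l),
    X.anchor e₂ (X.smul e₁ r a) s = X.mul e₄ r (X.anchor e₃ a s)
  bracket_smul : ∀ {i j l ij jl il n : ℤ} (e₁ : j + l = jl) (e₂ : i + jl = n) (e₃ : i + j = ij)
    (e₄ : ij + l = n) (e₅ : i + l = il) (e₆ : j + il = n) (a : X.A i) (r : X.R j) (b : X.A l),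
    X.bracket e₂ a (X.smul e₁ r b) = X.smul e₄ (X.anchor e₃ a r) b +
      (i * j).negOnePow • X.smul e₆ r (X.bracket e₅ a b)
  dR_mul : ∀ {i j n i' j' n' : ℤ} (e : i + j = n) (ei : i + 1 = i') (ej : j + 1 = j')
    (en : n + 1 = n') (e₁ : i' + j = n') (e₂ : i + j' = n') (r : X.R i) (s : X.R j),
    X.dR en (X.mul e r s) = X.mul e₁ (X.dR ei r) s + i.negOnePow • X.mul e₂ r (X.dR ej s)
  dA_smul : ∀ {i j n i' j' n' : ℤ} (e : i + j = n) (ei : i + 1 = i') (ej : j + 1 = j')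
    (en : n + 1 = n') (e₁ : i' + j = n') (e₂ : i + j' = n') (r : X.R i) (a : X.A j),
    X.dA en (X.smul e r a) = X.smul e₁ (X.dR ei r) a + i.negOnePow • X.smul e₂ r (X.dA ej a)
  dA_bracket : ∀ {i j n i' j' n' : ℤ} (e : i + j = n) (ei : i + 1 = i') (ej : j + 1 = j')
    (en : n + 1 = n') (e₁ : i' + j = n') (e₂ : i + j' = n') (a : X.A i) (b : X.A j),
    X.dA en (X.bracket e a b) =
      X.bracket e₁ (X.dA ei a) b + i.negOnePow • X.bracket e₂ a (X.dA ej b)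
  dR_anchor : ∀ {i j n i' j' n' : ℤ} (e : i + j = n) (ei : i + 1 = i') (ej : j + 1 = j')
    (en : n + 1 = n') (e₁ : i' + j = n') (e₂ : i + j' = n') (a : X.A i) (r : X.R j),
    X.dR en (X.anchor e a r) =
      X.anchor e₁ (X.dA ei a) r + i.negOnePow • X.anchor e₂ a (X.dR ej r)
  dR_dR : ∀ {i j n : ℤ} (e₁ : i + 1 = j) (e₂ : j + 1 = n) (e : 2 + i = n) (r : X.R i),
    X.dR e₂ (X.dR e₁ r) = X.anchor e X.h r
  dA_dA : ∀ {i j n : ℤ} (e₁ : i + 1 = j) (e₂ : j + 1 = n) (e : 2 + i = n) (a : X.A i),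
    X.dA e₂ (X.dA e₁ a) = X.bracket e X.h a
  dA_h : ∀ {n : ℤ} (e : 2 + 1 = n), X.dA e X.h = 0

/-- A CDG Lie algebroid in which a degree zero element is singled out as the unit. It encodes the
components of order `≤ 1` of a filtered CDG algebra over `R`: the elements `r • unit` play the
role of the elements `r` of `R`. For a CDG Lie algebroid `P` with a central element `K`, the pair
`(P, K)` is the result of setting `K = 1`. -/
structure UnitalCDGData (k : Type u) [Field k] extends CDGData k where
  unit : A 0

/-- The unit of a unital CDG Lie algebroid is central, acts by zero on `R`, and is closed. -/
structure IsUnitalCDGLieAlgebroid (X : UnitalCDGData k) : Prop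
    extends IsCDGLieAlgebroid X.toCDGData where
  unit_bracket : ∀ {i n : ℤ} (e : 0 + i = n) (a : X.A i), X.bracket e X.unit a = 0
  unit_anchor : ∀ {i n : ℤ} (e : 0 + i = n) (r : X.R i), X.anchor e X.unit r = 0
  dA_unit : ∀ {n : ℤ} (e : 0 + 1 = n), X.dA e X.unit = 0

/-- The unital CDG Lie algebroid `R ⊕ A` freely generated by a CDG Lie algebroid `A`, with unit
`(1, 0)`: the elements of order `≤ 1` of the enveloping algebra of `A` over `R`, with the super
commutator, i.e. `[(s, a), (t, b)] = (a(t) - (-1)^{|s||b|} b(s), [a, b])`. -/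
def adjoinUnit (X : CDGData k) : UnitalCDGData k where
  R := X.R
  A n := X.R n × X.A n
  one := X.one
  mul e := X.mul e
  smul e := LinearMap.mk₂ k (fun r p => (X.mul e r p.1, X.smul e r p.2))
    (by intros; simp) (by intros; simp) (by intros; simp) (by intros; simp)
  bracket {i j _} e := LinearMap.mk₂ k
    (fun p q => (X.anchor e p.2 q.1 -
      (i * j).negOnePow • X.anchor ((add_comm j i).trans e) q.2 p.1, X.bracket e p.2 q.2))
    (by intros; ext <;> simp; abel) (fun t p q => by
      ext
      · simp only [Prod.smul_fst, Prod.smul_snd, map_smul, LinearMap.smul_apply, smul_sub]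
        rw [smul_comm]
      · simp)
    (by intros; ext <;> simp; abel) (fun t p q => by
      ext
      · simp only [Prod.smul_fst, Prod.smul_snd, map_smul, LinearMap.smul_apply, smul_sub]
        rw [smul_comm]
      · simp)
  anchor e := X.anchor e ∘ₗ LinearMap.snd k _ _
  dR e := X.dR e
  dA e := (X.dR e).prodMap (X.dA e)
  h := (0, X.h)
  unit := (X.one, 0)

/-- The opposite of a unital CDG Lie algebroid. It is the structure for which left modules over the
opposite are right modules over the original one: for the opposite product
`x° y° = (-1)^{|x||y|} (y x)°` the super commutator, the action on `R` and the curvature change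
their signs, `d` does not change, and, as `a r = a(r) + (-1)^{|a||r|} r a`, the `R`-module structure
becomes `r° a° = (-1)^{|r||a|} (a r)° = (r a + (-1)^{|r||a|} a(r) • unit)°`. -/
def opp (X : UnitalCDGData k) : UnitalCDGData k where
  R := X.R
  A := X.A
  one := X.one
  mul e := X.mul e
  smul {i j n} e := LinearMap.mk₂ k
    (fun r a => X.smul e r a + (i * j).negOnePow •
      X.smul (add_zero n) (X.anchor ((add_comm j i).trans e) a r) X.unit)
    (by intros; simp; abel)
    (fun t r a => by
      simp only [map_smul, LinearMap.smul_apply, smul_add]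
      rw [smul_comm])
    (by intros; simp; abel)
    (fun t r a => by
      simp only [map_smul, LinearMap.smul_apply, smul_add]
      rw [smul_comm])
  bracket e := -X.bracket e
  anchor e := -X.anchor e
  dR e := X.dR e
  dA e := X.dA e
  h := -X.h
  unit := X.unit

/-- The data of a graded left module with differential over the data of a CDG Lie algebroid. -/
structure LeftModuleData (X : CDGData k) where
  N : ℤ → Type w
  [addN : ∀ n, AddCommGroup (N n)]
  [modN : ∀ n, Module k (N n)]
  actR : ∀ {i j n : ℤ}, i + j = n → (X.R i →ₗ[k] N j →ₗ[k] N n)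
  actA : ∀ {i j n : ℤ}, i + j = n → (X.A i →ₗ[k] N j →ₗ[k] N n)
  d : ∀ {i n : ℤ}, i + 1 = n → (N i →ₗ[k] N n)

attribute [instance] LeftModuleData.addN LeftModuleData.modN

/-- Left CDG-modules; in particular `d² = h` as operators. -/
structure IsLeftCDGModule {X : CDGData k} (M : LeftModuleData X) : Prop where
  one_act : ∀ {i : ℤ} (e : 0 + i = i) (x : M.N i), M.actR e X.one x = x
  mul_act : ∀ {i j l ij jl n : ℤ} (e₁ : i + j = ij) (e₂ : ij + l = n) (e₃ : j + l = jl)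
    (e₄ : i + jl = n) (r : X.R i) (s : X.R j) (x : M.N l),
    M.actR e₂ (X.mul e₁ r s) x = M.actR e₄ r (M.actR e₃ s x)
  smul_act : ∀ {i j l ij jl n : ℤ} (e₁ : i + j = ij) (e₂ : ij + l = n) (e₃ : j + l = jl)
    (e₄ : i + jl = n) (r : X.R i) (a : X.A j) (x : M.N l),
    M.actA e₂ (X.smul e₁ r a) x = M.actR e₄ r (M.actA e₃ a x)
  act_act : ∀ {i j l ij jl il n : ℤ} (e₁ : j + l = jl) (e₂ : i + jl = n) (e₃ : i + j = ij)
    (e₄ : ij + l = n) (e₅ : i + l = il) (e₆ : j + il = n) (a : X.A i) (r : X.R j) (x : M.N l),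
    M.actA e₂ a (M.actR e₁ r x) = M.actR e₄ (X.anchor e₃ a r) x +
      (i * j).negOnePow • M.actR e₆ r (M.actA e₅ a x)
  bracket_act : ∀ {i j l ij jl il n : ℤ} (e₁ : j + l = jl) (e₂ : i + jl = n) (e₃ : i + j = ij)
    (e₄ : ij + l = n) (e₅ : i + l = il) (e₆ : j + il = n) (a : X.A i) (b : X.A j) (x : M.N l),
    M.actA e₄ (X.bracket e₃ a b) x = M.actA e₂ a (M.actA e₁ b x) -
      (i * j).negOnePow • M.actA e₆ b (M.actA e₅ a x)
  d_actR : ∀ {i j n i' j' n' : ℤ} (e : i + j = n) (ei : i + 1 = i') (ej : j + 1 = j')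
    (en : n + 1 = n') (e₁ : i' + j = n') (e₂ : i + j' = n') (r : X.R i) (x : M.N j),
    M.d en (M.actR e r x) = M.actR e₁ (X.dR ei r) x + i.negOnePow • M.actR e₂ r (M.d ej x)
  d_actA : ∀ {i j n i' j' n' : ℤ} (e : i + j = n) (ei : i + 1 = i') (ej : j + 1 = j')
    (en : n + 1 = n') (e₁ : i' + j = n') (e₂ : i + j' = n') (a : X.A i) (x : M.N j),
    M.d en (M.actA e a x) = M.actA e₁ (X.dA ei a) x + i.negOnePow • M.actA e₂ a (M.d ej x)
  d_d : ∀ {i j n : ℤ} (e₁ : i + 1 = j) (e₂ : j + 1 = n) (e : 2 + i = n) (x : M.N i),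
    M.d e₂ (M.d e₁ x) = M.actA e X.h x

/-- The data of a graded right module with differential over the data of a CDG Lie algebroid. -/
structure RightModuleData (X : CDGData k) where
  N : ℤ → Type w
  [addN : ∀ n, AddCommGroup (N n)]
  [modN : ∀ n, Module k (N n)]
  actR : ∀ {i j n : ℤ}, i + j = n → (N i →ₗ[k] X.R j →ₗ[k] N n)
  actA : ∀ {i j n : ℤ}, i + j = n → (N i →ₗ[k] X.A j →ₗ[k] N n)
  d : ∀ {i n : ℤ}, i + 1 = n → (N i →ₗ[k] N n)

attribute [instance] RightModuleData.addN RightModuleData.modN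

/-- Right CDG-modules; in particular `d² x = - x h`, the sign being forced by the Leibniz rule and
`d² a = [h, a]`. -/
structure IsRightCDGModule {X : CDGData k} (M : RightModuleData X) : Prop where
  act_one : ∀ {i : ℤ} (e : i + 0 = i) (x : M.N i), M.actR e x X.one = x
  act_mul : ∀ {i j l ij jl n : ℤ} (e₁ : i + j = ij) (e₂ : ij + l = n) (e₃ : j + l = jl)
    (e₄ : i + jl = n) (x : M.N i) (r : X.R j) (s : X.R l),
    M.actR e₂ (M.actR e₁ x r) s = M.actR e₄ x (X.mul e₃ r s)
  act_smul : ∀ {i j l ij jl n : ℤ} (e₁ : i + j = ij) (e₂ : ij + l = n) (e₃ : j + l = jl)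
    (e₄ : i + jl = n) (x : M.N i) (r : X.R j) (a : X.A l),
    M.actA e₂ (M.actR e₁ x r) a = M.actA e₄ x (X.smul e₃ r a)
  act_anchor : ∀ {i j l ij il jl n : ℤ} (e₁ : i + j = ij) (e₂ : ij + l = n) (e₃ : i + l = il)
    (e₄ : il + j = n) (e₅ : j + l = jl) (e₆ : i + jl = n) (x : M.N i) (a : X.A j) (r : X.R l),
    M.actR e₆ x (X.anchor e₅ a r) = M.actR e₂ (M.actA e₁ x a) r -
      (j * l).negOnePow • M.actA e₄ (M.actR e₃ x r) a
  act_bracket : ∀ {i j l ij il jl n : ℤ} (e₁ : i + j = ij) (e₂ : ij + l = n) (e₃ : i + l = il)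
    (e₄ : il + j = n) (e₅ : j + l = jl) (e₆ : i + jl = n) (x : M.N i) (a : X.A j) (b : X.A l),
    M.actA e₆ x (X.bracket e₅ a b) = M.actA e₂ (M.actA e₁ x a) b -
      (j * l).negOnePow • M.actA e₄ (M.actA e₃ x b) a
  d_actR : ∀ {i j n i' j' n' : ℤ} (e : i + j = n) (ei : i + 1 = i') (ej : j + 1 = j')
    (en : n + 1 = n') (e₁ : i' + j = n') (e₂ : i + j' = n') (x : M.N i) (r : X.R j),
    M.d en (M.actR e x r) = M.actR e₁ (M.d ei x) r + i.negOnePow • M.actR e₂ x (X.dR ej r)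
  d_actA : ∀ {i j n i' j' n' : ℤ} (e : i + j = n) (ei : i + 1 = i') (ej : j + 1 = j')
    (en : n + 1 = n') (e₁ : i' + j = n') (e₂ : i + j' = n') (x : M.N i) (a : X.A j),
    M.d en (M.actA e x a) = M.actA e₁ (M.d ei x) a + i.negOnePow • M.actA e₂ x (X.dA ej a)
  d_d : ∀ {i j n : ℤ} (e₁ : i + 1 = j) (e₂ : j + 1 = n) (e : i + 2 = n) (x : M.N i),
    M.d e₂ (M.d e₁ x) = -M.actA e x X.h

/-- Right CDG-modules over a unital CDG Lie algebroid: the unit acts as the identity. -/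
structure IsUnitalRightCDGModule {P : UnitalCDGData k}
    (M : RightModuleData P.toCDGData) : Prop extends IsRightCDGModule M where
  act_unit : ∀ {i : ℤ} (e : i + 0 = i) (x : M.N i), M.actA e x P.unit = x

/-- Morphisms of unital CDG Lie algebroids. -/
structure UnitalHom (X Y : UnitalCDGData k) where
  onR : ∀ n, X.R n →ₗ[k] Y.R n
  onA : ∀ n, X.A n →ₗ[k] Y.A n
  map_one : onR 0 X.one = Y.one
  map_mul : ∀ {i j n : ℤ} (e : i + j = n) (r : X.R i) (s : X.R j),
    onR n (X.mul e r s) = Y.mul e (onR i r) (onR j s)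
  map_smul : ∀ {i j n : ℤ} (e : i + j = n) (r : X.R i) (a : X.A j),
    onA n (X.smul e r a) = Y.smul e (onR i r) (onA j a)
  map_bracket : ∀ {i j n : ℤ} (e : i + j = n) (a : X.A i) (b : X.A j),
    onA n (X.bracket e a b) = Y.bracket e (onA i a) (onA j b)
  map_anchor : ∀ {i j n : ℤ} (e : i + j = n) (a : X.A i) (r : X.R j),
    onR n (X.anchor e a r) = Y.anchor e (onA i a) (onR j r)
  map_dR : ∀ {i n : ℤ} (e : i + 1 = n) (r : X.R i), onR n (X.dR e r) = Y.dR e (onR i r)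
  map_dA : ∀ {i n : ℤ} (e : i + 1 = n) (a : X.A i), onA n (X.dA e a) = Y.dA e (onA i a)
  map_h : onA 2 X.h = Y.h
  map_unit : onA 0 X.unit = Y.unit

/-- Isomorphisms of unital CDG Lie algebroids: bijective morphisms. -/
structure UnitalHom.IsIso {X Y : UnitalCDGData k} (Φ : UnitalHom X Y) : Prop where
  onR : ∀ n, Function.Bijective (Φ.onR n)
  onA : ∀ n, Function.Bijective (Φ.onA n)

/-- Given an isomorphism `Φ` from `P` to the opposite of a CDG Lie algebroid `X`, a right module
over `P` becomes a left module over `X`: `r x = (-1)^{|r||x|} x Φ⁻¹(r)` and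
`a x = (-1)^{|a||x|} x Φ⁻¹(a)`, with the same differential. -/
def leftOfRight {P : UnitalCDGData k} {X : CDGData k}
    (Φ : UnitalHom P (opp (adjoinUnit X))) (hΦ : Φ.IsIso)
    (M : RightModuleData P.toCDGData) : LeftModuleData X where
  N := M.N
  actR {i j _} e := (i * j).negOnePow •
    ((M.actR ((add_comm j i).trans e)).flip ∘ₗ
      (LinearEquiv.ofBijective (Φ.onR i) (hΦ.onR i)).symm.toLinearMap)
  actA {i j _} e := (i * j).negOnePow •
    ((M.actA ((add_comm j i).trans e)).flip ∘ₗ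
      (LinearEquiv.ofBijective (Φ.onA i) (hΦ.onA i)).symm.toLinearMap ∘ₗ
        LinearMap.inr k (X.R i) (X.A i))
  d e := M.d e

end CDG

/-! ### The exterior coalgebra and its dual -/

section Exterior

variable (k : Type u) [Field k] (c : Type v) [AddCommGroup c] [Module k c]

/-- The grading of `Λ c` by exterior powers. -/
abbrev extGrading : ℕ → Submodule k (ExteriorAlgebra k c) := fun i => ⋀[k]^i c

/-- `x ↦ x ⊗ 1 + 1 ⊗ x`, from `c` to the super tensor square of `Λ c`. -/
def primitive : c →ₗ[k] GradedTensorProduct k (extGrading k c) (extGrading k c) :=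
  ((GradedTensorProduct.includeLeft (extGrading k c) (extGrading k c)).toLinearMap +
    (GradedTensorProduct.includeRight (extGrading k c) (extGrading k c)).toLinearMap) ∘ₗ
      ExteriorAlgebra.ι k

open GradedTensorProduct in
theorem primitive_mul_self (m : c) : primitive k c m * primitive k c m = 0 := by
  have hm : ExteriorAlgebra.ι k m ∈ extGrading k c 1 := by
    simp [extGrading]
  have hxx : ExteriorAlgebra.ι k m * ExteriorAlgebra.ι k m = 0 := ExteriorAlgebra.ι_sq_zero m
  simp only [primitive, LinearMap.comp_apply, LinearMap.add_apply, AlgHom.toLinearMap_apply]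
  generalize ExteriorAlgebra.ι k m = x at hm hxx
  rw [mul_add, add_mul, add_mul, ← map_mul, ← map_mul, hxx, map_zero, map_zero]
  have h1 : (includeLeft (extGrading k c) (extGrading k c)) x *
      (includeRight (extGrading k c) (extGrading k c)) x = x ᵍ⊗ₜ[k] x := by
    simpa using tmul_one_mul_one_tmul (R := k) (extGrading k c) (extGrading k c) x x
  have h2 : (includeRight (extGrading k c) (extGrading k c)) x *
      (includeLeft (extGrading k c) (extGrading k c)) x = -(x ᵍ⊗ₜ[k] x) := by
    simpa using
      tmul_coe_mul_coe_tmul (R := k) (extGrading k c) (extGrading k c) 1 ⟨x, hm⟩ ⟨x, hm⟩ 1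
  rw [h1, h2]
  simp

/-- The comultiplication `ξ ↦ ∑ ξ' ⊗ ξ''` of `Λ c`: the algebra map to the super tensor square of
`Λ c` with `x ↦ x ⊗ 1 + 1 ⊗ x` for `x ∈ c`. -/
def comul : ExteriorAlgebra k c →ₗ[k] ExteriorAlgebra k c ⊗[k] ExteriorAlgebra k c :=
  (GradedTensorProduct.of k (extGrading k c) (extGrading k c)).symm.toLinearMap ∘ₗ
    (ExteriorAlgebra.lift k ⟨primitive k c, primitive_mul_self k c⟩).toLinearMap

/-- The projection of `Λ c` to its component of degree `n ∈ ℤ`. -/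
def degProj (n : ℤ) : ExteriorAlgebra k c →ₗ[k] ExteriorAlgebra k c :=
  if 0 ≤ n then GradedAlgebra.proj (extGrading k c) n.toNat else 0

variable {k c}
variable {V W Z : Type*} [AddCommMonoid V] [Module k V] [AddCommMonoid W] [Module k W]
  [AddCommMonoid Z] [Module k Z]

/-- The convolution `ξ ↦ ∑ β (f ξ') (f' ξ'')`. -/
def conv (β : V →ₗ[k] W →ₗ[k] Z) :
    (ExteriorAlgebra k c →ₗ[k] V) →ₗ[k] (ExteriorAlgebra k c →ₗ[k] W) →ₗ[k]
      (ExteriorAlgebra k c →ₗ[k] Z) :=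
  LinearMap.mk₂ k (fun f f' => TensorProduct.lift β ∘ₗ TensorProduct.map f f' ∘ₗ comul k c)
    (fun f₁ f₂ f' => by rw [TensorProduct.map_add_left, LinearMap.add_comp, LinearMap.comp_add])
    (fun t f f' => by rw [TensorProduct.map_smul_left, LinearMap.smul_comp, LinearMap.comp_smul])
    (fun f f₁ f₂ => by rw [TensorProduct.map_add_right, LinearMap.add_comp, LinearMap.comp_add])
    (fun t f f' => by rw [TensorProduct.map_smul_right, LinearMap.smul_comp, LinearMap.comp_smul])

variable (k c V) in
/-- The linear maps `Λ c → V` that vanish on `Λ^m c` for `m ≠ n`: the component of degree `n` of the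
completed tensor product `V ⊗ Λ(c*)`, i.e. `Hom(Λ^n c, V)`. -/
def Coch (n : ℤ) : Submodule k (ExteriorAlgebra k c →ₗ[k] V) :=
  LinearMap.range (LinearMap.lcomp k V (degProj k c n))

/-- The projection of `Hom(Λ c, V)` to its component of degree `n`. -/
def cochProj (n : ℤ) : (ExteriorAlgebra k c →ₗ[k] V) →ₗ[k] Coch k c V n :=
  (LinearMap.lcomp k V (degProj k c n)).rangeRestrict

/-- The component `(i, j) → n` of a bilinear operation on cochains. -/
def cochComp₂ (i j n : ℤ)
    (F : (ExteriorAlgebra k c →ₗ[k] V) →ₗ[k] (ExteriorAlgebra k c →ₗ[k] W) →ₗ[k]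
      (ExteriorAlgebra k c →ₗ[k] Z)) :
    Coch k c V i →ₗ[k] Coch k c W j →ₗ[k] Coch k c Z n :=
  (F.compl₁₂ (Coch k c V i).subtype (Coch k c W j).subtype).compr₂ (cochProj n)

/-- The component `i → n` of a linear operation on cochains. -/
def cochComp₁ (i n : ℤ)
    (F : (ExteriorAlgebra k c →ₗ[k] V) →ₗ[k] (ExteriorAlgebra k c →ₗ[k] W)) :
    Coch k c V i →ₗ[k] Coch k c W n :=
  cochProj n ∘ₗ F ∘ₗ (Coch k c V i).subtype

variable (k c) in
/-- Exterior multiplication `c ⊗ Λ c → Λ c`. -/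
def wedge : c →ₗ[k] ExteriorAlgebra k c →ₗ[k] ExteriorAlgebra k c :=
  LinearMap.mul k (ExteriorAlgebra k c) ∘ₗ ExteriorAlgebra.ι k

end Exterior

/-! ### The main construction -/

section Construction

/-- A vector space `G` with an alternating bracket and a decomposition `G = b ⊕ c`. -/
structure SplitBracket (k : Type u) [Field k] (G b c : Type*) [AddCommGroup G] [Module k G]
    [AddCommGroup b] [Module k b] [AddCommGroup c] [Module k c] where
  br : G →ₗ[k] G →ₗ[k] G
  self : ∀ x, br x x = 0
  e : G ≃ₗ[k] b × c

namespace SplitBracket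

variable {k : Type u} [Field k] {G b c : Type*} [AddCommGroup G] [Module k G]
    [AddCommGroup b] [Module k b] [AddCommGroup c] [Module k c] (S : SplitBracket k G b c)

def inB : b →ₗ[k] G := S.e.symm.toLinearMap ∘ₗ LinearMap.inl k b c
def inC : c →ₗ[k] G := S.e.symm.toLinearMap ∘ₗ LinearMap.inr k b c
def prB : G →ₗ[k] b := LinearMap.fst k b c ∘ₗ S.e.toLinearMap
def prC : G →ₗ[k] c := LinearMap.snd k b c ∘ₗ S.e.toLinearMap

/-- The components `μ_b : b ∧ b → b`, `μ₁ : b ⊗ c → c`, `μ₂ : b ⊗ c → b` of the bracket. -/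
def muB : b →ₗ[k] b →ₗ[k] b := (S.br.compl₁₂ S.inB S.inB).compr₂ S.prB
def mu1 : b →ₗ[k] c →ₗ[k] c := (S.br.compl₁₂ S.inB S.inC).compr₂ S.prC
def mu2 : b →ₗ[k] c →ₗ[k] b := (S.br.compl₁₂ S.inB S.inC).compr₂ S.prB

/-- The bracket of `G` on `c ∧ c`, as an alternating map. -/
def brC : c [⋀^Fin 2]→ₗ[k] G where
  toFun v := S.br (S.inC (v 0)) (S.inC (v 1))
  map_update_add' v i x y := by
    fin_cases i <;> simp
  map_update_smul' v i t x := by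
    fin_cases i <;> simp
  map_eq_zero_of_eq' v i j h hij := by
    fin_cases i <;> fin_cases j <;> simp_all [S.self]

/-- The component `μ_c : Λ² c → c` of the bracket, extended by zero to `Λ c`. -/
def muC : ExteriorAlgebra k c →ₗ[k] c :=
  ExteriorAlgebra.liftAlternating (Pi.single 2 (S.prC.compAlternatingMap S.brC))

/-- The component `h* : Λ² c → b` of the bracket, extended by zero to `Λ c`. -/
def hStar : ExteriorAlgebra k c →ₗ[k] b :=
  ExteriorAlgebra.liftAlternating (Pi.single 2 (S.prB.compAlternatingMap S.brC))

/-- The action of `b` on `Λ c` by derivations extending `μ₁`: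
`x • ξ = ∑ μ₁(x, ξ'_1) ∧ ξ''`, where `ξ'_1` is the component of degree `1`. -/
def lambdaAct : b →ₗ[k] (ExteriorAlgebra k c →ₗ[k] ExteriorAlgebra k c) :=
  (conv (wedge k c)).flip LinearMap.id ∘ₗ LinearMap.lcomp k c ExteriorAlgebra.ιInv ∘ₗ S.mu1

/-- For `a : Λ c → b`, the operator `ξ ↦ ∑ a(ξ') • ξ''` on `Λ c`. -/
def cochAct : (ExteriorAlgebra k c →ₗ[k] b) →ₗ[k] (ExteriorAlgebra k c →ₗ[k] ExteriorAlgebra k c) :=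
  (conv S.lambdaAct).flip LinearMap.id

/-- The coderivation of `Λ c` of degree `-1` extending `μ_c`:
`x₁ ∧ … ∧ xₙ ↦ ∑_{i<j} (-1)^{i+j+1} μ_c(x_i, x_j) ∧ x₁ ∧ … x̂_i … x̂_j … ∧ xₙ`. -/
def bd : ExteriorAlgebra k c →ₗ[k] ExteriorAlgebra k c :=
  conv (wedge k c) S.muC LinearMap.id

/-- The super commutator on `b ⊗ Λ(c*)`, generated by the bracket of `b` and the action of `b` on
`Λ(c*)`: for `a`, `a'` of degrees `i`, `j` it is
`ξ ↦ ∑ [a(ξ'), a'(ξ'')] - a'(∑ a(ξ') • ξ'') + (-1)^{ij} a(∑ a'(ξ') • ξ'')`. -/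
def bracketTot (i j : ℤ) : (ExteriorAlgebra k c →ₗ[k] b) →ₗ[k] (ExteriorAlgebra k c →ₗ[k] b) →ₗ[k]
    (ExteriorAlgebra k c →ₗ[k] b) :=
  conv S.muB +
  LinearMap.mk₂ k
    (fun a a' => -(a' ∘ₗ S.cochAct a) + (i * j).negOnePow • (a ∘ₗ S.cochAct a'))
    (by intros; simp [LinearMap.comp_add, LinearMap.add_comp]; abel)
    (fun t a a' => by
      simp only [map_smul, LinearMap.comp_smul, LinearMap.smul_comp, smul_add, smul_neg]
      rw [smul_comm])
    (by intros; simp [LinearMap.comp_add, LinearMap.add_comp]; abel)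
    (fun t a a' => by
      simp only [map_smul, LinearMap.comp_smul, LinearMap.smul_comp, smul_add, smul_neg]
      rw [smul_comm])

/-- The action of `b ⊗ Λ(c*)` on `Λ(c*)`, `Λ(c*)`-linear in the first argument and generated by the
action of `b` on `c* ⊆ g*` dual to `μ₁`: `a(r)(ξ) = - r(∑ a(ξ') • ξ'')`. -/
def anchorTot : (ExteriorAlgebra k c →ₗ[k] b) →ₗ[k] (ExteriorAlgebra k c →ₗ[k] k) →ₗ[k]
    (ExteriorAlgebra k c →ₗ[k] k) :=
  LinearMap.mk₂ k (fun a r => -(r ∘ₗ S.cochAct a))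
    (by intros; simp [LinearMap.comp_add]; abel)
    (by intros; simp [LinearMap.comp_smul])
    (by intros; simp [LinearMap.add_comp]; abel)
    (by intros; simp [LinearMap.smul_comp])

/-- The main construction: `R = Λ(c*)`, `A = b ⊗ Λ(c*)` (completed; `R_n = Hom(Λ^n c, k)` and
`A_n = Hom(Λ^n c, b)`), with `d_R` the derivation generated by the dual of `μ_c`, `d_A` the
derivation extending `d_R` and generated by the map `b → b ⊗ c*` given by `μ₂`, and `h` the
component `h* : Λ² c → b` of the bracket. -/
def cdg : CDGData k where
  R n := Coch k c k n
  A n := Coch k c b n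
  one := cochProj 0 ExteriorAlgebra.algebraMapInv.toLinearMap
  mul {i j n} _ := cochComp₂ i j n (conv (LinearMap.mul k k))
  smul {i j n} _ := cochComp₂ i j n (conv (LinearMap.lsmul k b))
  bracket {i j n} _ := cochComp₂ i j n (S.bracketTot i j)
  anchor {i j n} _ := cochComp₂ i j n S.anchorTot
  dR {i n} _ := cochComp₁ i n (LinearMap.lcomp k k S.bd)
  dA {i n} _ := cochComp₁ i n
    (LinearMap.lcomp k b S.bd + i.negOnePow • (conv S.mu2).flip ExteriorAlgebra.ιInv)
  h := cochProj 2 S.hStar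

/-- The inclusion `b → A_0 = b ⊗ Λ^0(c*)`. -/
def constA : b →ₗ[k] Coch k c b 0 :=
  cochProj 0 ∘ₗ LinearMap.smulRightₗ ExteriorAlgebra.algebraMapInv.toLinearMap

section Module

variable {M : Type*} [AddCommGroup M] [Module k M]

variable (k c M) in
/-- The component of degree `n` of `Λ(c) ⊗ M`, i.e. `Λ^{-n}(c) ⊗ M`. -/
def modDeg (n : ℤ) : Submodule k (ExteriorAlgebra k c ⊗[k] M) :=
  LinearMap.range (LinearMap.rTensor M (degProj k c (-n)))

/-- The projection of `Λ(c) ⊗ M` to its component of degree `n`. -/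
def modProj (n : ℤ) : (ExteriorAlgebra k c ⊗[k] M) →ₗ[k] modDeg k c M n :=
  (LinearMap.rTensor M (degProj k c (-n))).rangeRestrict

/-- The operator `x ⊗ y ↦ x ⊗ f y`, as a function of `f` and `x`. -/
def tmulOp : Module.End k M →ₗ[k] ExteriorAlgebra k c →ₗ[k] (M →ₗ[k] ExteriorAlgebra k c ⊗[k] M) :=
  LinearMap.mk₂ k (fun f x => TensorProduct.mk k _ M x ∘ₗ f)
    (by intros; simp [LinearMap.comp_add]) (by intros; simp [LinearMap.comp_smul])
    (by intros; simp [LinearMap.add_comp]) (by intros; simp [LinearMap.smul_comp])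

/-- For `f : Λ c → End M`, the operator `ξ ⊗ m ↦ ∑ ξ'' ⊗ f(ξ') m` on `Λ c ⊗ M`. -/
def insertOp : (ExteriorAlgebra k c →ₗ[k] Module.End k M) →ₗ[k]
    (ExteriorAlgebra k c ⊗[k] M →ₗ[k] ExteriorAlgebra k c ⊗[k] M) where
  toFun f := TensorProduct.lift (conv (tmulOp (c := c) (M := M)) f LinearMap.id)
  map_add' f f' := by
    rw [map_add, LinearMap.add_apply]
    exact map_add (TensorProduct.uncurry (.id k) (ExteriorAlgebra k c) M _) _ _
  map_smul' t f := by
    rw [map_smul, LinearMap.smul_apply]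
    exact map_smul (TensorProduct.uncurry (.id k) (ExteriorAlgebra k c) M _) _ _

/-- The component `(i, cochains of degree j) → n` of an action of cochains on `Λ(c) ⊗ M`. -/
def actComp {V : Type*} [AddCommGroup V] [Module k V] (i j n : ℤ)
    (F : (ExteriorAlgebra k c →ₗ[k] V) →ₗ[k]
      (ExteriorAlgebra k c ⊗[k] M →ₗ[k] ExteriorAlgebra k c ⊗[k] M)) :
    modDeg k c M i →ₗ[k] Coch k c V j →ₗ[k] modDeg k c M n :=
  (F.flip.compl₁₂ (modDeg k c M i).subtype (Coch k c V j).subtype).compr₂ (modProj n)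

variable (ρ : G →ₗ[k] Module.End k M)

/-- The operators `ξ ⊗ m ↦ - ∑ (a(ξ') • ξ'' ⊗ m + ξ'' ⊗ a(ξ') m)`, for `a : Λ c → b`. -/
def rightAct : (ExteriorAlgebra k c →ₗ[k] b) →ₗ[k]
    (ExteriorAlgebra k c ⊗[k] M →ₗ[k] ExteriorAlgebra k c ⊗[k] M) :=
  -(LinearMap.rTensorHom M ∘ₗ S.cochAct +
    insertOp (c := c) (M := M) ∘ₗ
      LinearMap.llcomp k (ExteriorAlgebra k c) b (Module.End k M) (ρ ∘ₗ S.inB))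

/-- The right module `Λ(c) ⊗ M` over `b ⊗ Λ(c*)` attached to a `G`-module `M` (`M` in degree `0`,
`c` in degree `-1`): `R = Λ(c*)` acts by contractions, `(ξ ⊗ m) r = ∑ r(ξ') ξ'' ⊗ m`; an element `a`
of `A = b ⊗ Λ(c*)` acts by minus the tensor product action of `b` preceded by contraction,
`(ξ ⊗ m) a = - ∑ (a(ξ') • ξ'' ⊗ m + ξ'' ⊗ a(ξ') m)`; and the differential is
`d(ξ ⊗ m) = (-1)^{|ξ|+1} (∂ξ ⊗ m + ∑ ξ'' ⊗ ξ'_1 m)`, with `∂` extending `μ_c` and `ξ'_1 ∈ c` the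
component of degree one. -/
def rightModule : RightModuleData S.cdg where
  N n := modDeg k c M n
  actR {i j n} _ := actComp i j n
    (LinearMap.rTensorHom M ∘ₗ
      (conv (LinearMap.lsmul k (ExteriorAlgebra k c))).flip LinearMap.id)
  actA {i j n} _ := actComp i j n (S.rightAct ρ)
  d {i n} _ := modProj n ∘ₗ
    ((i + 1).negOnePow • (LinearMap.rTensor M S.bd +
      insertOp (ρ ∘ₗ S.inC ∘ₗ ExteriorAlgebra.ιInv))) ∘ₗ (modDeg k c M i).subtype

end Module

end SplitBracket

end Construction

/-! ### The CDG Lie algebroids attached to a Tate Lie algebra with a c-lattice subalgebra -/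

section Main

variable {k : Type u} [Field k] {g : Type v} [AddCommGroup g] [Module k g]
  [TopologicalSpace g] {br : g →ₗ[k] g →ₗ[k] g} (hg : IsTateLieAlgebra br)
  {B : Submodule k g} (hB : IsCLattice B) (s : (g ⧸ B) →ₗ[k] g) (hs : ∀ x, B.mkQ (s x) = x)

/-- `g = b ⊕ c` with `c = g/b`. -/
def splitG : SplitBracket k g B (g ⧸ B) where
  br := br
  self := hg.self
  e := splitting B s hs

/-- The bracket of the central extension `g^♯` of `g` by the critical cocycle. -/
def sharpBr : CentralExt k g →ₗ[k] CentralExt k g →ₗ[k] CentralExt k g :=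
  centralBr br (criticalCocycle s hs hg hB)

/-- `g^♯ = (b ⊕ k K) ⊕ c` with `c = g/b = g^♯/(b ⊕ k K)`. -/
def splitGSharp : SplitBracket k (CentralExt k g) (B × k) (g ⧸ B) where
  br := sharpBr hg hB s hs
  self x := Prod.ext (hg.self x.1) (criticalCocycle_self s hs hg hB x.1)
  e := (LinearEquiv.prodCongr (splitting B s hs) (LinearEquiv.refl k k) :
      (g × k) ≃ₗ[k] (B × (g ⧸ B)) × k).trans
    ((LinearEquiv.prodAssoc k B (g ⧸ B) k).trans
      (((LinearEquiv.refl k B).prodCongr (LinearEquiv.prodComm k (g ⧸ B) k)).trans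
        (LinearEquiv.prodAssoc k B k (g ⧸ B)).symm))

/-- The CDG Lie algebroid `(A, R, d_A, d_R, h)` of the pair `b ⊆ g`. -/
def algebroid : CDGData k := (splitG hg s hs).cdg

/-- The CDG Lie algebroid of the pair `b ⊕ k K ⊆ g^♯`. -/
def algebroidTilde : CDGData k := (splitGSharp hg hB s hs).cdg

/-- The result `A^♯` of setting `K = 1` in the CDG Lie algebroid of the pair `b ⊕ k K ⊆ g^♯`. -/
def algebroidSharp : UnitalCDGData k where
  toCDGData := algebroidTilde hg hB s hs
  unit := SplitBracket.constA ((0, 1) : B × k)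

end Main

end Semiinf

end

open Semiinf

set_option linter.unusedSimpArgs false

noncomputable section

namespace Semiinf

/-! Everything takes place in one convolution calculus. Elements of `R` and `A` are linear maps out
of the coalgebra `ExteriorAlgebra k c`, products and pointwise brackets are convolutions `conv`, and
the anchor and the differentials come from precomposition with coderivations `coder u`. Three facts
suffice for computing: convolution is associative (`conv_assoc`) and graded commutative
(`conv_comm`), and coderivations obey the Leibniz rule (`conv_comp_coder`).

The CDG axioms are shadows of the Jacobi identity of `G = b ⊕ c`. Let θ be the tautological
1-cochain `gen` with values in `c ⊆ G`. Then [a, θ] has components `corB a` and `corC a` for a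
`b`-valued cochain a, [θ, θ] is 2(h + μ_c), and θ ∘ `coder u` = u. The Jacobi identity for (a, a',
θ), (a, θ, θ) and (θ, θ, θ), compared with the Leibniz rule, determines `corB` and `corC` of a
bracket, of a differential and of the curvature (`gen_bracket`, `gen_dA`, `gen_hStar`). These
formulas give the axioms; characteristic 0 serves to divide by 2 and 3. The same calculus with
values in `End M`, acting on `Λ c ⊗ M` by `insertOp`, gives the right module attached to a
representation.

The isomorphism sends a pair consisting of a `b`-component a and a `K`-component t to t + `dvg a` in
`R` and -a in `A`. The divergence `dvg a` is a regularised trace: formally it is the trace of the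
action of a on `c` through μ₁ minus, up to sign, the divergence of the vector field `corC a`. Both
traces may be infinite, but the difference `trOp a` has finite rank (`trOp_eq`, `finite_trOp`),
because `x ↦ μ₁(x, z)` has finite rank: the bracket is continuous and `b` is a c-lattice. Four
properties of `dvg` give the isomorphism. Under multiplication by `R` it fails to be linear by
exactly the twist of the opposite module structure (`dvg_smul`); it is compatible with brackets,
since traces of commutators with a finite-rank factor vanish (`dvg_bracket`); its failure to commute
with d is minus the `K`-component of μ₂ in `g^♯` (`dvg_dA`); and its value on h is minus the
`K`-component of the new curvature (`snd_hStar`). The last two are where the critical cocycle ω₀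
enters, through its values on `b × c` and `c × c`; on `b × b` it vanishes
(`splitGSharp_isCriticalExt`).

It remains that ω₀ is a continuous cocycle. Its cocycle identity is the Jacobi identity in block
form with cyclicity of the trace, and ω₀(-, y) vanishes near 0 because only finitely many vectors
have to be controlled (`criticalCocycle_eq_zero_of_forall`). Passage from right to left modules is
transport along Φ⁻¹, followed by the change of side for the opposite of `R ⊕ A`. -/

/-! ### Signs -/

section Sign

/-- The sign `(-1)^n` as an element of `k`. -/
def sg (k : Type*) [Field k] (n : ℤ) : k := ((n.negOnePow : ℤ) : k)

variable {k : Type*} [Field k]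

/-- The axioms carry their signs as units of `ℤ`. Turned into scalars of `k`, they pass through
linear maps and can be normalised by `module`. -/
theorem negOnePow_smul_eq {V : Type*} [AddCommGroup V] [Module k V] (n : ℤ) (x : V) :
    n.negOnePow • x = sg k n • x := by
  rw [Units.smul_def, sg, Int.cast_smul_eq_zsmul]

@[simp] theorem sg_zero : sg k 0 = 1 := by simp [sg]
@[simp] theorem sg_one : sg k 1 = -1 := by simp [sg]
@[simp] theorem sg_two : sg k 2 = 1 := by simp [sg, Int.negOnePow_even 2 (by decide)]

theorem sg_add (m n : ℤ) : sg k (m + n) = sg k m * sg k n := by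
  simp [sg, Int.negOnePow_add]

@[simp] theorem sg_neg (n : ℤ) : sg k (-n) = sg k n := by
  simp [sg]

theorem sg_sub (m n : ℤ) : sg k (m - n) = sg k m * sg k n := by
  rw [sub_eq_add_neg, sg_add, sg_neg]

/-- The sign computations below end in the same way: the exponents are expanded by `sg_add`, each
remaining sign is split into its two values, and the rest is linear algebra over `k`. -/
theorem sg_cases (n : ℤ) : sg k n = 1 ∨ sg k n = -1 := by
  rcases Int.even_or_odd n with h | h
  · left; simp [sg, Int.negOnePow_even n h]
  · right; simp [sg, Int.negOnePow_odd n h]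

@[simp] theorem sg_mul_self (n : ℤ) : sg k n * sg k n = 1 := by
  rcases sg_cases (k := k) n with h | h <;> simp [h]

end Sign

/-! ### The exterior coalgebra -/

section Coalgebra

variable {k : Type u} [Field k] {c : Type v} [AddCommGroup c] [Module k c]

local notation "Λ" => ExteriorAlgebra k c

/-- The step `ξ ↦ x ∧ ξ` matches the recursion `comul_ι_mul`, so identities between convolutions
need no sums over shuffles. -/
theorem ext_induction {P : Λ → Prop} (one : P 1) (add : ∀ x y, P x → P y → P (x + y))
    (smul : ∀ (t : k) x, P x → P (t • x))
    (ι_mul : ∀ x ξ, P ξ → P (ExteriorAlgebra.ι k x * ξ)) (ξ : Λ) : P ξ := by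
  induction ξ using CliffordAlgebra.left_induction with
  | algebraMap r => rw [Algebra.algebraMap_eq_smul_one]; exact smul r 1 one
  | add x y hx hy => exact add x y hx hy
  | ι_mul x m h => exact ι_mul m x h

variable (k c) in
/-- The parity involution of the exterior algebra. -/
def parity : Λ →ₗ[k] Λ := (CliffordAlgebra.involute (Q := (0 : QuadraticForm k c))).toLinearMap

@[simp] theorem parity_one : parity k c 1 = 1 := map_one CliffordAlgebra.involute

@[simp] theorem parity_ι_mul (x : c) (ξ : Λ) :
    parity k c (ExteriorAlgebra.ι k x * ξ) = -(ExteriorAlgebra.ι k x * parity k c ξ) := by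
  simp only [parity, AlgHom.toLinearMap_apply, map_mul]
  rw [← neg_mul]
  congr 1
  exact CliffordAlgebra.involute_ι x

theorem extPow_induction {P : ℕ → Λ → Prop} (one : P 0 1)
    (add : ∀ m x y, P m x → P m y → P m (x + y)) (smul : ∀ m (t : k) x, P m x → P m (t • x))
    (ι_mul : ∀ m x ξ, ξ ∈ ⋀[k]^m c → P m ξ → P (m + 1) (ExteriorAlgebra.ι k x * ξ)) {m : ℕ}
    {ξ : Λ} (h : ξ ∈ ⋀[k]^m c) : P m ξ := by
  induction m generalizing ξ with
  | zero =>
    rw [ExteriorAlgebra.exteriorPower, pow_zero, Submodule.mem_one] at h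
    obtain ⟨r, rfl⟩ := h
    rw [Algebra.algebraMap_eq_smul_one]
    exact smul 0 r 1 one
  | succ m ih =>
    rw [ExteriorAlgebra.exteriorPower, pow_succ'] at h
    refine Submodule.mul_induction_on h ?_ (add _)
    rintro _ ⟨x, rfl⟩ ξ hξ
    exact ι_mul m x ξ hξ (ih hξ)

theorem ι_mul_mem {m : ℕ} (x : c) {ξ : Λ} (h : ξ ∈ ⋀[k]^m c) :
    ExteriorAlgebra.ι k x * ξ ∈ ⋀[k]^(m + 1) c := by
  rw [ExteriorAlgebra.exteriorPower, pow_succ']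
  exact Submodule.mul_mem_mul ⟨x, rfl⟩ h

theorem one_mem_extPow : (1 : Λ) ∈ ⋀[k]^0 c := by
  rw [ExteriorAlgebra.exteriorPower, pow_zero]
  exact Submodule.one_le.1 le_rfl

theorem parity_of_mem {m : ℕ} {ξ : Λ} (h : ξ ∈ ⋀[k]^m c) : parity k c ξ = sg k (m : ℤ) • ξ := by
  refine extPow_induction (P := fun m ξ => parity k c ξ = sg k (m : ℤ) • ξ) ?_ ?_ ?_ ?_ h
  · simp
  · intro m x y hx hy; rw [map_add, hx, hy, smul_add]
  · intro m t x hx; rw [map_smul, hx, smul_comm]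
  · intro m x ξ hξ ih
    rw [parity_ι_mul, ih, mul_smul_comm, Nat.cast_succ, sg_add, sg_one, mul_neg_one, neg_smul]

theorem ext_decomp_induction {P : Λ → Prop} (add : ∀ x y, P x → P y → P (x + y))
    (mem : ∀ (m : ℕ) x, x ∈ ⋀[k]^m c → P x) (ξ : Λ) : P ξ := by
  refine DirectSum.Decomposition.inductionOn (extGrading k c) (motive := P) (mem 0 0 (zero_mem _))
    (fun {i} x => mem i x.1 x.2) (fun x y => add x y) ξ

theorem comul_one : comul k c 1 = 1 ⊗ₜ 1 := by
  simp only [comul, LinearMap.comp_apply, AlgHom.toLinearMap_apply, map_one]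
  rfl

/-- The comultiplication is multiplicative for the super tensor product and `x` is primitive; `1 ⊗
x` has to pass the left factor of the comultiplication of `ξ`, whence the parity involution. -/
theorem comul_ι_mul (x : c) (ξ : Λ) : comul k c (ExteriorAlgebra.ι k x * ξ) =
    TensorProduct.map (wedge k c x) LinearMap.id (comul k c ξ) +
      TensorProduct.map (parity k c) (wedge k c x) (comul k c ξ) := by
  simp only [comul, LinearMap.comp_apply, AlgHom.toLinearMap_apply, map_mul]
  generalize ExteriorAlgebra.lift k ⟨primitive k c, primitive_mul_self k c⟩ ξ = η
  rw [ExteriorAlgebra.lift_ι_apply]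
  obtain ⟨η, rfl⟩ := (GradedTensorProduct.of k (extGrading k c) (extGrading k c)).surjective η
  have hx : ExteriorAlgebra.ι k x ∈ extGrading k c 1 := by simp [extGrading]
  induction η using TensorProduct.induction_on with
  | zero => simp
  | add a b ha hb =>
    simp only [map_add, mul_add, LinearEquiv.coe_coe] at ha hb ⊢
    rw [ha, hb]; abel
  | tmul a b =>
    induction a using ext_decomp_induction with
    | add a a' ha hb =>
      simp only [TensorProduct.add_tmul, map_add, mul_add, LinearEquiv.coe_coe] at ha hb ⊢
      rw [ha, hb]; abel
    | mem m a hm =>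
      simp only [primitive, LinearMap.comp_apply, LinearMap.add_apply, AlgHom.toLinearMap_apply,
        add_mul, map_add, LinearEquiv.coe_coe]
      congr 1
      · have := GradedTensorProduct.tmul_one_mul_coe_tmul (R := k) (extGrading k c) (extGrading k c)
          (ExteriorAlgebra.ι k x) ⟨a, hm⟩ b
        exact congrArg _ this
      -- Here `x` has degree 1 and `a` degree `m`, so the sign of the interchange is `(-1)^m`, which
      -- is what parity does to `a`.
      · have := GradedTensorProduct.tmul_coe_mul_coe_tmul (R := k) (extGrading k c) (extGrading k c)
          1 ⟨_, hx⟩ ⟨a, hm⟩ b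
        refine (congrArg (GradedTensorProduct.of k (extGrading k c) (extGrading k c)).symm
          this).trans ?_
        rw [one_mul, one_mul, LinearEquiv.symm_apply_apply, TensorProduct.map_tmul,
          parity_of_mem hm, sg, Int.cast_smul_eq_zsmul, ← Units.smul_def]
        rfl

/-! ### Convolution and its associativity -/

section Conv

variable {V W Z : Type*} [AddCommGroup V] [Module k V] [AddCommGroup W] [Module k W]
  [AddCommGroup Z] [Module k Z]

theorem conv_apply (β : V →ₗ[k] W →ₗ[k] Z) (f : Λ →ₗ[k] V) (g : Λ →ₗ[k] W) (ξ : Λ) :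
    conv β f g ξ = TensorProduct.lift β (TensorProduct.map f g (comul k c ξ)) := rfl

theorem conv_one (β : V →ₗ[k] W →ₗ[k] Z) (f : Λ →ₗ[k] V) (g : Λ →ₗ[k] W) :
    conv β f g 1 = β (f 1) (g 1) := by
  rw [conv_apply, comul_one]; simp

theorem conv_ι_mul (β : V →ₗ[k] W →ₗ[k] Z) (f : Λ →ₗ[k] V) (g : Λ →ₗ[k] W) (x : c) (ξ : Λ) :
    conv β f g (ExteriorAlgebra.ι k x * ξ) = conv β (f ∘ₗ wedge k c x) g ξ +
      conv β (f ∘ₗ parity k c) (g ∘ₗ wedge k c x) ξ := by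
  rw [conv_apply, comul_ι_mul, map_add, map_add, conv_apply, conv_apply,
    ← LinearMap.comp_apply (TensorProduct.map f g), ← TensorProduct.map_comp,
    ← LinearMap.comp_apply (TensorProduct.map f g), ← TensorProduct.map_comp, LinearMap.comp_id]

/-- Since a convolution depends only on the values β(f ξ, g η), every pointwise identity between
bilinear expressions lifts to cochains. -/
theorem conv_congr_apply {V' W' Z' : Type*} [AddCommGroup V'] [Module k V'] [AddCommGroup W']
    [Module k W'] [AddCommGroup Z'] [Module k Z']
    (L : Z →ₗ[k] Z') {β : V →ₗ[k] W →ₗ[k] Z} {β' : V' →ₗ[k] W' →ₗ[k] Z'} {f : Λ →ₗ[k] V}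
    {g : Λ →ₗ[k] W} {f' : Λ →ₗ[k] V'} {g' : Λ →ₗ[k] W'}
    (h : ∀ ξ η, L (β (f ξ) (g η)) = β' (f' ξ) (g' η)) :
    L ∘ₗ conv β f g = conv β' f' g' := by
  have : L ∘ₗ TensorProduct.lift β ∘ₗ TensorProduct.map f g =
      TensorProduct.lift β' ∘ₗ TensorProduct.map f' g' := by
    exact TensorProduct.ext' fun ξ η => by simpa using h ξ η
  refine LinearMap.ext fun ξ => ?_
  exact LinearMap.congr_fun this (comul k c ξ)

theorem conv_congr {V' W' : Type*} [AddCommGroup V'] [Module k V'] [AddCommGroup W']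
    [Module k W'] {β : V →ₗ[k] W →ₗ[k] Z} {β' : V' →ₗ[k] W' →ₗ[k] Z} {f : Λ →ₗ[k] V}
    {g : Λ →ₗ[k] W} {f' : Λ →ₗ[k] V'} {g' : Λ →ₗ[k] W'}
    (h : ∀ ξ η, β (f ξ) (g η) = β' (f' ξ) (g' η)) : conv β f g = conv β' f' g' :=
  conv_congr_apply LinearMap.id h

/-- This is coassociativity of the exterior coalgebra, with four different pairings allowed. The
induction has to run over all cochains at once, as the recursion replaces each of them by its
composite with parity or with a wedge. -/
theorem conv_assoc {X VW WX : Type*} [AddCommGroup X] [Module k X] [AddCommGroup VW]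
    [Module k VW] [AddCommGroup WX] [Module k WX] {β : VW →ₗ[k] X →ₗ[k] Z}
    {γ : V →ₗ[k] W →ₗ[k] VW} {β' : V →ₗ[k] WX →ₗ[k] Z} {γ' : W →ₗ[k] X →ₗ[k] WX}
    (h : ∀ x y z, β (γ x y) z = β' x (γ' y z)) (f : Λ →ₗ[k] V) (g : Λ →ₗ[k] W) (l : Λ →ₗ[k] X) :
    conv β (conv γ f g) l = conv β' f (conv γ' g l) := by
  -- Parity respects the comultiplication. It is needed because the recursion for the outer
  -- convolution composes the inner one with parity.
  have parity_comp : ∀ f g, conv γ f g ∘ₗ parity k c =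
      conv γ (f ∘ₗ parity k c) (g ∘ₗ parity k c) := by
    intro f g
    refine LinearMap.ext fun ξ => ?_
    induction ξ using ext_induction generalizing f g with
    | one => simp [conv_one]
    | add x y hx hy => rw [map_add, map_add, hx, hy]
    | smul t x hx => rw [map_smul, map_smul, hx]
    | ι_mul x ξ ih =>
      have e : (f ∘ₗ parity k c) ∘ₗ wedge k c x = -((f ∘ₗ wedge k c x) ∘ₗ parity k c) :=
        LinearMap.ext fun ξ => (congrArg f (parity_ι_mul x ξ)).trans (map_neg f _)
      have e' : (g ∘ₗ parity k c) ∘ₗ wedge k c x = -((g ∘ₗ wedge k c x) ∘ₗ parity k c) :=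
        LinearMap.ext fun ξ => (congrArg g (parity_ι_mul x ξ)).trans (map_neg g _)
      have ih' : ∀ f g, conv γ f g (parity k c ξ) =
        conv γ (f ∘ₗ parity k c) (g ∘ₗ parity k c) ξ := ih
      rw [LinearMap.comp_apply, parity_ι_mul, map_neg, conv_ι_mul, conv_ι_mul, e, e', ih', ih',
        map_neg, map_neg, LinearMap.neg_apply, LinearMap.neg_apply, LinearMap.neg_apply, neg_add]
  refine LinearMap.ext fun ξ => ?_
  induction ξ using ext_induction generalizing f g l with
  | one => simp [conv_one, h]
  | add x y hx hy => rw [map_add, map_add, hx, hy]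
  | smul t x hx => rw [map_smul, map_smul, hx]
  | ι_mul x ξ ih =>
    have e1 : conv γ f g ∘ₗ wedge k c x = conv γ (f ∘ₗ wedge k c x) g +
      conv γ (f ∘ₗ parity k c) (g ∘ₗ wedge k c x) := by
      refine LinearMap.ext fun ξ => ?_; exact conv_ι_mul γ f g x ξ
    have e2 : conv γ' g l ∘ₗ wedge k c x = conv γ' (g ∘ₗ wedge k c x) l +
      conv γ' (g ∘ₗ parity k c) (l ∘ₗ wedge k c x) := by
      refine LinearMap.ext fun ξ => ?_; exact conv_ι_mul γ' g l x ξ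
    rw [conv_ι_mul, conv_ι_mul, e1, e2, parity_comp]
    simp only [map_add, LinearMap.add_apply, ih, add_assoc]

theorem conv_assoc_left {X VW WX : Type*} [AddCommGroup X] [Module k X] [AddCommGroup VW]
    [Module k VW] [AddCommGroup WX] [Module k WX] {β : VW →ₗ[k] X →ₗ[k] Z}
    {γ : V →ₗ[k] W →ₗ[k] VW} {β' : V →ₗ[k] WX →ₗ[k] Z} {γ' : W →ₗ[k] X →ₗ[k] WX}
    (h : ∀ x y z, β' x (γ' y z) = β (γ x y) z) (f : Λ →ₗ[k] V) (g : Λ →ₗ[k] W) (l : Λ →ₗ[k] X) :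
    conv β' f (conv γ' g l) = conv β (conv γ f g) l :=
  (conv_assoc (fun x y z => (h x y z).symm) f g l).symm

end Conv

/-! ### Homogeneous cochains -/

theorem degProj_of_mem {m : ℕ} {ξ : Λ} (h : ξ ∈ ⋀[k]^m c) (n : ℤ) :
    degProj k c n ξ = if (m : ℤ) = n then ξ else 0 := by
  by_cases hn : 0 ≤ n
  · lift n to ℕ using hn
    rw [degProj, if_pos (by positivity), Int.toNat_natCast, GradedAlgebra.proj_apply]
    by_cases e : m = n
    · subst e
      rw [if_pos rfl, DirectSum.decompose_of_mem_same (extGrading k c) h]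
    · rw [if_neg (by exact_mod_cast e), DirectSum.decompose_of_mem_ne (extGrading k c) h e]
  · rw [degProj, if_neg hn, if_neg (by omega), LinearMap.zero_apply]

section Coch

variable {V W Z : Type*} [AddCommGroup V] [Module k V] [AddCommGroup W] [Module k W]
  [AddCommGroup Z] [Module k Z]

/-- The data are defined through the range of a projection, whereas degree arguments by induction
need vanishing outside one exterior power. -/
theorem mem_coch_iff {n : ℤ} {f : Λ →ₗ[k] V} :
    f ∈ Coch k c V n ↔ ∀ m : ℕ, (m : ℤ) ≠ n → ∀ ξ ∈ ⋀[k]^m c, f ξ = 0 := by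
  constructor
  · rintro ⟨g, rfl⟩ m hm ξ hξ
    rw [LinearMap.lcomp_apply, degProj_of_mem hξ, if_neg hm, map_zero]
  · intro h
    refine ⟨f, LinearMap.ext fun ξ => ?_⟩
    rw [LinearMap.lcomp_apply]
    induction ξ using ext_decomp_induction with
    | add x y hx hy => rw [map_add, map_add, map_add, hx, hy]
    | mem m ξ hξ =>
      rw [degProj_of_mem hξ]
      split_ifs with e
      · rfl
      · rw [map_zero, h m e ξ hξ]

/-- The projections built into the operations of the main construction change nothing once the
degrees are known to be right. -/
theorem cochProj_of_mem {n : ℤ} {f : Λ →ₗ[k] V} (h : f ∈ Coch k c V n) :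
    (cochProj n f : Λ →ₗ[k] V) = f := by
  obtain ⟨g, rfl⟩ := h
  refine LinearMap.ext fun ξ => ?_
  induction ξ using ext_decomp_induction with
  | add x y hx hy => rw [map_add, map_add, hx, hy]
  | mem m ξ hξ =>
    change g (degProj k c n (degProj k c n ξ)) = g (degProj k c n ξ)
    rw [degProj_of_mem hξ]
    split_ifs with e
    · rw [degProj_of_mem hξ, if_pos e]
    · rw [map_zero]

theorem coch_ext {n : ℤ} {f g : Λ →ₗ[k] V} (hf : f ∈ Coch k c V n) (hg : g ∈ Coch k c V n)
    (h : ∀ m : ℕ, (m : ℤ) = n → ∀ ξ ∈ ⋀[k]^m c, f ξ = g ξ) : f = g := by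
  refine LinearMap.ext fun ξ => ?_
  induction ξ using ext_decomp_induction with
  | add x y hx hy => rw [map_add, map_add, hx, hy]
  | mem m ξ hξ =>
    by_cases e : (m : ℤ) = n
    · exact h m e ξ hξ
    · rw [mem_coch_iff.1 hf m e ξ hξ, mem_coch_iff.1 hg m e ξ hξ]

theorem comp_mem_coch (L : V →ₗ[k] W) {n : ℤ} {f : Λ →ₗ[k] V} (h : f ∈ Coch k c V n) :
    L ∘ₗ f ∈ Coch k c W n := by
  rw [mem_coch_iff] at h ⊢
  intro m hm ξ hξ
  rw [LinearMap.comp_apply, h m hm ξ hξ, map_zero]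

theorem comp_parity_of_mem {n : ℤ} {f : Λ →ₗ[k] V} (h : f ∈ Coch k c V n) :
    f ∘ₗ parity k c = sg k n • f := by
  refine LinearMap.ext fun ξ => ?_
  induction ξ using ext_decomp_induction with
  | add x y hx hy => rw [map_add, map_add, hx, hy]
  | mem m ξ hξ =>
    rw [LinearMap.comp_apply, parity_of_mem hξ, map_smul, LinearMap.smul_apply]
    by_cases e : (m : ℤ) = n
    · rw [e]
    · rw [mem_coch_iff.1 h m e ξ hξ, smul_zero, smul_zero]

theorem comp_wedge_mem_coch (x : c) {n : ℤ} {f : Λ →ₗ[k] V} (h : f ∈ Coch k c V n) :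
    f ∘ₗ wedge k c x ∈ Coch k c V (n - 1) := by
  rw [mem_coch_iff] at h ⊢
  intro m hm ξ hξ
  exact h (m + 1) (by push_cast; omega) _ (ι_mul_mem x hξ)

theorem conv_ι_mul_of_mem (β : V →ₗ[k] W →ₗ[k] Z) {i : ℤ} {f : Λ →ₗ[k] V}
    (hf : f ∈ Coch k c V i) (g : Λ →ₗ[k] W) (x : c) (ξ : Λ) :
    conv β f g (ExteriorAlgebra.ι k x * ξ) = conv β (f ∘ₗ wedge k c x) g ξ +
      sg k i • conv β f (g ∘ₗ wedge k c x) ξ := by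
  rw [conv_ι_mul, comp_parity_of_mem hf, map_smul, LinearMap.smul_apply, LinearMap.smul_apply]

theorem conv_mem_coch (β : V →ₗ[k] W →ₗ[k] Z) {i j n : ℤ} (e : i + j = n) {f : Λ →ₗ[k] V}
    {g : Λ →ₗ[k] W} (hf : f ∈ Coch k c V i) (hg : g ∈ Coch k c W j) :
    conv β f g ∈ Coch k c Z n := by
  subst e
  rw [mem_coch_iff]
  intro m hm ξ hξ
  revert hm
  refine extPow_induction (P := fun m ξ => ∀ {i j : ℤ} {f : Λ →ₗ[k] V} {g : Λ →ₗ[k] W},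
    f ∈ Coch k c V i → g ∈ Coch k c W j → (m : ℤ) ≠ i + j → conv β f g ξ = 0)
    ?_ ?_ ?_ ?_ hξ hf hg
  · intro i j f g hf hg hm
    rw [conv_one]
    by_cases hi : i = 0
    · rw [mem_coch_iff.1 hg 0 (by push_cast at hm ⊢; omega) 1 one_mem_extPow, map_zero]
    · rw [mem_coch_iff.1 hf 0 (by push_cast at hm ⊢; omega) 1 one_mem_extPow, map_zero,
        LinearMap.zero_apply]
  · intro m x y hx hy i j f g hf hg hm
    rw [map_add, hx hf hg hm, hy hf hg hm, add_zero]
  · intro m t x hx i j f g hf hg hm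
    rw [map_smul, hx hf hg hm, smul_zero]
  · intro m x ξ hξ ih i j f g hf hg hm
    rw [conv_ι_mul_of_mem β hf, ih (comp_wedge_mem_coch x hf) hg (by push_cast at hm; omega),
      ih hf (comp_wedge_mem_coch x hg) (by push_cast at hm; omega), smul_zero, add_zero]

/-- Graded cocommutativity: the two terms of the recursion are exchanged when `f` and `g` are, and
contracting one of them with `x` lowers its degree by one, which accounts for the signs. -/
theorem conv_comm (β : V →ₗ[k] W →ₗ[k] Z) {i j : ℤ} {f : Λ →ₗ[k] V} {g : Λ →ₗ[k] W}
    (hf : f ∈ Coch k c V i) (hg : g ∈ Coch k c W j) :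
    conv β f g = sg k (i * j) • conv β.flip g f := by
  refine LinearMap.ext fun ξ => ?_
  rw [LinearMap.smul_apply]
  induction ξ using ext_induction generalizing i j f g with
  | one =>
    rw [conv_one, conv_one, LinearMap.flip_apply]
    -- If `i ≠ 0` then `f 1 = 0` and both sides vanish, so the sign only matters in degree 0, where
    -- it is 1.
    by_cases hi : i = 0
    · simp [hi]
    · rw [mem_coch_iff.1 hf 0 (by push_cast; omega) 1 one_mem_extPow]
      simp
  | add x y hx hy => rw [map_add, map_add, hx hf hg, hy hf hg, smul_add]
  | smul t x hx => rw [map_smul, map_smul, hx hf hg, smul_comm]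
  | ι_mul x ξ ih =>
    rw [conv_ι_mul_of_mem β hf, conv_ι_mul_of_mem _ hg, ih (comp_wedge_mem_coch x hf) hg,
      ih hf (comp_wedge_mem_coch x hg), sub_mul, mul_sub, sg_sub, sg_sub, one_mul, mul_one]
    rcases sg_cases (k := k) i with h | h <;> rcases sg_cases (k := k) j with h' | h' <;>
      simp only [h, h'] <;> module

theorem conv_comm' {β : V →ₗ[k] W →ₗ[k] Z} {β' : W →ₗ[k] V →ₗ[k] Z} {i j : ℤ}
    {f : Λ →ₗ[k] V} {g : Λ →ₗ[k] W} (h : ∀ x y, β x y = β' y x)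
    (hf : f ∈ Coch k c V i) (hg : g ∈ Coch k c W j) :
    conv β f g = sg k (i * j) • conv β' g f := by
  have e : β.flip = β' := LinearMap.ext₂ fun y x => h x y
  rw [conv_comm β hf hg, e]

/-- Reassociation makes the convolution of `f` and `g` an operator-valued cochain acting on `l`;
commuting `f` with `g` there requires no homogeneity of `l`. -/
theorem conv_left_comm {X VX WX : Type*} [AddCommGroup X] [Module k X] [AddCommGroup VX]
    [Module k VX] [AddCommGroup WX] [Module k WX] {β : V →ₗ[k] WX →ₗ[k] Z}
    {γ : W →ₗ[k] X →ₗ[k] WX} {β' : W →ₗ[k] VX →ₗ[k] Z} {γ' : V →ₗ[k] X →ₗ[k] VX}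
    (h : ∀ x y z, β x (γ y z) = β' y (γ' x z)) {i j : ℤ} {f : Λ →ₗ[k] V} {g : Λ →ₗ[k] W}
    (hf : f ∈ Coch k c V i) (hg : g ∈ Coch k c W j) (l : Λ →ₗ[k] X) :
    conv β f (conv γ g l) = sg k (i * j) • conv β' g (conv γ' f l) := by
  let pair : V →ₗ[k] W →ₗ[k] (X →ₗ[k] Z) :=
    LinearMap.mk₂ k (fun x y => β x ∘ₗ γ y) (by intros; ext; simp) (by intros; ext; simp)
      (by intros; ext; simp) (by intros; ext; simp)
  have e1 : conv β f (conv γ g l) = conv LinearMap.id (conv pair f g) l :=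
    conv_assoc_left (fun x y z => by simp [pair]) _ _ _
  have e2 : conv β' g (conv γ' f l) = conv LinearMap.id (conv pair.flip g f) l :=
    conv_assoc_left (fun x y z => by simp [pair, h]) _ _ _
  rw [e1, e2, conv_comm pair hf hg, map_smul, LinearMap.smul_apply]

end Coch

/-! ### Coderivations -/

section Coder

variable {V W Z : Type*} [AddCommGroup V] [Module k V] [AddCommGroup W] [Module k W]
  [AddCommGroup Z] [Module k Z]

/-- The coderivation of the exterior coalgebra with corestriction `u`. -/
def coder : (Λ →ₗ[k] c) →ₗ[k] (Λ →ₗ[k] Λ) := (conv (wedge k c)).flip LinearMap.id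

theorem coder_eq (u : Λ →ₗ[k] c) : coder u = conv (wedge k c) u LinearMap.id := rfl

variable (k c V) in
/-- The Jacobian `f ↦ (ξ ↦ (y ↦ f (y ∧ ξ)))` of cochains. -/
def jac : (Λ →ₗ[k] V) →ₗ[k] (Λ →ₗ[k] (c →ₗ[k] V)) :=
  LinearMap.mk₂ k (fun f ξ => f ∘ₗ (wedge k c).flip ξ) (by intros; ext; simp)
    (by intros; ext; simp) (by intros; ext; simp) (by intros; ext; simp)

theorem jac_apply (f : Λ →ₗ[k] V) (ξ : Λ) (y : c) :
    jac k c V f ξ y = f (ExteriorAlgebra.ι k y * ξ) := rfl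

theorem jac_mem_coch {n m : ℤ} (e : m + 1 = n) {f : Λ →ₗ[k] V} (h : f ∈ Coch k c V n) :
    jac k c V f ∈ Coch k c (c →ₗ[k] V) m := by
  rw [mem_coch_iff] at h ⊢
  intro m hm ξ hξ
  ext y
  exact h (m + 1) (by push_cast; omega) _ (ι_mul_mem y hξ)

/-- A vector field acts on a function by pairing its coefficients with the derivative. Written as a
convolution with `jac`, this action falls under the general rules for `conv`. -/
theorem comp_coder (f : Λ →ₗ[k] V) (u : Λ →ₗ[k] c) :
    f ∘ₗ coder u = conv LinearMap.applyₗ u (jac k c V f) := by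
  rw [coder_eq]
  exact conv_congr_apply f fun ξ η => (jac_apply f η (u ξ)).symm

theorem comp_coder_mem_coch {i p j n : ℤ} (e : p + 1 = j) (e' : i + p = n) {f : Λ →ₗ[k] V}
    {u : Λ →ₗ[k] c} (hf : f ∈ Coch k c V i) (hu : u ∈ Coch k c c j) :
    f ∘ₗ coder u ∈ Coch k c V n := by
  rw [comp_coder]
  exact conv_mem_coch _ (by omega) hu (jac_mem_coch (sub_add_cancel i 1) hf)

theorem jac_conv (β : V →ₗ[k] W →ₗ[k] Z) {i : ℤ} {f : Λ →ₗ[k] V} (hf : f ∈ Coch k c V i)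
    (g : Λ →ₗ[k] W) : jac k c Z (conv β f g) =
      conv (LinearMap.mk₂ k (fun (A : c →ₗ[k] V) y => β.flip y ∘ₗ A) (by intros; ext; simp)
        (by intros; ext; simp) (by intros; ext; simp) (by intros; ext; simp))
        (jac k c V f) g +
      sg k i • conv (LinearMap.mk₂ k (fun x (A : c →ₗ[k] W) => β x ∘ₗ A) (by intros; ext; simp)
        (by intros; ext; simp) (by intros; ext; simp) (by intros; ext; simp))
        f (jac k c W g) := by
  refine LinearMap.ext fun ξ => LinearMap.ext fun y => ?_
  rw [jac_apply, conv_ι_mul_of_mem β hf, LinearMap.add_apply, LinearMap.smul_apply,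
    LinearMap.add_apply, LinearMap.smul_apply]
  congr 1
  · exact (LinearMap.congr_fun (conv_congr_apply (LinearMap.applyₗ y) fun _ _ => rfl) ξ).symm
  · exact congrArg _
      (LinearMap.congr_fun (conv_congr_apply (LinearMap.applyₗ y) fun _ _ => rfl) ξ).symm

/-- The Leibniz rule for a coderivation of degree `p`; its corestriction has degree `p + 1` because
`c` itself sits in degree -1. It follows from the Leibniz rule for contractions, `jac_conv`. -/
theorem conv_comp_coder (β : V →ₗ[k] W →ₗ[k] Z) {i p j : ℤ} (e : p + 1 = j) {f : Λ →ₗ[k] V}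
    (hf : f ∈ Coch k c V i) (g : Λ →ₗ[k] W) {u : Λ →ₗ[k] c} (hu : u ∈ Coch k c c j) :
    conv β f g ∘ₗ coder u = conv β (f ∘ₗ coder u) g +
      sg k (i * p) • conv β f (g ∘ₗ coder u) := by
  rw [comp_coder, jac_conv β hf, map_add, map_smul, comp_coder f, comp_coder g]
  congr 1
  · exact conv_assoc_left (by intros; rfl) _ _ _
  · rw [conv_left_comm (β' := β) (γ' := LinearMap.applyₗ)
      (by intros; rfl) hu hf, smul_smul, ← sg_add]
    congr 1
    subst e
    rw [add_mul, one_mul, sg_add, sg_add, mul_comm, mul_assoc, sg_mul_self, mul_one, mul_comm p]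

theorem wedge_wedge (x y : c) (ξ : Λ) :
    wedge k c x (wedge k c y ξ) = -wedge k c y (wedge k c x ξ) := by
  have h := ExteriorAlgebra.ι_sq_zero (R := k) (x + y)
  simp only [wedge, LinearMap.comp_apply, LinearMap.mul_apply']
  rw [← mul_assoc, ← mul_assoc, ← neg_mul]
  congr 1
  rw [map_add, add_mul, mul_add, mul_add, ExteriorAlgebra.ι_sq_zero, ExteriorAlgebra.ι_sq_zero,
    zero_add, add_zero] at h
  exact eq_neg_of_add_eq_zero_left h

/-- By the Leibniz rule each composite is a coderivation plus a term of second order, and the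
second-order terms cancel in the super commutator because wedging with `x` and with `y` anticommute.
-/
theorem coder_comp {p q i j : ℤ} (ei : p + 1 = i) (ej : q + 1 = j) {u v : Λ →ₗ[k] c}
    (hu : u ∈ Coch k c c i) (hv : v ∈ Coch k c c j) :
    coder u ∘ₗ coder v - sg k (p * q) • coder v ∘ₗ coder u =
      coder (u ∘ₗ coder v - sg k (p * q) • v ∘ₗ coder u) := by
  have e1 : coder u ∘ₗ coder v = coder (u ∘ₗ coder v) +
      sg k (i * q) • conv (wedge k c) u (coder v) := by
    conv_lhs => rw [coder_eq u]
    exact conv_comp_coder _ ej hu _ hv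
  have e2 : coder v ∘ₗ coder u = coder (v ∘ₗ coder u) +
      sg k (j * p) • conv (wedge k c) v (coder u) := by
    conv_lhs => rw [coder_eq v]
    exact conv_comp_coder _ ei hv _ hu
  have e3 : conv (wedge k c) u (coder v) = -(sg k (i * j) • conv (wedge k c) v (coder u)) := by
    rw [coder_eq v, conv_left_comm (β' := -wedge k c) (γ' := wedge k c)
      (fun x y ξ => wedge_wedge x y ξ) hu hv, ← smul_neg]
    congr 1
    rw [← LinearMap.neg_apply]
    exact (conv_congr_apply (-LinearMap.id) fun _ _ => rfl).symm
  rw [e1, e2, e3, map_sub, map_smul]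
  subst ei ej
  simp only [add_mul, mul_add, sg_add, one_mul, mul_one, mul_comm q p]
  rcases sg_cases (k := k) (p * q) with h | h <;> rcases sg_cases (k := k) p with h' | h' <;>
    rcases sg_cases (k := k) q with h'' | h'' <;> simp only [h, h', h'', sg_one] <;> module

theorem counit_one : ExteriorAlgebra.algebraMapInv (1 : Λ) = 1 := map_one _

theorem counit_ι_mul (x : c) (ξ : Λ) :
    ExteriorAlgebra.algebraMapInv (ExteriorAlgebra.ι k x * ξ) = 0 := by
  rw [map_mul, ExteriorAlgebra.algebraMapInv, ExteriorAlgebra.lift_ι_apply, LinearMap.zero_apply,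
    zero_mul]

theorem ιInv_wedge (x : c) (ξ : Λ) : ExteriorAlgebra.ιInv (wedge k c x ξ) =
    ExteriorAlgebra.algebraMapInv ξ • x := by
  -- The map `ExteriorAlgebra.ιInv` is the second component of the homomorphism to the square-zero
  -- extension, for this right module structure; the product there gives the formula.
  let _ : Module kᵐᵒᵖ c := Module.compHom _ ((RingHom.id k).fromOpposite mul_comm)
  have _ : IsCentralScalar k c := ⟨fun r m => rfl⟩
  have h : ∀ ξ : Λ, (ExteriorAlgebra.toTrivSqZeroExt ξ).fst = ExteriorAlgebra.algebraMapInv ξ := by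
    intro ξ
    refine AlgHom.congr_fun (φ₁ := (TrivSqZeroExt.fstHom k k c).comp ExteriorAlgebra.toTrivSqZeroExt)
      (ExteriorAlgebra.hom_ext (LinearMap.ext fun y => ?_)) ξ
    change (ExteriorAlgebra.toTrivSqZeroExt (ExteriorAlgebra.ι k y)).fst =
      ExteriorAlgebra.algebraMapInv (ExteriorAlgebra.ι k y)
    rw [ExteriorAlgebra.toTrivSqZeroExt_ι, ExteriorAlgebra.algebraMapInv,
      ExteriorAlgebra.lift_ι_apply]
    rfl
  change (ExteriorAlgebra.toTrivSqZeroExt (ExteriorAlgebra.ι k x * ξ)).snd = _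
  rw [map_mul, ExteriorAlgebra.toTrivSqZeroExt_ι, TrivSqZeroExt.snd_mul, h]
  simp

theorem ιInv_one : ExteriorAlgebra.ιInv (1 : Λ) = 0 := by
  let _ : Module kᵐᵒᵖ c := Module.compHom _ ((RingHom.id k).fromOpposite mul_comm)
  have _ : IsCentralScalar k c := ⟨fun r m => rfl⟩
  change (ExteriorAlgebra.toTrivSqZeroExt (1 : Λ)).snd = _
  rw [map_one, TrivSqZeroExt.snd_one]

theorem ιInv_mem_coch : (ExteriorAlgebra.ιInv : Λ →ₗ[k] c) ∈ Coch k c c 1 := by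
  rw [mem_coch_iff]
  intro m hm ξ hξ
  revert hm
  refine extPow_induction (P := fun m ξ => (m : ℤ) ≠ 1 → ExteriorAlgebra.ιInv ξ = 0)
    ?_ ?_ ?_ ?_ hξ
  · exact fun _ => ιInv_one
  · intro m x y hx hy hm; rw [map_add, hx hm, hy hm, add_zero]
  · intro m t x hx hm; rw [map_smul, hx hm, smul_zero]
  · intro m x ξ hξ ih hm
    refine (ιInv_wedge x ξ).trans ?_
    cases m with
    | zero => simp at hm
    | succ m =>
      suffices h : ExteriorAlgebra.algebraMapInv ξ = (0 : k) by rw [h, zero_smul]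
      rw [ExteriorAlgebra.exteriorPower, pow_succ'] at hξ
      refine Submodule.mul_induction_on hξ ?_ fun _ _ h h' => by rw [map_add, h, h', add_zero]
      rintro _ ⟨x, rfl⟩ η -
      exact counit_ι_mul x η

theorem counit_mem_coch :
    (ExteriorAlgebra.algebraMapInv.toLinearMap : Λ →ₗ[k] k) ∈ Coch k c k 0 := by
  rw [mem_coch_iff]
  intro m hm ξ hξ
  revert hm
  refine extPow_induction (P := fun m ξ => (m : ℤ) ≠ 0 →
    ExteriorAlgebra.algebraMapInv.toLinearMap ξ = 0) ?_ ?_ ?_ ?_ hξ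
  · exact fun h => absurd rfl h
  · intro m x y hx hy hm; rw [map_add, hx hm, hy hm, add_zero]
  · intro m t x hx hm; rw [map_smul, hx hm, smul_zero]
  · intro m x ξ hξ ih hm
    exact counit_ι_mul x ξ

theorem counit_conv (β : k →ₗ[k] V →ₗ[k] W) (f : Λ →ₗ[k] V) :
    conv β ExteriorAlgebra.algebraMapInv.toLinearMap f = β 1 ∘ₗ f := by
  refine LinearMap.ext fun ξ => ?_
  induction ξ using ext_induction generalizing f with
  | one => rw [conv_one, AlgHom.toLinearMap_apply, counit_one]; rfl
  | add x y hx hy => rw [map_add, map_add, hx, hy]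
  | smul t x hx => rw [map_smul, map_smul, hx]
  | ι_mul x ξ ih =>
    have h : ExteriorAlgebra.algebraMapInv.toLinearMap ∘ₗ wedge k c x = (0 : Λ →ₗ[k] k) :=
      LinearMap.ext fun ξ => counit_ι_mul x ξ
    rw [conv_ι_mul_of_mem β counit_mem_coch, h, map_zero, ih, sg_zero, one_smul,
      LinearMap.zero_apply, LinearMap.zero_apply, zero_add]
    rfl

theorem conv_counit (β : V →ₗ[k] k →ₗ[k] W) (f : Λ →ₗ[k] V) :
    conv β f ExteriorAlgebra.algebraMapInv.toLinearMap = β.flip 1 ∘ₗ f := by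
  refine LinearMap.ext fun ξ => ?_
  induction ξ using ext_induction generalizing f with
  | one => rw [conv_one, AlgHom.toLinearMap_apply, counit_one]; rfl
  | add x y hx hy => rw [map_add, map_add, hx, hy]
  | smul t x hx => rw [map_smul, map_smul, hx]
  | ι_mul x ξ ih =>
    have h : ExteriorAlgebra.algebraMapInv.toLinearMap ∘ₗ wedge k c x = (0 : Λ →ₗ[k] k) :=
      LinearMap.ext fun ξ => counit_ι_mul x ξ
    rw [conv_ι_mul β, h, map_zero, ih, LinearMap.zero_apply, add_zero]
    rfl

theorem counit_comp_coder (u : Λ →ₗ[k] c) :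
    ExteriorAlgebra.algebraMapInv.toLinearMap ∘ₗ coder u = (0 : Λ →ₗ[k] k) := by
  rw [coder_eq, conv_congr_apply (β' := (0 : c →ₗ[k] Λ →ₗ[k] k)) (f' := u) (g' := LinearMap.id) _
    fun x ξ => counit_ι_mul _ _]
  exact (conv_congr_apply (0 : k →ₗ[k] k) (β := 0) (f := u) (g := LinearMap.id)
    fun _ _ => rfl).symm

/-- A coderivation returns its corestriction. This makes the tautological cochain convert
precomposition with coderivations into plain cochains. -/
theorem ιInv_comp_coder (u : Λ →ₗ[k] c) : ExteriorAlgebra.ιInv ∘ₗ coder u = u := by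
  rw [coder_eq, conv_congr_apply (β' := (LinearMap.lsmul k c).flip) (f' := u)
    (g' := ExteriorAlgebra.algebraMapInv.toLinearMap) _ fun x ξ => ιInv_wedge _ _]
  rw [conv_counit]
  exact LinearMap.ext fun ξ => one_smul k (u ξ)

end Coder

end Coalgebra

/-! ### Skew-symmetry and the Jacobi identity for convolutions -/

section MoreConv

variable {k : Type u} [Field k] {c : Type v} [AddCommGroup c] [Module k c]
variable {V W Z : Type*} [AddCommGroup V] [Module k V] [AddCommGroup W] [Module k W]
  [AddCommGroup Z] [Module k Z]

local notation "Λ" => ExteriorAlgebra k c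

theorem conv_bil_add (β β' : V →ₗ[k] W →ₗ[k] Z) (f : Λ →ₗ[k] V) (g : Λ →ₗ[k] W) :
    conv (β + β') f g = conv β f g + conv β' f g := by
  refine LinearMap.ext fun ξ => ?_
  rw [LinearMap.add_apply, conv_apply, conv_apply, conv_apply]
  exact LinearMap.congr_fun (map_add (TensorProduct.uncurry (.id k) V W Z) β β') _

theorem conv_bil_zero (f : Λ →ₗ[k] V) (g : Λ →ₗ[k] W) :
    conv (0 : V →ₗ[k] W →ₗ[k] Z) f g = 0 := by
  have h := conv_bil_add (0 : V →ₗ[k] W →ₗ[k] Z) 0 f g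
  rw [add_zero] at h
  exact left_eq_add.1 h

theorem bil_skew {β : V →ₗ[k] V →ₗ[k] W} (hs : ∀ x, β x x = 0) (x y : V) : β x y = -β y x := by
  have h := hs (x + y)
  simp only [map_add, LinearMap.add_apply, hs, zero_add, add_zero] at h
  exact eq_neg_of_add_eq_zero_right h

theorem conv_skew {β : V →ₗ[k] V →ₗ[k] V} (hs : ∀ x, β x x = 0) {i j : ℤ} {f g : Λ →ₗ[k] V}
    (hf : f ∈ Coch k c V i) (hg : g ∈ Coch k c V j) :
    conv β f g = -(sg k (i * j) • conv β g f) := by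
  rw [conv_comm' (β' := -β) (bil_skew hs) hf hg, ← smul_neg]
  congr 1
  exact (conv_congr_apply (-LinearMap.id) fun _ _ => rfl).symm

/-- Each double bracket is a convolution of an operator-valued cochain with `l`. The pointwise
Jacobi identity relates these operators, and commuting `f` with `g` produces the sign. -/
theorem conv_jacobi {β : V →ₗ[k] V →ₗ[k] V}
    (hJ : ∀ x y z, β x (β y z) = β (β x y) z + β y (β x z)) {i j : ℤ} {f g : Λ →ₗ[k] V}
    (hf : f ∈ Coch k c V i) (hg : g ∈ Coch k c V j) (l : Λ →ₗ[k] V) :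
    conv β f (conv β g l) = conv β (conv β f g) l + sg k (i * j) • conv β g (conv β f l) := by
  let pair : V →ₗ[k] V →ₗ[k] (V →ₗ[k] V) := (LinearMap.mul k (Module.End k V)).compl₁₂ β β
  have e1 : conv β f (conv β g l) = conv LinearMap.id (conv pair f g) l :=
    conv_assoc_left (fun x y z => by simp [pair]) _ _ _
  have e2 : conv β g (conv β f l) = conv LinearMap.id (conv pair g f) l :=
    conv_assoc_left (fun x y z => by simp [pair]) _ _ _
  have e3 : conv β (conv β f g) l = conv LinearMap.id (conv (β.compr₂ β) f g) l := by
    refine conv_congr fun ξ η => ?_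
    rw [LinearMap.id_apply, ← conv_congr_apply β (β := β) (f := f) (g := g) fun _ _ => rfl]
    rfl
  have e4 : conv pair f g = conv (β.compr₂ β) f g + conv pair.flip f g := by
    have hp : pair = β.compr₂ β + pair.flip := by
      refine LinearMap.ext₂ fun x y => LinearMap.ext fun z => ?_
      simp [pair, hJ x y z]
    conv_lhs => rw [hp]
    exact conv_bil_add _ _ _ _
  rw [e1, e4, e3, e2, conv_comm pair.flip hf hg, LinearMap.flip_flip]
  simp

/-! ### Alternating maps as cochains -/

theorem liftAlternating_single_mem_coch (n : ℕ) (f : c [⋀^Fin n]→ₗ[k] V) :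
    ExteriorAlgebra.liftAlternating (Pi.single n f) ∈ Coch k c V n := by
  rw [mem_coch_iff]
  intro m hm ξ hξ
  have hm' : m ≠ n := by exact_mod_cast hm
  rw [← ExteriorAlgebra.ιMulti_span_fixedDegree] at hξ
  induction hξ using Submodule.span_induction with
  | mem x h =>
    obtain ⟨y, rfl⟩ := h
    rw [ExteriorAlgebra.liftAlternating_apply_ιMulti, Pi.single_eq_of_ne hm',
      AlternatingMap.zero_apply]
  | zero => exact map_zero _
  | add x y _ _ hx hy => rw [map_add, hx, hy, add_zero]
  | smul t x _ hx => rw [map_smul, hx, smul_zero]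

theorem liftAlternating_two_apply (f : c [⋀^Fin 2]→ₗ[k] V) (x y : c) :
    ExteriorAlgebra.liftAlternating (Pi.single 2 f)
      (ExteriorAlgebra.ι k x * (ExteriorAlgebra.ι k y * 1)) = f ![x, y] := by
  have h : ExteriorAlgebra.ι k x * (ExteriorAlgebra.ι k y * 1) =
      ExteriorAlgebra.ιMulti k 2 ![x, y] := by
    simp [ExteriorAlgebra.ιMulti_apply]
  rw [h, ExteriorAlgebra.liftAlternating_apply_ιMulti, Pi.single_eq_same]

theorem coch_two_ext {f g : Λ →ₗ[k] V} (hf : f ∈ Coch k c V 2) (hg : g ∈ Coch k c V 2)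
    (h : ∀ x y, f (ExteriorAlgebra.ι k x * (ExteriorAlgebra.ι k y * 1)) =
      g (ExteriorAlgebra.ι k x * (ExteriorAlgebra.ι k y * 1))) : f = g := by
  refine coch_ext hf hg fun m hm ξ hξ => ?_
  obtain rfl : m = 2 := by exact_mod_cast hm
  rw [← ExteriorAlgebra.ιMulti_span_fixedDegree] at hξ
  induction hξ using Submodule.span_induction with
  | mem x h' =>
    obtain ⟨y, rfl⟩ := h'
    have e : ExteriorAlgebra.ιMulti k 2 y =
        ExteriorAlgebra.ι k (y 0) * (ExteriorAlgebra.ι k (y 1) * 1) := by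
      simp [ExteriorAlgebra.ιMulti_apply]
      rfl
    rw [e, h]
  | zero => rw [map_zero, map_zero]
  | add x y _ _ hx hy => rw [map_add, map_add, hx, hy]
  | smul t x _ hx => rw [map_smul, map_smul, hx]

/-- The convolution square of the projection to `c`. -/
theorem conv_ιInv_ιInv_apply (β : c →ₗ[k] c →ₗ[k] V) (x y : c) :
    conv β ExteriorAlgebra.ιInv ExteriorAlgebra.ιInv
      (ExteriorAlgebra.ι k x * (ExteriorAlgebra.ι k y * 1)) = β x y - β y x := by
  have e : ExteriorAlgebra.ιInv ∘ₗ wedge k c x =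
      LinearMap.toSpanSingleton k c x ∘ₗ ExteriorAlgebra.algebraMapInv.toLinearMap := by
    refine LinearMap.ext fun ξ => ?_
    rw [LinearMap.comp_apply, ιInv_wedge]; rfl
  have h1 : ExteriorAlgebra.ιInv (ExteriorAlgebra.ι k y * 1) = y := by
    rw [mul_one]; exact ExteriorAlgebra.ι_leftInverse y
  have e1 : conv β (LinearMap.toSpanSingleton k c x ∘ₗ ExteriorAlgebra.algebraMapInv.toLinearMap)
      ExteriorAlgebra.ιInv = β x ∘ₗ ExteriorAlgebra.ιInv := by
    have h2 : β x = (β ∘ₗ LinearMap.toSpanSingleton k c x) 1 := by simp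
    rw [h2, ← counit_conv]
    exact conv_congr fun _ _ => rfl
  have e2 : conv β ExteriorAlgebra.ιInv
      (LinearMap.toSpanSingleton k c x ∘ₗ ExteriorAlgebra.algebraMapInv.toLinearMap) =
      β.flip x ∘ₗ ExteriorAlgebra.ιInv := by
    have h2 : β.flip x = (β.compl₂ (LinearMap.toSpanSingleton k c x)).flip 1 :=
      LinearMap.ext fun y => by simp
    rw [h2, ← conv_counit]
    exact conv_congr fun _ _ => rfl
  rw [conv_ι_mul_of_mem β ιInv_mem_coch, e, e1, e2, LinearMap.comp_apply, LinearMap.comp_apply, h1]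
  simp [sub_eq_add_neg]

end MoreConv

section CochComp

variable {k : Type u} [Field k] {c : Type v} [AddCommGroup c] [Module k c]
variable {V W Z : Type*} [AddCommGroup V] [Module k V] [AddCommGroup W] [Module k W]
  [AddCommGroup Z] [Module k Z]

local notation "Λ" => ExteriorAlgebra k c

theorem cochComp₂_coe {i j n : ℤ}
    {F : (Λ →ₗ[k] V) →ₗ[k] (Λ →ₗ[k] W) →ₗ[k] (Λ →ₗ[k] Z)} {f : Coch k c V i} {g : Coch k c W j}
    (h : F f.1 g.1 ∈ Coch k c Z n) : (cochComp₂ i j n F f g).1 = F f.1 g.1 :=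
  cochProj_of_mem h

theorem cochComp₁_coe {i n : ℤ} {F : (Λ →ₗ[k] V) →ₗ[k] (Λ →ₗ[k] W)} {f : Coch k c V i}
    (h : F f.1 ∈ Coch k c W n) : (cochComp₁ i n F f).1 = F f.1 :=
  cochProj_of_mem h

end CochComp

/-! ### The tautological cochain of a split Lie algebra -/

namespace SplitBracket

variable {k : Type u} [Field k] {G b c : Type*} [AddCommGroup G] [Module k G]
    [AddCommGroup b] [Module k b] [AddCommGroup c] [Module k c] (S : SplitBracket k G b c)

local notation "Λ" => ExteriorAlgebra k c

theorem prB_inB (x : b) : S.prB (S.inB x) = x := by simp [prB, inB]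
theorem prC_inB (x : b) : S.prC (S.inB x) = 0 := by simp [prC, inB]
theorem prB_inC (x : c) : S.prB (S.inC x) = 0 := by simp [prB, inC]
theorem prC_inC (x : c) : S.prC (S.inC x) = x := by simp [prC, inC]

theorem inB_prB_add (x : G) : S.inB (S.prB x) + S.inC (S.prC x) = x := by
  apply S.e.injective
  simp [prB, prC, inB, inC]

theorem ext_comp {f g : Λ →ₗ[k] G} (hb : S.prB ∘ₗ f = S.prB ∘ₗ g)
    (hc : S.prC ∘ₗ f = S.prC ∘ₗ g) : f = g := by
  refine LinearMap.ext fun ξ => ?_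
  rw [← S.inB_prB_add (f ξ), ← S.inB_prB_add (g ξ)]
  exact congrArg₂ _ (congrArg _ (LinearMap.congr_fun hb ξ)) (congrArg _ (LinearMap.congr_fun hc ξ))

/-- The tautological cochain of degree one with values in `c ⊆ G`. -/
def gen : Λ →ₗ[k] G := S.inC ∘ₗ ExteriorAlgebra.ιInv

theorem gen_mem : S.gen ∈ Coch k c G 1 := comp_mem_coch _ ιInv_mem_coch

/-- For `a : Λ c → b`, the cochain `ξ ↦ ∑ μ₁(a(ξ'), ξ''_1)`. -/
def corC (a : Λ →ₗ[k] b) : Λ →ₗ[k] c := conv S.mu1 a ExteriorAlgebra.ιInv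

/-- For `a : Λ c → b`, the cochain `ξ ↦ ∑ μ₂(a(ξ'), ξ''_1)`. -/
def corB (a : Λ →ₗ[k] b) : Λ →ₗ[k] b := conv S.mu2 a ExteriorAlgebra.ιInv

theorem corC_mem {i n : ℤ} (e : i + 1 = n) {a : Λ →ₗ[k] b} (ha : a ∈ Coch k c b i) :
    S.corC a ∈ Coch k c c n := conv_mem_coch _ e ha ιInv_mem_coch

theorem corB_mem {i n : ℤ} (e : i + 1 = n) {a : Λ →ₗ[k] b} (ha : a ∈ Coch k c b i) :
    S.corB a ∈ Coch k c b n := conv_mem_coch _ e ha ιInv_mem_coch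

theorem muC_mem : S.muC ∈ Coch k c c 2 := liftAlternating_single_mem_coch 2 _

theorem hStar_mem : S.hStar ∈ Coch k c b 2 := liftAlternating_single_mem_coch 2 _

/-- The action of `b` extends μ₁ by derivations, so by associativity an element of `A` acts as the
vector field with coefficients `corC a`. From here on the anchor is computed through `coder`. -/
theorem cochAct_eq (a : Λ →ₗ[k] b) : S.cochAct a = coder (S.corC a) := by
  let δ : c →ₗ[k] Λ →ₗ[k] (b →ₗ[k] Λ) :=
    LinearMap.mk₂ k (fun z η => (wedge k c).flip η ∘ₗ S.mu1.flip z) (by intros; ext; simp)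
      (by intros; ext; simp) (by intros; ext; simp) (by intros; ext; simp)
  have e : S.lambdaAct.flip = conv δ ExteriorAlgebra.ιInv LinearMap.id := by
    refine LinearMap.ext fun ξ => LinearMap.ext fun x => ?_
    exact (LinearMap.congr_fun (conv_congr_apply (LinearMap.applyₗ x) fun _ _ => rfl) ξ).symm
  have e1 : S.cochAct a = conv LinearMap.applyₗ a S.lambdaAct.flip :=
    conv_congr (β := S.lambdaAct) (g := LinearMap.id) fun x y =>
      (LinearMap.applyₗ_apply_apply _ _).symm
  rw [e1, e]
  exact conv_assoc_left (fun _ _ _ => rfl) _ _ _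

theorem bd_eq : S.bd = coder S.muC := rfl

theorem gen_comp_coder (u : Λ →ₗ[k] c) : S.gen ∘ₗ coder u = S.inC ∘ₗ u := by
  rw [gen, LinearMap.comp_assoc, ιInv_comp_coder]

/-- Both maps μ₁ and μ₂ are thus encoded in one bracket with the tautological cochain, to which the
Jacobi identity of `G` applies. -/
theorem br_gen (a : Λ →ₗ[k] b) : conv S.br (S.inB ∘ₗ a) S.gen =
    S.inB ∘ₗ S.corB a + S.inC ∘ₗ S.corC a := by
  apply S.ext_comp
  · refine (conv_congr_apply (β' := S.mu2) _ fun _ _ => rfl).trans ?_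
    refine LinearMap.ext fun ξ => ?_
    simp [corB, prB_inB, prB_inC]
  · refine (conv_congr_apply (β' := S.mu1) _ fun _ _ => rfl).trans ?_
    refine LinearMap.ext fun ξ => ?_
    simp [corC, prC_inB, prC_inC]

/-- On `x ∧ y` the two orders of splitting contribute [x, y] and -[y, x], whence the factor 2. -/
theorem gen_gen : conv S.br S.gen S.gen =
    (2 : k) • (S.inB ∘ₗ S.hStar + S.inC ∘ₗ S.muC) := by
  have e : conv S.br S.gen S.gen = conv (S.br.compl₁₂ S.inC S.inC) ExteriorAlgebra.ιInv
    ExteriorAlgebra.ιInv := conv_congr fun _ _ => rfl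
  refine coch_two_ext (conv_mem_coch _ (by norm_num) S.gen_mem S.gen_mem)
    (Submodule.smul_mem _ _ (add_mem (comp_mem_coch _ S.hStar_mem) (comp_mem_coch _ S.muC_mem)))
    fun x y => ?_
  have skew : S.br (S.inC y) (S.inC x) = -S.br (S.inC x) (S.inC y) := by
    exact bil_skew S.self _ _
  rw [e, conv_ιInv_ιInv_apply, LinearMap.smul_apply, LinearMap.add_apply, LinearMap.comp_apply,
    LinearMap.comp_apply, muC, hStar, liftAlternating_two_apply, liftAlternating_two_apply]
  change _ = (2 : k) • (S.inB (S.prB (S.br (S.inC x) (S.inC y))) +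
    S.inC (S.prC (S.br (S.inC x) (S.inC y))))
  rw [inB_prB_add, LinearMap.compl₁₂_apply, LinearMap.compl₁₂_apply, skew]
  module

/-- The bracket of `G` makes it a Lie algebra in which `b` is a subalgebra. -/
structure IsLiePair : Prop where
  jacobi : ∀ x y z, S.br x (S.br y z) = S.br (S.br x y) z + S.br y (S.br x z)
  closed : ∀ x y, S.prC (S.br (S.inB x) (S.inB y)) = 0


variable {S}

/-! ### Structure equations obtained from the Jacobi identity -/

section Structure

variable {i j : ℤ} {a a' : ExteriorAlgebra k c →ₗ[k] b}

theorem components {f g : Λ →ₗ[k] b} {f' g' : Λ →ₗ[k] c}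
    (h : S.inB ∘ₗ f + S.inC ∘ₗ f' = S.inB ∘ₗ g + S.inC ∘ₗ g') : f = g ∧ f' = g' := by
  constructor <;> refine LinearMap.ext fun ξ => ?_
  · have := congrArg S.prB (LinearMap.congr_fun h ξ)
    simpa [prB_inB, prB_inC] using this
  · have := congrArg S.prC (LinearMap.congr_fun h ξ)
    simpa [prC_inB, prC_inC] using this

theorem IsLiePair.inB_muB (hS : S.IsLiePair) (x y : b) :
    S.inB (S.muB x y) = S.br (S.inB x) (S.inB y) := by
  have h := S.inB_prB_add (S.br (S.inB x) (S.inB y))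
  rwa [hS.closed, map_zero, add_zero] at h

theorem IsLiePair.inB_conv (hS : S.IsLiePair) (f g : Λ →ₗ[k] b) :
    S.inB ∘ₗ conv S.muB f g = conv S.br (S.inB ∘ₗ f) (S.inB ∘ₗ g) :=
  conv_congr_apply _ fun _ _ => hS.inB_muB _ _

theorem IsLiePair.muB_jacobi (hS : S.IsLiePair) (x y z : b) :
    S.muB x (S.muB y z) = S.muB (S.muB x y) z + S.muB y (S.muB x z) := by
  rw [← S.prB_inB (S.muB x (S.muB y z)), ← S.prB_inB (S.muB (S.muB x y) z + S.muB y (S.muB x z))]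
  simp only [map_add, hS.inB_muB, hS.jacobi (S.inB x) (S.inB y)]

theorem muB_self (x : b) : S.muB x x = 0 := by
  rw [muB, LinearMap.compr₂_apply, LinearMap.compl₁₂_apply, S.self, map_zero]

theorem bracketTot_apply (i j : ℤ) (a a' : Λ →ₗ[k] b) : S.bracketTot i j a a' =
    conv S.muB a a' - a' ∘ₗ coder (S.corC a) + sg k (i * j) • (a ∘ₗ coder (S.corC a')) := by
  rw [← cochAct_eq, ← cochAct_eq, ← negOnePow_smul_eq, sub_eq_add_neg, add_assoc]
  rfl

theorem bracketTot_mem {n : ℤ} (e : i + j = n) (ha : a ∈ Coch k c b i) (ha' : a' ∈ Coch k c b j) :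
    S.bracketTot i j a a' ∈ Coch k c b n := by
  rw [bracketTot_apply]
  exact add_mem (sub_mem (conv_mem_coch _ e ha ha')
    (comp_coder_mem_coch rfl (by omega) ha' (S.corC_mem rfl ha)))
    (Submodule.smul_mem _ _ (comp_coder_mem_coch rfl e ha (S.corC_mem rfl ha')))

/-- The Leibniz rule for [a, θ] under the vector field of a', solved for the term in which that
field hits a. -/
theorem br_comp_gen (ha : a ∈ Coch k c b i) (ha' : a' ∈ Coch k c b j) :
    conv S.br (S.inB ∘ₗ a ∘ₗ coder (S.corC a')) S.gen =
      (S.inB ∘ₗ S.corB a + S.inC ∘ₗ S.corC a) ∘ₗ coder (S.corC a') -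
        sg k (i * j) • conv S.br (S.inB ∘ₗ a) (S.inC ∘ₗ S.corC a') := by
  rw [← br_gen, conv_comp_coder S.br rfl (comp_mem_coch S.inB ha) S.gen (S.corC_mem rfl ha'),
    gen_comp_coder, LinearMap.comp_assoc]
  module

/-- The Jacobi identity for a, a', θ handles the pointwise bracket, and `br_comp_gen`, used twice,
handles the two derivative terms. The brackets of a with `inC ∘ corC a'`, and those with a and a'
exchanged, cancel. -/
theorem IsLiePair.gen_bracket (hS : S.IsLiePair) (ha : a ∈ Coch k c b i)
    (ha' : a' ∈ Coch k c b j) :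
    conv S.br (S.inB ∘ₗ S.bracketTot i j a a') S.gen =
      S.inB ∘ₗ (conv S.muB a (S.corB a') - sg k (i * j) • conv S.muB a' (S.corB a)
        - S.corB a' ∘ₗ coder (S.corC a) + sg k (i * j) • (S.corB a ∘ₗ coder (S.corC a'))) +
      S.inC ∘ₗ (- S.corC a' ∘ₗ coder (S.corC a) +
        sg k (i * j) • (S.corC a ∘ₗ coder (S.corC a'))) := by
  have h1 := br_comp_gen (S := S) ha ha'
  have h2 := br_comp_gen (S := S) ha' ha
  have h3 := conv_jacobi hS.jacobi (comp_mem_coch S.inB ha) (comp_mem_coch S.inB ha') S.gen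
  rw [br_gen, br_gen, map_add, map_add, ← hS.inB_conv, ← hS.inB_conv, ← hS.inB_conv] at h3
  rw [bracketTot_apply]
  simp only [LinearMap.comp_add, LinearMap.comp_sub, LinearMap.comp_smul, map_add, map_sub,
    map_smul, LinearMap.add_apply, LinearMap.sub_apply, LinearMap.smul_apply, h1, h2,
    LinearMap.add_comp, LinearMap.comp_neg, LinearMap.comp_assoc] at h3 ⊢
  rw [mul_comm j i]
  rcases sg_cases (k := k) (i * j) with h | h <;> simp only [h] at h3 ⊢ <;>
    linear_combination (norm := module) -h3

theorem IsLiePair.corC_bracket (hS : S.IsLiePair) (ha : a ∈ Coch k c b i)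
    (ha' : a' ∈ Coch k c b j) : S.corC (S.bracketTot i j a a') =
      - S.corC a' ∘ₗ coder (S.corC a) + sg k (i * j) • (S.corC a ∘ₗ coder (S.corC a')) :=
  (components ((br_gen S _).symm.trans (hS.gen_bracket ha ha'))).2

theorem IsLiePair.corB_bracket (hS : S.IsLiePair) (ha : a ∈ Coch k c b i)
    (ha' : a' ∈ Coch k c b j) : S.corB (S.bracketTot i j a a') =
      conv S.muB a (S.corB a') - sg k (i * j) • conv S.muB a' (S.corB a)
        - S.corB a' ∘ₗ coder (S.corC a) + sg k (i * j) • (S.corB a ∘ₗ coder (S.corC a')) :=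
  (components ((br_gen S _).symm.trans (hS.gen_bracket ha ha'))).1

/-- The `c`-component of `gen_bracket` together with `coder_comp`: the anchor respects brackets up
to the sign caused by precomposition, which reverses the order. -/
theorem IsLiePair.coder_bracket (hS : S.IsLiePair) (ha : a ∈ Coch k c b i)
    (ha' : a' ∈ Coch k c b j) : coder (S.corC (S.bracketTot i j a a')) =
      sg k (i * j) • (coder (S.corC a) ∘ₗ coder (S.corC a')) -
        coder (S.corC a') ∘ₗ coder (S.corC a) := by
  have h := coder_comp rfl rfl (S.corC_mem rfl ha) (S.corC_mem rfl ha')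
  rw [hS.corC_bracket ha ha']
  simp only [map_sub, map_add, map_neg, map_smul] at h ⊢
  rcases sg_cases (k := k) (i * j) with h' | h' <;> simp only [h'] at h ⊢ <;>
    first | linear_combination (norm := module) -h | linear_combination (norm := module) h

/-- The differential of `b ⊗ Λ(c*)` on elements of degree `i`. -/
def dATot (S : SplitBracket k G b c) (i : ℤ) (a : Λ →ₗ[k] b) : Λ →ₗ[k] b :=
  a ∘ₗ S.bd + sg k i • S.corB a

theorem dATot_mem {n : ℤ} (e : i + 1 = n) (ha : a ∈ Coch k c b i) :
    S.dATot i a ∈ Coch k c b n :=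
  add_mem (comp_coder_mem_coch (p := 1) (by norm_num) e ha S.muC_mem)
    (Submodule.smul_mem _ _ (S.corB_mem e ha))

variable [CharZero k]

/-- The Jacobi identity for three copies of θ says that three times [[θ, θ], θ] vanishes, and the
Leibniz rule for [θ, θ] evaluates [μ_c, θ] as (h + μ_c) ∘ ∂. -/
theorem IsLiePair.gen_hStar (hS : S.IsLiePair) :
    conv S.br (S.inB ∘ₗ S.hStar) S.gen =
      S.inB ∘ₗ (-S.hStar ∘ₗ S.bd) + S.inC ∘ₗ (-S.muC ∘ₗ S.bd) := by
  have hmu := comp_mem_coch S.inC S.muC_mem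
  have h1 := conv_jacobi hS.jacobi S.gen_mem S.gen_mem S.gen
  have h2 := conv_comp_coder S.br (p := 1) (by norm_num) S.gen_mem S.gen S.muC_mem
  have h3 := conv_skew S.self S.gen_mem hmu
  have h4 := conv_skew S.self S.gen_mem (comp_mem_coch S.inB S.hStar_mem)
  rw [gen_gen, gen_comp_coder] at h2
  rw [gen_gen] at h1
  simp only [map_add, map_smul, LinearMap.add_apply, LinearMap.smul_apply] at h1
  rw [h3, h4] at h1
  rw [h3] at h2
  rw [bd_eq]
  simp only [one_mul, mul_one, sg_one, sg_two, LinearMap.comp_neg, LinearMap.smul_comp,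
    LinearMap.add_comp, LinearMap.comp_assoc] at h1 h2 ⊢
  -- The 6 is the 3 from the Jacobi identity times the 2 in [θ, θ]; characteristic 0 removes it.
  have e1 : (6 : k) • (S.inB ∘ₗ S.hStar ∘ₗ coder S.muC + S.inC ∘ₗ S.muC ∘ₗ coder S.muC +
    conv S.br (S.inB ∘ₗ S.hStar) S.gen) = 0 := by
    linear_combination (norm := module) (3 : k) • h2 - h1
  have e2 := (smul_eq_zero.1 e1).resolve_left (by norm_num)
  linear_combination (norm := module) e2

theorem IsLiePair.corC_hStar (hS : S.IsLiePair) : S.corC S.hStar = -S.muC ∘ₗ S.bd :=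
  (components ((br_gen S _).symm.trans hS.gen_hStar)).2

theorem IsLiePair.corB_hStar (hS : S.IsLiePair) : S.corB S.hStar = -S.hStar ∘ₗ S.bd :=
  (components ((br_gen S _).symm.trans hS.gen_hStar)).1

/-- The super commutator of the odd coderivation ∂ with itself is 2∂², so ∂² is again a
coderivation; its corestriction is known from `corC_hStar`. This is the axiom for `d_R²`. -/
theorem IsLiePair.coder_hStar (hS : S.IsLiePair) : coder (S.corC S.hStar) = -S.bd ∘ₗ S.bd := by
  have h := coder_comp (p := 1) (q := 1) (by norm_num) (by norm_num) S.muC_mem S.muC_mem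
  rw [hS.corC_hStar, bd_eq]
  simp only [one_mul, sg_one, map_sub, map_smul, map_neg] at h ⊢
  have e : (2 : k) • (coder (S.muC ∘ₗ coder S.muC) - coder S.muC ∘ₗ coder S.muC) = 0 := by
    linear_combination (norm := module) -h
  have e2 := (smul_eq_zero.1 e).resolve_left two_ne_zero
  linear_combination (norm := module) -e2

/-- Three relations combine: the Leibniz rule for [a, θ] along ∂, the Jacobi identity for a, θ, θ,
and the Leibniz rule for [θ, θ] along the vector field of a. The last two carry a factor 2 from [θ,
θ] and enter with coefficient ±1/2. -/
theorem IsLiePair.gen_dA (hS : S.IsLiePair) (ha : a ∈ Coch k c b i) :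
    conv S.br (S.inB ∘ₗ S.dATot i a) S.gen =
      S.inB ∘ₗ (S.corB a ∘ₗ S.bd + sg k i • (conv S.muB a S.hStar -
        S.hStar ∘ₗ coder (S.corC a))) +
      S.inC ∘ₗ (S.corC a ∘ₗ S.bd - sg k i • (S.muC ∘ₗ coder (S.corC a))) := by
  have ha' := comp_mem_coch S.inB ha
  have hu := comp_mem_coch S.inC (S.corC_mem rfl ha)
  have h1 := conv_comp_coder S.br (p := 1) (by norm_num) ha' S.gen S.muC_mem
  have h2 := conv_jacobi hS.jacobi ha' S.gen_mem S.gen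
  have h3 := conv_comp_coder S.br rfl S.gen_mem S.gen (S.corC_mem rfl ha)
  have h4 := conv_skew S.self S.gen_mem hu
  have h5 := conv_skew S.self S.gen_mem (comp_mem_coch S.inB (S.corB_mem rfl ha))
  rw [br_gen, gen_comp_coder] at h1
  rw [gen_gen, gen_comp_coder, h4] at h3
  rw [gen_gen, br_gen] at h2
  simp only [map_add, map_smul, LinearMap.add_apply, h4, h5] at h2
  rw [← hS.inB_conv] at h2
  rw [dATot]
  simp only [LinearMap.comp_add, LinearMap.comp_smul, map_add, map_smul, LinearMap.add_apply,
    LinearMap.smul_apply, LinearMap.comp_sub, ← bd_eq, LinearMap.smul_comp, LinearMap.add_comp,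
    LinearMap.comp_assoc, one_mul, mul_one, sg_add, sg_one] at h1 h2 h3 ⊢
  rcases sg_cases (k := k) i with h | h <;> simp only [h] at h1 h2 h3 ⊢
  · linear_combination (norm := module) -h1 - (1 / 2 : k) • h2 + (1 / 2 : k) • h3
  · linear_combination (norm := module) -h1 + (1 / 2 : k) • h2 - (1 / 2 : k) • h3

theorem IsLiePair.corC_dA (hS : S.IsLiePair) (ha : a ∈ Coch k c b i) : S.corC (S.dATot i a) =
    S.corC a ∘ₗ S.bd - sg k i • (S.muC ∘ₗ coder (S.corC a)) :=
  (components ((br_gen S _).symm.trans (hS.gen_dA ha))).2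

theorem IsLiePair.corB_dA (hS : S.IsLiePair) (ha : a ∈ Coch k c b i) : S.corB (S.dATot i a) =
    S.corB a ∘ₗ S.bd + sg k i • (conv S.muB a S.hStar - S.hStar ∘ₗ coder (S.corC a)) :=
  (components ((br_gen S _).symm.trans (hS.gen_dA ha))).1

theorem IsLiePair.coder_dA (hS : S.IsLiePair) (ha : a ∈ Coch k c b i) :
    coder (S.corC (S.dATot i a)) =
      coder (S.corC a) ∘ₗ S.bd - sg k i • (S.bd ∘ₗ coder (S.corC a)) := by
  have h := coder_comp (q := 1) rfl (by norm_num) (S.corC_mem rfl ha) S.muC_mem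
  rw [hS.corC_dA ha, bd_eq]
  rw [mul_one] at h
  exact h.symm

end Structure

/-! ### The operations of the main construction on underlying cochains -/

section Coe

variable {i j n : ℤ}

variable (S) in
/-- The underlying cochain of an element of `R`. -/
def valR {n : ℤ} : S.cdg.R n →ₗ[k] (Λ →ₗ[k] k) := (Coch k c k n).subtype

variable (S) in
/-- The underlying cochain of an element of `A`. -/
def valA {n : ℤ} : S.cdg.A n →ₗ[k] (Λ →ₗ[k] b) := (Coch k c b n).subtype

theorem valR_mem (r : S.cdg.R n) : S.valR r ∈ Coch k c k n :=
  Subtype.property (p := (· ∈ Coch k c k n)) r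

theorem valA_mem (a : S.cdg.A n) : S.valA a ∈ Coch k c b n :=
  Subtype.property (p := (· ∈ Coch k c b n)) a

theorem valR_injective : Function.Injective (S.valR (n := n)) := Subtype.val_injective
theorem valA_injective : Function.Injective (S.valA (n := n)) := Subtype.val_injective

theorem valA_smul (e : i + j = n) (r : S.cdg.R i) (a : S.cdg.A j) :
    S.valA (S.cdg.smul e r a) = conv (LinearMap.lsmul k b) (S.valR r) (S.valA a) :=
  cochComp₂_coe (conv_mem_coch _ e (valR_mem r) (valA_mem a))

theorem valR_mul (e : i + j = n) (r : S.cdg.R i) (r' : S.cdg.R j) :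
    S.valR (S.cdg.mul e r r') = conv (LinearMap.mul k k) (S.valR r) (S.valR r') :=
  cochComp₂_coe (conv_mem_coch _ e (valR_mem r) (valR_mem r'))

theorem valR_one : S.valR S.cdg.one = ExteriorAlgebra.algebraMapInv.toLinearMap :=
  cochProj_of_mem counit_mem_coch

theorem valA_bracket (e : i + j = n) (a : S.cdg.A i) (a' : S.cdg.A j) :
    S.valA (S.cdg.bracket e a a') = S.bracketTot i j (S.valA a) (S.valA a') :=
  cochComp₂_coe (bracketTot_mem e (valA_mem a) (valA_mem a'))

theorem valR_anchor (e : i + j = n) (a : S.cdg.A i) (r : S.cdg.R j) :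
    S.valR (S.cdg.anchor e a r) = -(S.valR r ∘ₗ coder (S.corC (S.valA a))) := by
  rw [← cochAct_eq]
  refine cochComp₂_coe (F := S.anchorTot) ?_
  change -(S.valR r ∘ₗ S.cochAct (S.valA a)) ∈ _
  rw [cochAct_eq]
  exact neg_mem (comp_coder_mem_coch rfl (by omega) (valR_mem r) (S.corC_mem rfl (valA_mem a)))

theorem valR_dR (e : i + 1 = n) (r : S.cdg.R i) :
    S.valR (S.cdg.dR e r) = S.valR r ∘ₗ S.bd :=
  cochComp₁_coe (F := LinearMap.lcomp k k S.bd)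
    (comp_coder_mem_coch (p := 1) (by norm_num) e (valR_mem r) S.muC_mem)

theorem valA_dA (e : i + 1 = n) (a : S.cdg.A i) :
    S.valA (S.cdg.dA e a) = S.dATot i (S.valA a) := by
  have h : (LinearMap.lcomp k b S.bd + i.negOnePow • (conv S.mu2).flip ExteriorAlgebra.ιInv)
      (S.valA a) = S.dATot i (S.valA a) := by
    rw [negOnePow_smul_eq (k := k)]; rfl
  rw [← h]
  refine cochComp₁_coe ?_
  change (LinearMap.lcomp k b S.bd + i.negOnePow • (conv S.mu2).flip ExteriorAlgebra.ιInv)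
      (S.valA a) ∈ _
  rw [h]
  exact dATot_mem e (valA_mem a)

theorem valA_h : S.valA S.cdg.h = S.hStar := cochProj_of_mem S.hStar_mem

theorem constA_coe (x : b) : (SplitBracket.constA x : Coch k c b 0).1 =
    LinearMap.toSpanSingleton k b x ∘ₗ ExteriorAlgebra.algebraMapInv.toLinearMap :=
  cochProj_of_mem (comp_mem_coch (LinearMap.toSpanSingleton k b x) counit_mem_coch)

end Coe

end SplitBracket

/-! ### The CDG Lie algebroid axioms -/

namespace SplitBracket

variable {k : Type u} [Field k] {G b c : Type*} [AddCommGroup G] [Module k G]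
    [AddCommGroup b] [Module k b] [AddCommGroup c] [Module k c] {S : SplitBracket k G b c}

local notation "Λ" => ExteriorAlgebra k c

section

variable {V W Z : Type*} [AddCommGroup V] [Module k V] [AddCommGroup W] [Module k W]
  [AddCommGroup Z] [Module k Z]

theorem corC_smul (r : Λ →ₗ[k] k) (a : Λ →ₗ[k] b) :
    S.corC (conv (LinearMap.lsmul k b) r a) = conv (LinearMap.lsmul k c) r (S.corC a) :=
  conv_assoc (fun x y z => by simp) _ _ _

theorem corB_smul (r : Λ →ₗ[k] k) (a : Λ →ₗ[k] b) :
    S.corB (conv (LinearMap.lsmul k b) r a) = conv (LinearMap.lsmul k b) r (S.corB a) :=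
  conv_assoc (fun x y z => by simp) _ _ _

/-- The module structure of coderivations over cochains. -/
theorem comp_coder_smul {f : Λ →ₗ[k] V} {r : Λ →ₗ[k] k} {u : Λ →ₗ[k] c} :
    f ∘ₗ coder (conv (LinearMap.lsmul k c) r u) =
      conv (LinearMap.lsmul k V) r (f ∘ₗ coder u) := by
  rw [comp_coder, comp_coder]
  exact conv_assoc (fun x y z => by simp) _ _ _

end

/-- The bracket is of action type: a pointwise bracket plus derivatives along vector fields. The
pointwise Jacobi identity, the Leibniz rule for the pointwise bracket and `coder_bracket` account
for all terms. -/
theorem IsLiePair.bracketTot_jacobi (hS : S.IsLiePair) {i j l : ℤ}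
    {a₁ a₂ a₃ : ExteriorAlgebra k c →ₗ[k] b}
    (h₁ : a₁ ∈ Coch k c b i) (h₂ : a₂ ∈ Coch k c b j) (h₃ : a₃ ∈ Coch k c b l) :
    S.bracketTot i (j + l) a₁ (S.bracketTot j l a₂ a₃) =
      S.bracketTot (i + j) l (S.bracketTot i j a₁ a₂) a₃ +
        sg k (i * j) • S.bracketTot j (i + l) a₂ (S.bracketTot i l a₁ a₃) := by
  have hJ := conv_jacobi hS.muB_jacobi h₁ h₂ a₃
  have L1 := conv_comp_coder S.muB rfl h₂ a₃ (S.corC_mem rfl h₁)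
  have L2 := conv_comp_coder S.muB rfl h₁ a₃ (S.corC_mem rfl h₂)
  have L3 := conv_comp_coder S.muB rfl h₁ a₂ (S.corC_mem rfl h₃)
  have K := conv_skew S.muB_self h₂ (comp_coder_mem_coch rfl rfl h₁ (S.corC_mem rfl h₃))
  rw [bracketTot_apply i (j + l), bracketTot_apply (i + j) l, bracketTot_apply j (i + l),
    hS.coder_bracket h₁ h₂, hS.coder_bracket h₂ h₃, hS.coder_bracket h₁ h₃, bracketTot_apply,
    bracketTot_apply, bracketTot_apply]
  simp only [map_add, map_sub, map_smul, LinearMap.add_apply, LinearMap.sub_apply,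
    LinearMap.smul_apply, LinearMap.comp_add, LinearMap.comp_sub, LinearMap.comp_smul,
    LinearMap.add_comp, LinearMap.sub_comp, LinearMap.smul_comp, L1, L2, L3, hJ, K, mul_add,
    add_mul, sg_add, LinearMap.comp_assoc, mul_comm j i, mul_comm l i, mul_comm l j]
  clear hJ L1 L2 L3 K
  rcases sg_cases (k := k) (i * j) with h | h <;> rcases sg_cases (k := k) (i * l) with h' | h' <;>
    rcases sg_cases (k := k) (j * l) with h'' | h'' <;> simp only [h, h', h''] <;> module

variable [CharZero k]

/-- The part along ∂ is the Leibniz rule for `muB` together with `coder_dA`; the part from μ₂ is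
`corB_bracket`. -/
theorem IsLiePair.dATot_bracket (hS : S.IsLiePair) {i j : ℤ}
    {a₁ a₂ : ExteriorAlgebra k c →ₗ[k] b}
    (h₁ : a₁ ∈ Coch k c b i) (h₂ : a₂ ∈ Coch k c b j) :
    S.dATot (i + j) (S.bracketTot i j a₁ a₂) = S.bracketTot (i + 1) j (S.dATot i a₁) a₂ +
      sg k i • S.bracketTot i (j + 1) a₁ (S.dATot j a₂) := by
  have L := conv_comp_coder S.muB (p := 1) (by norm_num) h₁ a₂ S.muC_mem
  rw [← bd_eq] at L
  rw [dATot, hS.corB_bracket h₁ h₂, bracketTot_apply, bracketTot_apply,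
    bracketTot_apply, hS.coder_dA h₁, hS.coder_dA h₂, dATot, dATot]
  simp only [map_add, map_sub, map_smul, LinearMap.add_apply, LinearMap.sub_apply,
    LinearMap.smul_apply, LinearMap.comp_add, LinearMap.comp_sub, LinearMap.comp_smul,
    LinearMap.add_comp, LinearMap.sub_comp, LinearMap.smul_comp, L, mul_add, add_mul, sg_add,
    LinearMap.comp_assoc, mul_one, one_mul, conv_skew S.muB_self (S.corB_mem rfl h₁) h₂,
    mul_comm j i]
  clear L
  rcases sg_cases (k := k) (i * j) with h | h <;> rcases sg_cases (k := k) i with h' | h' <;>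
    rcases sg_cases (k := k) j with h'' | h'' <;> simp only [h, h', h'', sg_one] <;> module

theorem IsLiePair.isCDGLieAlgebroid (hS : S.IsLiePair) : IsCDGLieAlgebroid S.cdg where
  one_mul e r := by
    apply S.valR_injective
    rw [valR_mul, valR_one, counit_conv]
    exact LinearMap.ext fun ξ => one_mul _
  mul_assoc e₁ e₂ e₃ e₄ r s t := by
    apply S.valR_injective
    rw [valR_mul, valR_mul, valR_mul, valR_mul]
    exact conv_assoc (fun x y z => mul_assoc x y z) _ _ _
  mul_comm e e' r s := by
    apply S.valR_injective
    simp only [map_add, map_neg, map_zero, map_smul, negOnePow_smul_eq (k := k)]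
    rw [valR_mul, valR_mul]
    exact conv_comm' (fun x y => mul_comm x y) (valR_mem r) (valR_mem s)
  one_smul e a := by
    apply S.valA_injective
    rw [valA_smul, valR_one, counit_conv]
    exact LinearMap.ext fun ξ => one_smul k _
  mul_smul e₁ e₂ e₃ e₄ r s a := by
    apply S.valA_injective
    rw [valA_smul, valA_smul, valA_smul, valR_mul]
    exact conv_assoc (fun x y z => mul_smul x y z) _ _ _
  bracket_skew {i j n} e e' a b := by
    apply S.valA_injective
    simp only [map_add, map_neg, map_zero, map_smul, negOnePow_smul_eq (k := k)]
    rw [valA_bracket, valA_bracket, bracketTot_apply, bracketTot_apply,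
      conv_skew S.muB_self (valA_mem a) (valA_mem b), mul_comm j i]
    rcases sg_cases (k := k) (i * j) with h | h <;> simp only [h] <;> module
  jacobi {i j l ij jl il n} e₁ e₂ e₃ e₄ e₅ e₆ a b c := by
    apply S.valA_injective
    simp only [map_add, map_neg, map_zero, map_smul, negOnePow_smul_eq (k := k)]
    simp only [valA_bracket]
    subst e₁ e₃ e₅
    exact hS.bracketTot_jacobi (valA_mem a) (valA_mem b) (valA_mem c)
  anchor_bracket {i j l ij jl il n} e₁ e₂ e₃ e₄ e₅ e₆ a b r := by
    apply S.valR_injective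
    simp only [map_add, map_neg, map_zero, map_smul, negOnePow_smul_eq (k := k)]
    simp only [valR_anchor, valA_bracket]
    rw [hS.coder_bracket (valA_mem a) (valA_mem b)]
    simp only [LinearMap.comp_sub, LinearMap.comp_smul, LinearMap.neg_comp, LinearMap.comp_assoc]
    module
  anchor_mul {i j l ij jl il n} e₁ e₂ e₃ e₄ e₅ e₆ a r s := by
    apply S.valR_injective
    simp only [map_add, map_neg, map_zero, map_smul, negOnePow_smul_eq (k := k)]
    simp only [valR_anchor, valR_mul]
    rw [conv_comp_coder _ rfl (valR_mem r) (S.valR s) (S.corC_mem rfl (valA_mem a)), mul_comm j i]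
    simp only [map_neg, LinearMap.neg_apply]
    module
  smul_anchor {i j l ij jl n} e₁ e₂ e₃ e₄ r a s := by
    apply S.valR_injective
    rw [valR_anchor, valR_mul, valR_anchor, valA_smul, corC_smul, comp_coder_smul, map_neg]
    rfl
  bracket_smul {i j l ij jl il n} e₁ e₂ e₃ e₄ e₅ e₆ a r b := by
    apply S.valA_injective
    simp only [map_add, map_neg, map_zero, map_smul, negOnePow_smul_eq (k := k)]
    simp only [valA_bracket, valA_smul, valR_anchor]
    subst e₁
    rw [bracketTot_apply, bracketTot_apply, corC_smul, comp_coder_smul,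
      conv_left_comm (β' := LinearMap.lsmul k _) (γ' := S.muB) (fun x y z => by simp)
        (valA_mem a) (valR_mem r), conv_comp_coder _ rfl (valR_mem r) _ (S.corC_mem rfl (valA_mem a)),
      mul_add, sg_add, mul_comm j i]
    simp only [map_add, map_sub, map_neg, map_smul, LinearMap.neg_apply]
    module
  dR_mul {i j n i' j' n'} e ei ej en e₁ e₂ r s := by
    apply S.valR_injective
    simp only [map_add, map_neg, map_zero, map_smul, negOnePow_smul_eq (k := k)]
    simp only [valR_dR, valR_mul]
    rw [bd_eq, conv_comp_coder (p := 1) _ (by norm_num) (valR_mem r) (S.valR s) S.muC_mem, mul_one]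
  dA_smul {i j n i' j' n'} e ei ej en e₁ e₂ r a := by
    apply S.valA_injective
    simp only [map_add, map_neg, map_zero, map_smul, negOnePow_smul_eq (k := k)]
    simp only [valR_dR, valA_dA, valA_smul]
    subst e
    rw [dATot, dATot, corB_smul, bd_eq,
      conv_comp_coder (p := 1) _ (by norm_num) (valR_mem r) _ S.muC_mem, sg_add, mul_one, map_add,
      map_smul]
    module
  dA_bracket {i j n i' j' n'} e ei ej en e₁ e₂ a b := by
    apply S.valA_injective
    simp only [map_add, map_neg, map_zero, map_smul, negOnePow_smul_eq (k := k)]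
    simp only [valA_dA, valA_bracket]
    subst e ei ej
    exact hS.dATot_bracket (valA_mem a) (valA_mem b)
  dR_anchor {i j n i' j' n'} e ei ej en e₁ e₂ a r := by
    apply S.valR_injective
    simp only [map_add, map_neg, map_zero, map_smul, negOnePow_smul_eq (k := k)]
    simp only [valR_anchor, valR_dR, valA_dA]
    rw [hS.coder_dA (valA_mem a)]
    simp only [LinearMap.comp_sub, LinearMap.comp_smul, LinearMap.neg_comp, LinearMap.comp_assoc]
    module
  dR_dR {i j n} e₁ e₂ e r := by
    apply S.valR_injective
    rw [valR_dR, valR_dR, valR_anchor, valA_h, hS.coder_hStar]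
    simp only [LinearMap.comp_neg, neg_neg, LinearMap.comp_assoc]
  dA_dA {i j n} e₁ e₂ e a := by
    apply S.valA_injective
    -- The square of the differential splits into a ∘ ∂², which `coder_hStar` identifies with the
    -- action of h, and the terms from `corB_dA`, which give the pointwise bracket with h and the
    -- derivative of h along a.
    rw [valA_dA, valA_dA, valA_bracket, valA_h, bracketTot_apply, hS.coder_hStar, dATot,
      hS.corB_dA (valA_mem a), conv_skew S.muB_self S.hStar_mem (valA_mem a), dATot, ← e₁,
      two_mul, sg_add, sg_add, sg_one, sg_mul_self]
    simp only [LinearMap.add_comp, LinearMap.smul_comp, LinearMap.comp_neg, LinearMap.comp_assoc]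
    rcases sg_cases (k := k) i with h | h <;> simp only [h] <;> module
  dA_h e := by
    apply S.valA_injective
    simp only [map_add, map_neg, map_zero, map_smul, negOnePow_smul_eq (k := k)]
    rw [valA_dA, valA_h, dATot, hS.corB_hStar, sg_two, one_smul, add_neg_cancel]

end SplitBracket

namespace SplitBracket

variable {k : Type u} [Field k] {G b c : Type*} [AddCommGroup G] [Module k G]
    [AddCommGroup b] [Module k b] [AddCommGroup c] [Module k c] {S : SplitBracket k G b c}
    {M : Type*} [AddCommGroup M] [Module k M]

local notation "Λ" => ExteriorAlgebra k c

/-! ### Operators on `Λ(c) ⊗ M` -/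

section Operators

theorem coder_smul (r : Λ →ₗ[k] k) (u : Λ →ₗ[k] c) :
    coder (conv (LinearMap.lsmul k c) r u) =
      coder u ∘ₗ conv (LinearMap.lsmul k Λ) r LinearMap.id := by
  have e : coder u ∘ₗ conv (LinearMap.lsmul k Λ) r LinearMap.id =
      conv (LinearMap.lsmul k Λ) r (coder u) :=
    conv_congr_apply (coder u) fun ξ η => (coder u).map_smul (r ξ) η
  rw [e, coder_eq, coder_eq]
  exact conv_assoc (β := wedge k c) (γ := LinearMap.lsmul k c) (β' := LinearMap.lsmul k Λ)
    (γ' := wedge k c) (fun x y z => by simp) _ _ _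

theorem insertOp_tmul (F : Λ →ₗ[k] Module.End k M) (ξ : Λ) (m : M) :
    insertOp F (ξ ⊗ₜ m) = conv tmulOp F LinearMap.id ξ m := rfl

/-- The operator applied first splits off the first tensor factor, so the order of composition is
reversed relative to the convolution. This is why the module is a right module. -/
theorem insertOp_comp (F F' : Λ →ₗ[k] Module.End k M) :
    insertOp F ∘ₗ insertOp F' =
      insertOp (conv (LinearMap.mul k (Module.End k M)).flip F' F) := by
  refine TensorProduct.ext' fun ξ m => ?_
  rw [LinearMap.comp_apply, insertOp_tmul, insertOp_tmul]
  let β : Module.End k M →ₗ[k] (M →ₗ[k] Λ ⊗[k] M) →ₗ[k] (Λ ⊗[k] M) :=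
    LinearMap.applyₗ ∘ₗ LinearMap.applyₗ m
  have e1 : (insertOp F ∘ₗ LinearMap.applyₗ m) ∘ₗ conv tmulOp F' LinearMap.id =
      conv β F' (conv tmulOp F LinearMap.id) := conv_congr_apply _ fun _ _ => rfl
  have e2 : LinearMap.applyₗ m ∘ₗ conv tmulOp
      (conv (LinearMap.mul k (Module.End k M)).flip F' F) LinearMap.id =
      conv β F' (conv tmulOp F LinearMap.id) := by
    rw [conv_congr_apply (β' := tmulOp.compr₂ (LinearMap.applyₗ m))
      (f' := conv (LinearMap.mul k (Module.End k M)).flip F' F)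
      (g' := LinearMap.id) _ fun _ _ => rfl]
    exact conv_assoc (fun _ _ _ => rfl) _ _ _
  exact LinearMap.congr_fun (e1.trans e2.symm) ξ

/-- The Leibniz rule `conv_comp_coder` for the convolution of `F` with the identity of `Λ c`. -/
theorem insertOp_comp_coder {i p j : ℤ} (e : p + 1 = j) {F : Λ →ₗ[k] Module.End k M}
    (hF : F ∈ Coch k c (Module.End k M) i) {u : Λ →ₗ[k] c} (hu : u ∈ Coch k c c j) :
    insertOp F ∘ₗ LinearMap.rTensor M (coder u) = insertOp (F ∘ₗ coder u) +
      sg k (i * p) • (LinearMap.rTensor M (coder u) ∘ₗ insertOp F) := by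
  refine TensorProduct.ext' fun ξ m => ?_
  have h := LinearMap.congr_fun (LinearMap.congr_fun
    (conv_comp_coder (tmulOp (c := c) (M := M)) e hF LinearMap.id hu) ξ) m
  rw [LinearMap.id_comp] at h
  refine h.trans ?_
  rw [LinearMap.add_apply, LinearMap.add_apply, LinearMap.smul_apply, LinearMap.smul_apply]
  congr 2
  have e1 : LinearMap.llcomp k M _ _ (LinearMap.rTensor M (coder u)) ∘ₗ
      conv tmulOp F LinearMap.id = conv tmulOp F (coder u) :=
    conv_congr_apply _ fun _ _ => rfl
  exact (LinearMap.congr_fun (LinearMap.congr_fun e1 ξ) m).symm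

/-- Contraction with a cochain as an insertion operator. -/
theorem rTensor_contraction (r : Λ →ₗ[k] k) :
    LinearMap.rTensor M (conv (LinearMap.lsmul k Λ) r LinearMap.id) =
      insertOp (LinearMap.toSpanSingleton k (Module.End k M) 1 ∘ₗ r) := by
  refine TensorProduct.ext' fun ξ m => ?_
  have e1 : (TensorProduct.mk k Λ M).flip m ∘ₗ conv (LinearMap.lsmul k Λ) r LinearMap.id =
      LinearMap.applyₗ m ∘ₗ
        conv tmulOp (LinearMap.toSpanSingleton k (Module.End k M) 1 ∘ₗ r) LinearMap.id := by
    rw [conv_congr_apply (β' := (LinearMap.lsmul k (Λ ⊗[k] M)))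
      (f' := r) (g' := (TensorProduct.mk k Λ M).flip m) _ fun _ _ => rfl,
      conv_congr_apply (β' := (LinearMap.lsmul k (Λ ⊗[k] M)))
      (f' := r) (g' := (TensorProduct.mk k Λ M).flip m) _ fun ξ η => ?_]
    simp [tmulOp]
  exact LinearMap.congr_fun e1 ξ

/-- An operator on `Λ(c) ⊗ M` of degree `d`. -/
def HasDegree (d : ℤ) (T : Λ ⊗[k] M →ₗ[k] Λ ⊗[k] M) : Prop :=
  ∀ (m : ℕ) (ξ : Λ), ξ ∈ ⋀[k]^m c → ∀ (x : M) (q : ℤ), q ≠ m - d →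
    LinearMap.rTensor M (degProj k c q) (T (ξ ⊗ₜ x)) = 0

theorem HasDegree.add {d : ℤ} {T T' : Λ ⊗[k] M →ₗ[k] Λ ⊗[k] M} (h : HasDegree d T)
    (h' : HasDegree d T') : HasDegree d (T + T') := by
  intro m ξ hξ x q hq
  rw [LinearMap.add_apply, map_add, h m ξ hξ x q hq, h' m ξ hξ x q hq, add_zero]

theorem HasDegree.smul {d : ℤ} {T : Λ ⊗[k] M →ₗ[k] Λ ⊗[k] M} (h : HasDegree d T) (t : k) :
    HasDegree d (t • T) := by
  intro m ξ hξ x q hq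
  rw [LinearMap.smul_apply, map_smul, h m ξ hξ x q hq, smul_zero]

theorem HasDegree.neg {d : ℤ} {T : Λ ⊗[k] M →ₗ[k] Λ ⊗[k] M} (h : HasDegree d T) :
    HasDegree d (-T) := by
  intro m ξ hξ x q hq
  rw [LinearMap.neg_apply, map_neg, h m ξ hξ x q hq, neg_zero]

theorem degProj_mem_coch (q : ℤ) : degProj k c q ∈ Coch k c Λ q :=
  ⟨LinearMap.id, LinearMap.id_comp _⟩

theorem hasDegree_coder {p j : ℤ} (e : p + 1 = j) {u : Λ →ₗ[k] c} (hu : u ∈ Coch k c c j) :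
    HasDegree p (LinearMap.rTensor M (coder u)) := by
  intro m ξ hξ x q hq
  have h := mem_coch_iff.1 (comp_coder_mem_coch e rfl (degProj_mem_coch q) hu) m (by omega) ξ hξ
  rw [LinearMap.rTensor_tmul, LinearMap.rTensor_tmul]
  exact (congrArg (· ⊗ₜ x) h).trans (TensorProduct.zero_tmul _ _)

theorem hasDegree_insertOp {i : ℤ} {F : Λ →ₗ[k] Module.End k M}
    (hF : F ∈ Coch k c (Module.End k M) i) : HasDegree i (insertOp F) := by
  intro m ξ hξ x q hq
  have e1 : LinearMap.llcomp k M _ _ (LinearMap.rTensor M (degProj k c q)) ∘ₗ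
      conv tmulOp F LinearMap.id = conv tmulOp F (degProj k c q) :=
    conv_congr_apply _ fun _ _ => rfl
  have h := mem_coch_iff.1 (conv_mem_coch tmulOp rfl hF (degProj_mem_coch q)) m (by omega) ξ hξ
  rw [← e1] at h
  exact LinearMap.congr_fun h x

/-- A tensor is the finite sum of its homogeneous components, of which only one survives. -/
theorem rTensor_degProj_eq {n : ℤ} {y : Λ ⊗[k] M}
    (h : ∀ q, q ≠ n → LinearMap.rTensor M (degProj k c q) y = 0) :
    LinearMap.rTensor M (degProj k c n) y = y := by
  -- Quantifying over all larger finite sets of degrees makes the claim stable under sums and lets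
  -- `n` be inserted afterwards.
  have key : ∀ y : Λ ⊗[k] M, ∃ s : Finset ℤ, ∀ t : Finset ℤ, s ⊆ t →
      ∑ q ∈ t, LinearMap.rTensor M (degProj k c q) y = y := by
    intro y
    induction y using TensorProduct.induction_on with
    | zero => exact ⟨∅, fun t _ => by simp⟩
    | add y y' hy hy' =>
      obtain ⟨s, hs⟩ := hy
      obtain ⟨s', hs'⟩ := hy'
      refine ⟨s ∪ s', fun t ht => ?_⟩
      simp only [map_add, Finset.sum_add_distrib]
      rw [hs t (Finset.union_subset_left ht), hs' t (Finset.union_subset_right ht)]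
    | tmul ξ x =>
      induction ξ using ext_decomp_induction with
      | add y y' hy hy' =>
        obtain ⟨s, hs⟩ := hy
        obtain ⟨s', hs'⟩ := hy'
        refine ⟨s ∪ s', fun t ht => ?_⟩
        simp only [TensorProduct.add_tmul, map_add, Finset.sum_add_distrib]
        rw [hs t (Finset.union_subset_left ht), hs' t (Finset.union_subset_right ht)]
      | mem m ξ hξ =>
        refine ⟨{(m : ℤ)}, fun t ht => ?_⟩
        rw [Finset.sum_eq_single_of_mem (m : ℤ) (ht (Finset.mem_singleton_self _))]
        · rw [LinearMap.rTensor_tmul, degProj_of_mem hξ, if_pos rfl]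
        · intro q _ hq
          rw [LinearMap.rTensor_tmul, degProj_of_mem hξ, if_neg hq.symm, TensorProduct.zero_tmul]
  obtain ⟨s, hs⟩ := key y
  have e := hs (insert n s) (Finset.subset_insert n s)
  rwa [Finset.sum_eq_single_of_mem n (Finset.mem_insert_self _ _) fun q _ hq => h q hq] at e

theorem HasDegree.modProj_coe {d i n : ℤ} (e : i + d = n) {T : Λ ⊗[k] M →ₗ[k] Λ ⊗[k] M}
    (hT : HasDegree d T) {x : Λ ⊗[k] M} (hx : x ∈ modDeg k c M i) : (modProj n (T x)).1 = T x := by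
  obtain ⟨y, rfl⟩ := hx
  induction y using TensorProduct.induction_on with
  | zero => simp
  | add y y' hy hy' => 
    simp only [map_add, Submodule.coe_add, hy, hy']
  | tmul ξ x =>
    rw [LinearMap.rTensor_tmul]
    -- Degree `i` of the module is the exterior power of order `-i`; for `i > 0` the projection, and
    -- hence the element, is zero.
    by_cases hi : 0 ≤ -i
    · refine rTensor_degProj_eq fun q hq => hT (-i).toNat _ ?_ x q (by omega)
      rw [degProj, if_pos hi, GradedAlgebra.proj_apply]
      exact Subtype.property _
    · rw [degProj, if_neg hi, LinearMap.zero_apply, TensorProduct.zero_tmul]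
      simp

end Operators

/-! ### The right module attached to a representation -/

section RightModule

variable (ρ : G →ₗ[k] Module.End k M)

variable (S) in
/-- The action of a cochain with values in `b`, up to sign. -/
def actOp (a : Λ →ₗ[k] b) : Λ ⊗[k] M →ₗ[k] Λ ⊗[k] M :=
  LinearMap.rTensor M (coder (S.corC a)) + insertOp (ρ ∘ₗ S.inB ∘ₗ a)

variable (S) in
/-- The differential, up to sign. -/
def diffOp : Λ ⊗[k] M →ₗ[k] Λ ⊗[k] M :=
  LinearMap.rTensor M S.bd + insertOp (ρ ∘ₗ S.gen)

variable (M) in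
/-- The contraction with a cochain. -/
def contrOp (r : Λ →ₗ[k] k) : Λ ⊗[k] M →ₗ[k] Λ ⊗[k] M :=
  insertOp (LinearMap.toSpanSingleton k (Module.End k M) 1 ∘ₗ r)

variable {ρ} {i j : ℤ}

theorem contrOp_comp (r r' : Λ →ₗ[k] k) :
    contrOp M r' ∘ₗ contrOp M r = contrOp M (conv (LinearMap.mul k k) r r') := by
  rw [contrOp, contrOp, insertOp_comp, contrOp]
  congr 1
  refine (conv_congr_apply (LinearMap.toSpanSingleton k (Module.End k M) 1) fun ξ η => ?_).symm
  simp [mul_comm (r ξ), mul_smul]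

theorem actOp_comp_contrOp (r : Λ →ₗ[k] k) (a : Λ →ₗ[k] b) :
    S.actOp ρ a ∘ₗ contrOp M r = S.actOp ρ (conv (LinearMap.lsmul k b) r a) := by
  rw [actOp, actOp, LinearMap.add_comp, contrOp]
  congr 1
  · rw [← rTensor_contraction, ← LinearMap.rTensor_comp]
    congr 1
    rw [corC_smul, coder_smul]
  · rw [insertOp_comp]
    congr 1
    refine (conv_congr_apply (ρ ∘ₗ S.inB) fun ξ η => ?_).symm
    simp

theorem rep_conv (hρ : ∀ x y, ρ (S.br x y) = ρ x * ρ y - ρ y * ρ x) (f g : Λ →ₗ[k] G) :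
    ρ ∘ₗ conv S.br f g = conv (LinearMap.mul k (Module.End k M)) (ρ ∘ₗ f) (ρ ∘ₗ g) -
      conv (LinearMap.mul k (Module.End k M)).flip (ρ ∘ₗ f) (ρ ∘ₗ g) := by
  rw [eq_sub_iff_add_eq, conv_congr_apply (β' := S.br.compr₂ ρ) (f' := f) (g' := g) _
    fun _ _ => rfl, ← conv_congr (β := (LinearMap.mul k (Module.End k M)).compl₁₂ ρ ρ)
      (f := f) (g := g) (β' := LinearMap.mul k (Module.End k M)) fun _ _ => rfl,
    ← conv_congr (β := (LinearMap.mul k (Module.End k M)).flip.compl₁₂ ρ ρ)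
      (f := f) (g := g) (β' := (LinearMap.mul k (Module.End k M)).flip) fun _ _ => rfl,
    ← conv_bil_add]
  exact conv_congr fun ξ η => by simp [hρ]

/-- The super commutator of two insertion operators. -/
theorem insertOp_commutator (hρ : ∀ x y, ρ (S.br x y) = ρ x * ρ y - ρ y * ρ x)
    {f g : Λ →ₗ[k] G} (hf : f ∈ Coch k c G i) (hg : g ∈ Coch k c G j) :
    insertOp (ρ ∘ₗ conv S.br f g) = sg k (i * j) • (insertOp (ρ ∘ₗ f) ∘ₗ insertOp (ρ ∘ₗ g)) -
      insertOp (ρ ∘ₗ g) ∘ₗ insertOp (ρ ∘ₗ f) := by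
  rw [insertOp_comp, insertOp_comp, rep_conv hρ, map_sub, conv_comm _ (comp_mem_coch ρ hf)
    (comp_mem_coch ρ hg), map_smul]

/-- Contractions super commute with insertions. -/
theorem insertOp_contrOp {F : ExteriorAlgebra k c →ₗ[k] Module.End k M}
    {r : ExteriorAlgebra k c →ₗ[k] k} (hF : F ∈ Coch k c (Module.End k M) i)
    (hr : r ∈ Coch k c k j) :
    insertOp F ∘ₗ contrOp M r = sg k (i * j) • (contrOp M r ∘ₗ insertOp F) := by
  have hr' := comp_mem_coch (LinearMap.toSpanSingleton k (Module.End k M) 1) hr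
  rw [contrOp, insertOp_comp, insertOp_comp, conv_comm _ hr' hF, map_smul, mul_comm]
  congr 2
  exact conv_congr fun ξ η => by simp

/-- Contraction with r super commutes with the insertion part of a, so only the coderivation part
contributes, by the Leibniz rule. -/
theorem contrOp_anchor {a : ExteriorAlgebra k c →ₗ[k] b} {r : ExteriorAlgebra k c →ₗ[k] k}
    (ha : a ∈ Coch k c b i) (hr : r ∈ Coch k c k j) :
    contrOp M (-(r ∘ₗ coder (S.corC a))) =
      sg k (i * j) • (S.actOp ρ a ∘ₗ contrOp M r) - contrOp M r ∘ₗ S.actOp ρ a := by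
  have hr' := comp_mem_coch (LinearMap.toSpanSingleton k (Module.End k M) 1) hr
  have h1 := insertOp_comp_coder rfl hr' (S.corC_mem rfl ha)
  have h2 := insertOp_contrOp (comp_mem_coch (ρ ∘ₗ S.inB) ha) hr
  rw [LinearMap.comp_assoc] at h1 h2
  rw [actOp, LinearMap.add_comp, LinearMap.comp_add, h2, contrOp, contrOp, LinearMap.comp_neg,
    map_neg, h1, mul_comm j i]
  rcases sg_cases (k := k) (i * j) with h | h <;> simp only [h] <;> module

theorem contrOp_dR {r : ExteriorAlgebra k c →ₗ[k] k} (hr : r ∈ Coch k c k j) :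
    contrOp M (r ∘ₗ S.bd) = contrOp M r ∘ₗ S.diffOp ρ -
      sg k j • (S.diffOp ρ ∘ₗ contrOp M r) := by
  have hr' := comp_mem_coch (LinearMap.toSpanSingleton k (Module.End k M) 1) hr
  have h1 := insertOp_comp_coder (p := 1) (by norm_num) hr' S.muC_mem
  have h2 := insertOp_contrOp (comp_mem_coch ρ S.gen_mem) hr
  rw [LinearMap.comp_assoc] at h1
  rw [diffOp, LinearMap.add_comp, LinearMap.comp_add, h2, contrOp, contrOp, bd_eq, h1, one_mul,
    mul_one]
  rcases sg_cases (k := k) j with h | h <;> simp only [h] <;> module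

variable (hS : S.IsLiePair) (hρ : ∀ x y, ρ (S.br x y) = ρ x * ρ y - ρ y * ρ x)
include hS hρ

/-- The commutators of the two coderivations, of the two insertions, and of one with the other
yield, in turn, the vector field of the bracket, its pointwise part, and its derivative terms. -/
theorem actOp_bracket {a a' : ExteriorAlgebra k c →ₗ[k] b} (ha : a ∈ Coch k c b i)
    (ha' : a' ∈ Coch k c b j) : S.actOp ρ (S.bracketTot i j a a') =
      sg k (i * j) • (S.actOp ρ a ∘ₗ S.actOp ρ a') - S.actOp ρ a' ∘ₗ S.actOp ρ a := by
  have h1 := insertOp_commutator hρ (comp_mem_coch S.inB ha) (comp_mem_coch S.inB ha')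
  have h2 := insertOp_comp_coder rfl (comp_mem_coch (ρ ∘ₗ S.inB) ha) (S.corC_mem rfl ha')
  have h3 := insertOp_comp_coder rfl (comp_mem_coch (ρ ∘ₗ S.inB) ha') (S.corC_mem rfl ha)
  rw [actOp, hS.coder_bracket ha ha', bracketTot_apply, LinearMap.comp_add, LinearMap.comp_sub,
    hS.inB_conv, actOp, actOp]
  simp only [LinearMap.comp_assoc, mul_comm j i] at h1 h2 h3
  simp only [LinearMap.comp_add, LinearMap.add_comp, LinearMap.comp_sub, LinearMap.comp_smul,
    map_add, map_sub, map_smul, h1, h2, h3, LinearMap.rTensor_sub, LinearMap.rTensor_smul,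
    LinearMap.rTensor_comp]
  rcases sg_cases (k := k) (i * j) with h | h <;> simp only [h] <;> module

variable [CharZero k]

theorem actOp_dA {a : ExteriorAlgebra k c →ₗ[k] b} (ha : a ∈ Coch k c b i) :
    S.actOp ρ (S.dATot i a) = S.actOp ρ a ∘ₗ S.diffOp ρ -
      sg k i • (S.diffOp ρ ∘ₗ S.actOp ρ a) := by
  have h1 := insertOp_commutator hρ (comp_mem_coch S.inB ha) S.gen_mem
  have h2 := insertOp_comp_coder (p := 1) (by norm_num) (comp_mem_coch (ρ ∘ₗ S.inB) ha) S.muC_mem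
  have h3 := insertOp_comp_coder rfl (comp_mem_coch ρ S.gen_mem) (S.corC_mem rfl ha)
  rw [LinearMap.comp_assoc, gen_comp_coder] at h3
  rw [br_gen] at h1
  rw [actOp, hS.coder_dA ha, dATot, actOp, diffOp, bd_eq]
  simp only [LinearMap.comp_assoc, mul_one, one_mul] at h1 h2 h3
  simp only [LinearMap.comp_add, LinearMap.add_comp, LinearMap.comp_sub, LinearMap.comp_smul,
    map_add, map_sub, map_smul, h2, h3, LinearMap.rTensor_sub, LinearMap.rTensor_smul,
    LinearMap.rTensor_comp] at h1 ⊢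
  rcases sg_cases (k := k) i with h | h <;> simp only [h] at h1 ⊢ 
  · linear_combination (norm := module) h1
  · linear_combination (norm := module) -h1

/-- The square of the insertion of θ is half its super commutator with itself, that is, the
insertion of h + μ_c up to sign; the μ_c part cancels against the cross terms with ∂. -/
theorem actOp_hStar : S.actOp ρ S.hStar = -(S.diffOp ρ ∘ₗ S.diffOp ρ) := by
  have h1 := insertOp_commutator hρ S.gen_mem S.gen_mem
  have h2 := insertOp_comp_coder (p := 1) (by norm_num) (comp_mem_coch ρ S.gen_mem) S.muC_mem
  rw [LinearMap.comp_assoc, gen_comp_coder] at h2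
  rw [gen_gen] at h1
  rw [actOp, hS.coder_hStar, diffOp, bd_eq]
  simp only [LinearMap.comp_add, LinearMap.add_comp, LinearMap.comp_smul,
    map_add, map_smul, h2, LinearMap.rTensor_neg, mul_one, sg_one, LinearMap.comp_assoc,
    LinearMap.rTensor_comp, LinearMap.comp_neg, LinearMap.neg_comp] at h1 ⊢
  linear_combination (norm := module) (1 / 2 : k) • h1

end RightModule

/-! ### The module operations as operators -/

section Val

variable (ρ : G →ₗ[k] Module.End k M)

variable (S) in
/-- The underlying element of `Λ(c) ⊗ M`. -/
def valN {n : ℤ} : (S.rightModule ρ).N n →ₗ[k] Λ ⊗[k] M := (modDeg k c M n).subtype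

variable {ρ} {i j n : ℤ}

theorem valN_mem (x : (S.rightModule ρ).N n) : S.valN ρ x ∈ modDeg k c M n :=
  Subtype.property (p := (· ∈ modDeg k c M n)) x

theorem valN_injective : Function.Injective (S.valN ρ (n := n)) := Subtype.val_injective

theorem valN_actR (e : i + j = n) (x : (S.rightModule ρ).N i) (r : S.cdg.R j) :
    S.valN ρ ((S.rightModule ρ).actR e x r) = contrOp M (S.valR r) (S.valN ρ x) := by
  have h := HasDegree.modProj_coe e (hasDegree_insertOp
    (comp_mem_coch (LinearMap.toSpanSingleton k (Module.End k M) 1) (valR_mem r))) (valN_mem x)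
  rw [← rTensor_contraction] at h
  rw [contrOp, ← rTensor_contraction]
  exact h

theorem actOp_hasDegree {a : ExteriorAlgebra k c →ₗ[k] b} (ha : a ∈ Coch k c b j) :
    HasDegree j (S.actOp ρ a) :=
  (hasDegree_coder rfl (S.corC_mem rfl ha)).add (hasDegree_insertOp (comp_mem_coch (ρ ∘ₗ S.inB) ha))

theorem valN_actA (e : i + j = n) (x : (S.rightModule ρ).N i) (a : S.cdg.A j) :
    S.valN ρ ((S.rightModule ρ).actA e x a) = -S.actOp ρ (S.valA a) (S.valN ρ x) := by
  have h := (actOp_hasDegree (S := S) (ρ := ρ) (valA_mem a)).neg.modProj_coe e (valN_mem x)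
  rw [actOp, ← cochAct_eq] at h ⊢
  exact h

theorem valN_d (e : i + 1 = n) (x : (S.rightModule ρ).N i) :
    S.valN ρ ((S.rightModule ρ).d e x) = sg k (i + 1) • S.diffOp ρ (S.valN ρ x) := by
  have h0 : HasDegree 1 (S.diffOp ρ) :=
    (hasDegree_coder (p := 1) (by norm_num) S.muC_mem).add
      (hasDegree_insertOp (comp_mem_coch ρ S.gen_mem))
  have h := (h0.smul (sg k (i + 1))).modProj_coe e (valN_mem x)
  rw [← LinearMap.smul_apply, ← h, ← negOnePow_smul_eq]
  rfl

end Val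

/-- With the right action equal to `-actOp` and the differential to `(-1)^(i+1) diffOp`, each axiom
is an operator identity proved above. In `d²` the signs of two consecutive degrees multiply to -1.
-/
theorem IsLiePair.isRightCDGModule [CharZero k] (hS : S.IsLiePair) {ρ : G →ₗ[k] Module.End k M}
    (hρ : ∀ x y, ρ (S.br x y) = ρ x * ρ y - ρ y * ρ x) :
    IsRightCDGModule (S.rightModule ρ) where
  act_one e x := by
    apply valN_injective
    rw [valN_actR, valR_one, contrOp, ← rTensor_contraction, counit_conv]
    have h : LinearMap.lsmul k Λ 1 ∘ₗ LinearMap.id = LinearMap.id :=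
      LinearMap.ext fun ξ => one_smul k ξ
    rw [h, LinearMap.rTensor_id, LinearMap.id_apply]
  act_mul e₁ e₂ e₃ e₄ x r s := by
    apply valN_injective
    rw [valN_actR, valN_actR, valN_actR, valR_mul, ← contrOp_comp, LinearMap.comp_apply]
  act_smul e₁ e₂ e₃ e₄ x r a := by
    apply valN_injective
    rw [valN_actA, valN_actR, valN_actA, valA_smul, ← actOp_comp_contrOp, LinearMap.comp_apply]
  act_anchor e₁ e₂ e₃ e₄ e₅ e₆ x a r := by
    apply valN_injective
    simp only [map_sub, map_neg, map_smul, negOnePow_smul_eq (k := k)]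
    simp only [valN_actA, valN_actR, valR_anchor]
    rw [contrOp_anchor (S := S) (ρ := ρ) (valA_mem a) (valR_mem r)]
    simp only [LinearMap.sub_apply, LinearMap.smul_apply, LinearMap.comp_apply, map_neg]
    module
  act_bracket e₁ e₂ e₃ e₄ e₅ e₆ x a b := by
    apply valN_injective
    simp only [map_sub, map_neg, map_smul, negOnePow_smul_eq (k := k)]
    simp only [valN_actA, valA_bracket]
    rw [actOp_bracket hS hρ (valA_mem a) (valA_mem b)]
    simp only [LinearMap.sub_apply, LinearMap.smul_apply, LinearMap.comp_apply, map_neg]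
    module
  d_actR {i j n i' j' n'} e ei ej en e₁ e₂ x r := by
    apply valN_injective
    simp only [map_add, map_neg, map_smul, negOnePow_smul_eq (k := k)]
    simp only [valN_d, valN_actR, valR_dR]
    rw [contrOp_dR (ρ := ρ) (valR_mem r), ← e]
    simp only [LinearMap.sub_apply, LinearMap.smul_apply, LinearMap.comp_apply, map_smul, sg_add,
      sg_one]
    module
  d_actA {i j n i' j' n'} e ei ej en e₁ e₂ x a := by
    apply valN_injective
    simp only [map_add, map_neg, map_smul, negOnePow_smul_eq (k := k)]
    simp only [valN_d, valN_actA, valA_dA]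
    rw [actOp_dA hS hρ (valA_mem a), ← e]
    simp only [LinearMap.sub_apply, LinearMap.smul_apply, LinearMap.comp_apply, map_smul, sg_add,
      sg_one, map_neg]
    module
  d_d {i j n} e₁ e₂ e x := by
    apply valN_injective
    simp only [map_neg, valN_d, valN_actA, valA_h, actOp_hStar hS hρ]
    rw [← e₁, sg_add _ 1, map_smul, smul_smul, mul_right_comm, sg_mul_self]
    simp

/-- The constant cochain with value `x`. -/
def constCoch {V : Type*} [AddCommGroup V] [Module k V] (x : V) : Λ →ₗ[k] V :=
  LinearMap.toSpanSingleton k V x ∘ₗ ExteriorAlgebra.algebraMapInv.toLinearMap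

theorem conv_constCoch {V W Z : Type*} [AddCommGroup V] [Module k V] [AddCommGroup W] [Module k W]
    [AddCommGroup Z] [Module k Z] (β : V →ₗ[k] W →ₗ[k] Z) (x : V) (f : Λ →ₗ[k] W) :
    conv β (constCoch x) f = β x ∘ₗ f := by
  have h : β x = (β ∘ₗ LinearMap.toSpanSingleton k V x) 1 := by simp
  rw [h, ← counit_conv]
  exact conv_congr fun _ _ => rfl

theorem actOp_constCoch (ρ : G →ₗ[k] Module.End k M) (x : b) (hx : S.mu1 x = 0)
    (hρx : ρ (S.inB x) = -1) : S.actOp ρ (constCoch x) = -LinearMap.id := by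
  rw [actOp, corC, conv_constCoch, hx, LinearMap.zero_comp, map_zero, LinearMap.rTensor_zero,
    zero_add]
  refine TensorProduct.ext' fun ξ m => ?_
  have h : ρ ∘ₗ S.inB ∘ₗ constCoch (k := k) (c := c) x = constCoch (ρ (S.inB x)) := by
    refine LinearMap.ext fun ξ => ?_
    simp [constCoch]
  rw [h, insertOp_tmul, conv_constCoch, hρx]
  simp [tmulOp]

end SplitBracket

/-! ### Adjoining a unit and passing to the opposite -/

section Unital

variable {k : Type u} [Field k]

namespace IsCDGLieAlgebroid

variable {X : CDGData k} (hX : IsCDGLieAlgebroid X) {i j l n : ℤ}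
include hX

theorem mul_one' (e : i + 0 = n) (e' : i = n) (r : X.R i) : X.mul e r X.one = e' ▸ r := by
  subst e'
  rw [hX.mul_comm e (by omega), mul_zero, Int.negOnePow_zero, _root_.one_smul, hX.one_mul]

theorem mul_one (e : i + 0 = i) (r : X.R i) : X.mul e r X.one = r := hX.mul_one' e rfl r

theorem anchor_one (e : i + 0 = n) (a : X.A i) : X.anchor e a X.one = 0 := by
  obtain rfl : i = n := by omega
  have h := hX.anchor_mul (zero_add 0) e e (by omega) e (by omega) a X.one X.one
  rw [hX.one_mul, hX.mul_one, mul_zero, Int.negOnePow_zero, _root_.one_smul, hX.one_mul] at h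
  exact left_eq_add.1 h

theorem dR_one (e : 0 + 1 = n) : X.dR e X.one = 0 := by
  obtain rfl : 1 = n := by omega
  have h := hX.dR_mul (zero_add 0) e e e (by omega) (by omega) X.one X.one
  rw [hX.one_mul, hX.mul_one, Int.negOnePow_zero, _root_.one_smul, hX.one_mul] at h
  exact left_eq_add.1 h

end IsCDGLieAlgebroid

section AdjoinUnit

variable {X : CDGData k} {i j l n : ℤ}

variable (X) in
/-- The identification of the base of `R ⊕ A` with `R`. -/
def adjR {n : ℤ} : (adjoinUnit X).R n →ₗ[k] X.R n := LinearMap.id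

variable (X) in
/-- The component in `R` of an element of `R ⊕ A`. -/
def adjFst {n : ℤ} : (adjoinUnit X).A n →ₗ[k] X.R n := LinearMap.fst k (X.R n) (X.A n)

variable (X) in
/-- The component in `A` of an element of `R ⊕ A`. -/
def adjSnd {n : ℤ} : (adjoinUnit X).A n →ₗ[k] X.A n := LinearMap.snd k (X.R n) (X.A n)

theorem adjR_injective : Function.Injective (adjR X (n := n)) := fun _ _ h => h

theorem adj_ext {p q : (adjoinUnit X).A n} (h₁ : adjFst X p = adjFst X q)
    (h₂ : adjSnd X p = adjSnd X q) : p = q := Prod.ext h₁ h₂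

theorem adjR_one : adjR X (adjoinUnit X).one = X.one := rfl

theorem adjR_mul (e : i + j = n) (r : (adjoinUnit X).R i) (s : (adjoinUnit X).R j) :
    adjR X ((adjoinUnit X).mul e r s) = X.mul e (adjR X r) (adjR X s) := rfl

theorem adjR_dR (e : i + 1 = n) (r : (adjoinUnit X).R i) :
    adjR X ((adjoinUnit X).dR e r) = X.dR e (adjR X r) := rfl

theorem adjR_anchor (e : i + j = n) (a : (adjoinUnit X).A i) (r : (adjoinUnit X).R j) :
    adjR X ((adjoinUnit X).anchor e a r) = X.anchor e (adjSnd X a) (adjR X r) := rfl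

theorem adjFst_smul (e : i + j = n) (r : (adjoinUnit X).R i) (p : (adjoinUnit X).A j) :
    adjFst X ((adjoinUnit X).smul e r p) = X.mul e (adjR X r) (adjFst X p) := rfl

theorem adjSnd_smul (e : i + j = n) (r : (adjoinUnit X).R i) (p : (adjoinUnit X).A j) :
    adjSnd X ((adjoinUnit X).smul e r p) = X.smul e (adjR X r) (adjSnd X p) := rfl

theorem adjFst_bracket (e : i + j = n) (p : (adjoinUnit X).A i) (q : (adjoinUnit X).A j) :
    adjFst X ((adjoinUnit X).bracket e p q) = X.anchor e (adjSnd X p) (adjFst X q) -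
      sg k (i * j) • X.anchor ((add_comm j i).trans e) (adjSnd X q) (adjFst X p) := by
  rw [← negOnePow_smul_eq]; rfl

theorem adjSnd_bracket (e : i + j = n) (p : (adjoinUnit X).A i) (q : (adjoinUnit X).A j) :
    adjSnd X ((adjoinUnit X).bracket e p q) = X.bracket e (adjSnd X p) (adjSnd X q) := rfl

theorem adjFst_dA (e : i + 1 = n) (p : (adjoinUnit X).A i) :
    adjFst X ((adjoinUnit X).dA e p) = X.dR e (adjFst X p) := rfl

theorem adjSnd_dA (e : i + 1 = n) (p : (adjoinUnit X).A i) :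
    adjSnd X ((adjoinUnit X).dA e p) = X.dA e (adjSnd X p) := rfl

theorem adjFst_h : adjFst X (adjoinUnit X).h = 0 := rfl
theorem adjSnd_h : adjSnd X (adjoinUnit X).h = X.h := rfl
theorem adjFst_unit : adjFst X (adjoinUnit X).unit = X.one := rfl
theorem adjSnd_unit : adjSnd X (adjoinUnit X).unit = 0 := rfl

/-- The free unital CDG Lie algebroid on a CDG Lie algebroid. -/
theorem isUnital_adjoinUnit (hX : IsCDGLieAlgebroid X) :
    IsUnitalCDGLieAlgebroid (adjoinUnit X) where
  one_mul := hX.one_mul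
  mul_assoc := hX.mul_assoc
  mul_comm := hX.mul_comm
  one_smul e a := by
    apply adj_ext
    · rw [adjFst_smul, adjR_one, hX.one_mul]
    · rw [adjSnd_smul, adjR_one, hX.one_smul]
  mul_smul e₁ e₂ e₃ e₄ r s a := by
    apply adj_ext
    · rw [adjFst_smul, adjFst_smul, adjFst_smul, adjR_mul, hX.mul_assoc e₁ e₂ e₃ e₄]
    · rw [adjSnd_smul, adjSnd_smul, adjSnd_smul, adjR_mul, hX.mul_smul e₁ e₂ e₃ e₄]
  bracket_skew {i j n} e e' a b := by
    apply adj_ext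
    · simp only [negOnePow_smul_eq (k := k), map_neg, map_smul, adjFst_bracket, mul_comm j i]
      rcases sg_cases (k := k) (i * j) with h | h <;> simp only [h] <;> module
    · simp only [negOnePow_smul_eq (k := k), map_neg, map_smul, adjSnd_bracket]
      rw [hX.bracket_skew e e', negOnePow_smul_eq (k := k)]
  jacobi {i j l ij jl il n} e₁ e₂ e₃ e₄ e₅ e₆ a b c := by
    apply adj_ext
    · simp only [negOnePow_smul_eq (k := k), map_add, map_smul, adjFst_bracket, adjSnd_bracket,
        map_sub]
      -- The component in `R` is linear in the `R`-parts of a, b, c; for each of them the identity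
      -- is that the other two elements act compatibly with their bracket.
      have h1 := hX.anchor_bracket e₁ e₂ e₃ e₄ e₅ e₆ (adjSnd X a) (adjSnd X b) (adjFst X c)
      have h2 := hX.anchor_bracket (j := l) (l := j) (jl := jl) (il := ij) (ij := il) (by omega) e₂
        e₅ (by omega) e₃ (by omega)
        (adjSnd X a) (adjSnd X c) (adjFst X b)
      have h3 := hX.anchor_bracket (i := j) (j := l) (l := i) (jl := il) (il := ij) (ij := jl)
        (by omega) e₆ e₁ (by omega) (by omega) (by omega)
        (adjSnd X b) (adjSnd X c) (adjFst X a)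
      simp only [negOnePow_smul_eq (k := k)] at h1 h2 h3
      rw [h1, h2, h3]
      subst e₁ e₃ e₅
      simp only [mul_add, add_mul, sg_add, mul_comm j i, mul_comm l i, mul_comm l j]
      rcases sg_cases (k := k) (i * j) with h | h <;> rcases sg_cases (k := k) (i * l) with h' | h' <;>
        rcases sg_cases (k := k) (j * l) with h'' | h'' <;> simp only [h, h', h''] <;> module
    · simp only [negOnePow_smul_eq (k := k), map_add, map_smul, adjSnd_bracket]
      rw [hX.jacobi e₁ e₂ e₃ e₄ e₅ e₆, negOnePow_smul_eq (k := k)]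
  anchor_bracket e₁ e₂ e₃ e₄ e₅ e₆ a b r := hX.anchor_bracket e₁ e₂ e₃ e₄ e₅ e₆ _ _ _
  anchor_mul e₁ e₂ e₃ e₄ e₅ e₆ a r s := hX.anchor_mul e₁ e₂ e₃ e₄ e₅ e₆ _ _ _
  smul_anchor e₁ e₂ e₃ e₄ r a s := hX.smul_anchor e₁ e₂ e₃ e₄ _ _ _
  bracket_smul {i j l ij jl il n} e₁ e₂ e₃ e₄ e₅ e₆ a r b := by
    apply adj_ext
    · simp only [negOnePow_smul_eq (k := k), map_add, map_smul, adjFst_bracket, adjFst_smul,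
        adjSnd_smul, map_sub, adjR_anchor]
      rw [hX.anchor_mul e₁ e₂ e₃ e₄ e₅ e₆, hX.smul_anchor e₁ (by omega) (by omega) e₆,
        negOnePow_smul_eq (k := k)]
      subst e₁
      simp only [mul_add, sg_add]
      module
    · simp only [negOnePow_smul_eq (k := k), map_add, map_smul, adjSnd_bracket, adjSnd_smul,
        adjR_anchor]
      rw [hX.bracket_smul e₁ e₂ e₃ e₄ e₅ e₆, negOnePow_smul_eq (k := k)]
  dR_mul := hX.dR_mul
  dA_smul e ei ej en e₁ e₂ r a := by
    apply adj_ext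
    · simp only [negOnePow_smul_eq (k := k), map_add, map_smul, adjFst_smul, adjFst_dA, adjR_dR]
      rw [hX.dR_mul e ei ej en e₁ e₂, negOnePow_smul_eq (k := k)]
    · simp only [negOnePow_smul_eq (k := k), map_add, map_smul, adjSnd_smul, adjSnd_dA, adjR_dR]
      rw [hX.dA_smul e ei ej en e₁ e₂, negOnePow_smul_eq (k := k)]
  dA_bracket {i j n i' j' n'} e ei ej en e₁ e₂ a b := by
    apply adj_ext
    · simp only [negOnePow_smul_eq (k := k), map_add, map_smul, adjFst_bracket, adjFst_dA,
        adjSnd_dA, map_sub]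
      rw [hX.dR_anchor e ei ej en e₁ e₂, hX.dR_anchor _ ej ei en (by omega) (by omega),
        negOnePow_smul_eq (k := k), negOnePow_smul_eq (k := k)]
      subst ei ej
      simp only [mul_add, add_mul, sg_add, mul_one, one_mul]
      rcases sg_cases (k := k) i with h | h <;> rcases sg_cases (k := k) j with h' | h' <;>
        simp only [h, h'] <;> module
    · simp only [negOnePow_smul_eq (k := k), map_add, map_smul, adjSnd_bracket, adjSnd_dA]
      rw [hX.dA_bracket e ei ej en e₁ e₂, negOnePow_smul_eq (k := k)]
  dR_anchor e ei ej en e₁ e₂ a r := hX.dR_anchor e ei ej en e₁ e₂ _ _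
  dR_dR e₁ e₂ e r := hX.dR_dR e₁ e₂ e _
  dA_dA e₁ e₂ e a := by
    apply adj_ext
    · rw [adjFst_bracket, adjFst_dA, adjFst_dA, adjSnd_h, adjFst_h, map_zero, smul_zero, sub_zero,
        hX.dR_dR e₁ e₂ e]
    · rw [adjSnd_bracket, adjSnd_dA, adjSnd_dA, adjSnd_h, hX.dA_dA e₁ e₂ e]
  dA_h e := by
    apply adj_ext
    · rw [adjFst_dA, adjFst_h, map_zero, map_zero]
    · rw [adjSnd_dA, adjSnd_h, hX.dA_h e, map_zero]
  unit_bracket {i n} e a := by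
    apply adj_ext
    · rw [adjFst_bracket, adjSnd_unit, adjFst_unit, map_zero, LinearMap.zero_apply,
        hX.anchor_one, smul_zero, sub_zero, map_zero]
    · rw [adjSnd_bracket, adjSnd_unit, map_zero, LinearMap.zero_apply, map_zero]
  unit_anchor e r := by
    apply adjR_injective
    rw [adjR_anchor, adjSnd_unit, map_zero, LinearMap.zero_apply, map_zero]
  dA_unit e := by
    apply adj_ext
    · rw [adjFst_dA, adjFst_unit, hX.dR_one, map_zero]
    · rw [adjSnd_dA, adjSnd_unit, map_zero, map_zero]

end AdjoinUnit


/-! ### The opposite of a unital CDG Lie algebroid -/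

section Opposite

variable {X : UnitalCDGData k} {i j l n : ℤ}

variable (X) in
/-- The element `r • unit`. -/
def scalar {n : ℤ} : X.R n →ₗ[k] X.A n := (X.smul (add_zero n)).flip X.unit

theorem smul_unit (r : X.R n) : X.smul (add_zero n) r X.unit = scalar X r := rfl

namespace IsUnitalCDGLieAlgebroid

variable (hX : IsUnitalCDGLieAlgebroid X)
include hX

theorem smul_scalar (e : i + j = n) (r : X.R i) (t : X.R j) :
    X.smul e r (scalar X t) = scalar X (X.mul e r t) :=
  (hX.mul_smul e (add_zero n) (add_zero j) e r t X.unit).symm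

theorem anchor_scalar (e : i + j = n) (t : X.R i) (r : X.R j) :
    X.anchor e (scalar X t) r = 0 := by
  rw [← smul_unit, hX.smul_anchor (add_zero i) e (zero_add j) e, hX.unit_anchor, map_zero]

theorem bracket_unit (e : i + 0 = n) (a : X.A i) : X.bracket e a X.unit = 0 := by
  rw [hX.bracket_skew e (by omega), hX.unit_bracket, smul_zero, neg_zero]

theorem bracket_scalar (e : i + j = n) (a : X.A i) (t : X.R j) :
    X.bracket e a (scalar X t) = scalar X (X.anchor e a t) := by
  rw [← smul_unit, hX.bracket_smul (add_zero j) e e (add_zero n) (add_zero i) (by omega),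
    hX.bracket_unit, map_zero, smul_zero, add_zero, smul_unit]

theorem dA_scalar (e : i + 1 = n) (t : X.R i) : X.dA e (scalar X t) = scalar X (X.dR e t) := by
  rw [← smul_unit, hX.dA_smul (add_zero i) e (zero_add 1) e (add_zero n) e, hX.dA_unit, map_zero,
    smul_zero, add_zero, smul_unit]

end IsUnitalCDGLieAlgebroid

variable (X) in
/-- The identification of the base of the opposite with the original one. -/
def oppR {n : ℤ} : (opp X).R n →ₗ[k] X.R n := LinearMap.id

variable (X) in
/-- The identification of the underlying space of the opposite with the original one. -/
def oppA {n : ℤ} : (opp X).A n →ₗ[k] X.A n := LinearMap.id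

theorem oppR_injective : Function.Injective (oppR X (n := n)) := fun _ _ h => h
theorem oppA_injective : Function.Injective (oppA X (n := n)) := fun _ _ h => h

theorem oppR_one : oppR X (opp X).one = X.one := rfl
theorem oppA_unit : oppA X (opp X).unit = X.unit := rfl
theorem oppA_h : oppA X (opp X).h = -X.h := rfl

theorem oppR_mul (e : i + j = n) (r : (opp X).R i) (s : (opp X).R j) :
    oppR X ((opp X).mul e r s) = X.mul e (oppR X r) (oppR X s) := rfl

theorem oppA_smul (e : i + j = n) (r : (opp X).R i) (a : (opp X).A j) :
    oppA X ((opp X).smul e r a) = X.smul e (oppR X r) (oppA X a) +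
      sg k (i * j) • scalar X (X.anchor ((add_comm j i).trans e) (oppA X a) (oppR X r)) := by
  rw [← negOnePow_smul_eq]; rfl

theorem oppA_bracket (e : i + j = n) (a : (opp X).A i) (b : (opp X).A j) :
    oppA X ((opp X).bracket e a b) = -X.bracket e (oppA X a) (oppA X b) := rfl

theorem oppR_anchor (e : i + j = n) (a : (opp X).A i) (r : (opp X).R j) :
    oppR X ((opp X).anchor e a r) = -X.anchor e (oppA X a) (oppR X r) := rfl

theorem oppR_dR (e : i + 1 = n) (r : (opp X).R i) :
    oppR X ((opp X).dR e r) = X.dR e (oppR X r) := rfl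

theorem oppA_dA (e : i + 1 = n) (a : (opp X).A i) :
    oppA X ((opp X).dA e a) = X.dA e (oppA X a) := rfl

/-- The opposite of a unital CDG Lie algebroid is a unital CDG Lie algebroid. -/
theorem isUnital_opp (hX : IsUnitalCDGLieAlgebroid X) : IsUnitalCDGLieAlgebroid (opp X) where
  one_mul := hX.one_mul
  mul_assoc := hX.mul_assoc
  mul_comm := hX.mul_comm
  one_smul e a := by
    apply oppA_injective
    rw [oppA_smul, oppR_one, hX.anchor_one, map_zero, smul_zero, add_zero, hX.one_smul]
  mul_smul {i j l ij jl n} e₁ e₂ e₃ e₄ r s a := by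
    apply oppA_injective
    simp only [oppA_smul, oppR_mul, map_add, map_smul, LinearMap.add_apply, LinearMap.smul_apply,
      hX.smul_scalar, hX.anchor_scalar, map_zero, smul_zero, add_zero]
    -- The correction for `rs` splits by the derivation rule into the corrections for `r` and for
    -- `s`; the correction of a correction vanishes, as multiples of the unit act by zero on `R`.
    rw [hX.mul_smul e₁ e₂ e₃ e₄, hX.smul_anchor e₃ (by omega) (jl := l + i) (by omega) (by omega),
      hX.anchor_mul e₁ (by omega) (ij := l + i) (by omega) (by omega) (il := jl) (by omega)
        (by omega), negOnePow_smul_eq (k := k),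
      hX.mul_comm (i := l + i) (by omega) (by omega), negOnePow_smul_eq (k := k)]
    subst e₁ e₃
    simp only [map_add, map_smul, mul_add, add_mul, sg_add, mul_comm j i, mul_comm l i,
      mul_comm l j]
    rcases sg_cases (k := k) (i * j) with h | h <;> rcases sg_cases (k := k) (i * l) with h' | h' <;>
        rcases sg_cases (k := k) (j * l) with h'' | h'' <;> simp only [h, h', h''] <;> module
  bracket_skew e e' a b := by
    apply oppA_injective
    rw [map_neg, negOnePow_smul_eq (k := k), map_smul, oppA_bracket, oppA_bracket,
      hX.bracket_skew e e', negOnePow_smul_eq (k := k), smul_neg]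
  jacobi e₁ e₂ e₃ e₄ e₅ e₆ a b c := by
    apply oppA_injective
    rw [map_add, negOnePow_smul_eq (k := k), map_smul]
    simp only [oppA_bracket, map_neg, LinearMap.neg_apply, neg_neg]
    rw [hX.jacobi e₁ e₂ e₃ e₄ e₅ e₆, negOnePow_smul_eq (k := k)]
  anchor_bracket e₁ e₂ e₃ e₄ e₅ e₆ a b r := by
    apply oppR_injective
    rw [map_add, negOnePow_smul_eq (k := k), map_smul]
    simp only [oppR_anchor, oppA_bracket, map_neg, LinearMap.neg_apply, neg_neg]
    rw [hX.anchor_bracket e₁ e₂ e₃ e₄ e₅ e₆, negOnePow_smul_eq (k := k)]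
  anchor_mul e₁ e₂ e₃ e₄ e₅ e₆ a r s := by
    apply oppR_injective
    rw [map_add, negOnePow_smul_eq (k := k), map_smul]
    simp only [oppR_anchor, oppR_mul, map_neg, LinearMap.neg_apply]
    rw [hX.anchor_mul e₁ e₂ e₃ e₄ e₅ e₆, negOnePow_smul_eq (k := k)]
    module
  smul_anchor e₁ e₂ e₃ e₄ r a s := by
    apply oppR_injective
    simp only [oppR_anchor, oppR_mul, oppA_smul, map_neg, map_add, LinearMap.add_apply, map_smul,
      LinearMap.smul_apply, hX.anchor_scalar, smul_zero, add_zero]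
    rw [hX.smul_anchor e₁ e₂ e₃ e₄]
  bracket_smul {i j l ij jl il n} e₁ e₂ e₃ e₄ e₅ e₆ a r b := by
    apply oppA_injective
    rw [map_add, negOnePow_smul_eq (k := k), map_smul]
    simp only [oppA_bracket, oppA_smul, oppR_anchor, map_add, map_smul, map_neg,
      LinearMap.neg_apply, hX.bracket_scalar]
    -- The bracket with the correction term b(r) · 1 yields a(b(r)) · 1. Exchanging the two actions
    -- produces the corrections on the right-hand side.
    rw [hX.bracket_smul e₁ e₂ e₃ e₄ e₅ e₆, negOnePow_smul_eq (k := k),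
      hX.anchor_bracket (i := i) (j := l) (l := j) (by omega) e₂ e₅ (by omega) e₃ (by omega),
      negOnePow_smul_eq (k := k)]
    subst e₃ e₅
    simp only [map_add, map_smul, mul_add, add_mul, sg_add, mul_comm j i, mul_comm l i,
      mul_comm l j]
    rcases sg_cases (k := k) (i * j) with h | h <;> rcases sg_cases (k := k) (i * l) with h' | h' <;>
        rcases sg_cases (k := k) (j * l) with h'' | h'' <;> simp only [h, h', h''] <;> module
  dR_mul := hX.dR_mul
  dA_smul {i j n i' j' n'} e ei ej en e₁ e₂ r a := by
    apply oppA_injective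
    rw [map_add, negOnePow_smul_eq (k := k), map_smul]
    simp only [oppA_smul, oppA_dA, oppR_dR, map_add, map_smul, hX.dA_scalar]
    rw [hX.dA_smul e ei ej en e₁ e₂, hX.dR_anchor _ ej ei en (by omega) (by omega),
      negOnePow_smul_eq (k := k), negOnePow_smul_eq (k := k)]
    subst ei ej
    simp only [map_add, map_smul, mul_add, add_mul, sg_add, _root_.mul_one, _root_.one_mul]
    rcases sg_cases (k := k) i with h | h <;> rcases sg_cases (k := k) j with h' | h' <;>
        simp only [h, h'] <;> module
  dA_bracket e ei ej en e₁ e₂ a b := by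
    apply oppA_injective
    rw [map_add, negOnePow_smul_eq (k := k), map_smul]
    simp only [oppA_bracket, oppA_dA, map_neg]
    rw [hX.dA_bracket e ei ej en e₁ e₂, negOnePow_smul_eq (k := k)]
    module
  dR_anchor e ei ej en e₁ e₂ a r := by
    apply oppR_injective
    rw [map_add, negOnePow_smul_eq (k := k), map_smul]
    simp only [oppR_anchor, oppR_dR, oppA_dA, map_neg]
    rw [hX.dR_anchor e ei ej en e₁ e₂, negOnePow_smul_eq (k := k)]
    module
  dR_dR e₁ e₂ e r := by
    apply oppR_injective
    rw [oppR_anchor, oppA_h, map_neg, LinearMap.neg_apply, neg_neg, oppR_dR, oppR_dR,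
      hX.dR_dR e₁ e₂ e]
  dA_dA e₁ e₂ e a := by
    apply oppA_injective
    rw [oppA_bracket, oppA_h, map_neg, LinearMap.neg_apply, neg_neg, oppA_dA, oppA_dA,
      hX.dA_dA e₁ e₂ e]
  dA_h e := by
    apply oppA_injective
    rw [oppA_dA, oppA_h, map_neg, hX.dA_h e, neg_zero, map_zero]
  unit_bracket e a := by
    apply oppA_injective
    rw [oppA_bracket, oppA_unit, hX.unit_bracket, neg_zero, map_zero]
  unit_anchor e r := by
    apply oppR_injective
    rw [oppR_anchor, oppA_unit, hX.unit_anchor, neg_zero, map_zero]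
  dA_unit e := hX.dA_unit e

end Opposite

/-! ### From right modules over the opposite to left modules -/

section LeftOfRight

/-- The inverse of an isomorphism of unital CDG Lie algebroids. -/
def UnitalHom.symm {P Q : UnitalCDGData k} (Φ : UnitalHom P Q) (hΦ : Φ.IsIso) : UnitalHom Q P where
  onR n := (LinearEquiv.ofBijective (Φ.onR n) (hΦ.onR n)).symm.toLinearMap
  onA n := (LinearEquiv.ofBijective (Φ.onA n) (hΦ.onA n)).symm.toLinearMap
  map_one := (LinearEquiv.symm_apply_eq _).2 Φ.map_one.symm
  map_mul e r s := by
    refine (LinearEquiv.symm_apply_eq _).2 ((Φ.map_mul e _ _).trans ?_).symm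
    congr 1
    · exact congrArg _ (LinearEquiv.apply_symm_apply (LinearEquiv.ofBijective _ _) _)
    · exact LinearEquiv.apply_symm_apply (LinearEquiv.ofBijective _ _) _
  map_smul e r s := by
    refine (LinearEquiv.symm_apply_eq _).2 ((Φ.map_smul e _ _).trans ?_).symm
    congr 1
    · exact congrArg _ (LinearEquiv.apply_symm_apply (LinearEquiv.ofBijective _ _) _)
    · exact LinearEquiv.apply_symm_apply (LinearEquiv.ofBijective _ _) _
  map_bracket e r s := by
    refine (LinearEquiv.symm_apply_eq _).2 ((Φ.map_bracket e _ _).trans ?_).symm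
    congr 1
    · exact congrArg _ (LinearEquiv.apply_symm_apply (LinearEquiv.ofBijective _ _) _)
    · exact LinearEquiv.apply_symm_apply (LinearEquiv.ofBijective _ _) _
  map_anchor e r s := by
    refine (LinearEquiv.symm_apply_eq _).2 ((Φ.map_anchor e _ _).trans ?_).symm
    congr 1
    · exact congrArg _ (LinearEquiv.apply_symm_apply (LinearEquiv.ofBijective _ _) _)
    · exact LinearEquiv.apply_symm_apply (LinearEquiv.ofBijective _ _) _
  map_dR e r := by
    refine (LinearEquiv.symm_apply_eq _).2 ((Φ.map_dR e _).trans ?_).symm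
    exact congrArg _ (LinearEquiv.apply_symm_apply (LinearEquiv.ofBijective _ _) _)
  map_dA e r := by
    refine (LinearEquiv.symm_apply_eq _).2 ((Φ.map_dA e _).trans ?_).symm
    exact congrArg _ (LinearEquiv.apply_symm_apply (LinearEquiv.ofBijective _ _) _)
  map_h := (LinearEquiv.symm_apply_eq _).2 Φ.map_h.symm
  map_unit := (LinearEquiv.symm_apply_eq _).2 Φ.map_unit.symm

/-- The restriction of a right module along a morphism. -/
def RightModuleData.restrict {P Q : UnitalCDGData k} (Ψ : UnitalHom Q P)
    (M : RightModuleData P.toCDGData) : RightModuleData Q.toCDGData where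
  N := M.N
  actR {_ j _} e := (M.actR e).compl₂ (Ψ.onR j)
  actA {_ j _} e := (M.actA e).compl₂ (Ψ.onA j)
  d e := M.d e

theorem IsUnitalRightCDGModule.restrict {P Q : UnitalCDGData k} (Ψ : UnitalHom Q P)
    {M : RightModuleData P.toCDGData} (hM : IsUnitalRightCDGModule M) :
    IsUnitalRightCDGModule (P := Q) (M.restrict Ψ) where
  act_one e x := (congrArg (M.actR e x) Ψ.map_one).trans (hM.act_one e x)
  act_mul e₁ e₂ e₃ e₄ x r s := (hM.act_mul e₁ e₂ e₃ e₄ x _ _).trans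
    (congrArg (M.actR e₄ x) (Ψ.map_mul e₃ r s).symm)
  act_smul e₁ e₂ e₃ e₄ x r a := (hM.act_smul e₁ e₂ e₃ e₄ x _ _).trans
    (congrArg (M.actA e₄ x) (Ψ.map_smul e₃ r a).symm)
  act_anchor e₁ e₂ e₃ e₄ e₅ e₆ x a r := (congrArg (M.actR e₆ x) (Ψ.map_anchor e₅ a r)).trans
    (hM.act_anchor e₁ e₂ e₃ e₄ e₅ e₆ x _ _)
  act_bracket e₁ e₂ e₃ e₄ e₅ e₆ x a b := (congrArg (M.actA e₆ x) (Ψ.map_bracket e₅ a b)).trans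
    (hM.act_bracket e₁ e₂ e₃ e₄ e₅ e₆ x _ _)
  d_actR {i j _ _ _ _} e ei ej en e₁ e₂ x r := (hM.d_actR e ei ej en e₁ e₂ x (Ψ.onR j r)).trans
    (congrArg (fun t => M.actR e₁ (M.d ei x) (Ψ.onR j r) + i.negOnePow • M.actR e₂ x t)
      (Ψ.map_dR ej r).symm)
  d_actA {i j _ _ _ _} e ei ej en e₁ e₂ x r := (hM.d_actA e ei ej en e₁ e₂ x (Ψ.onA j r)).trans
    (congrArg (fun t => M.actA e₁ (M.d ei x) (Ψ.onA j r) + i.negOnePow • M.actA e₂ x t)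
      (Ψ.map_dA ej r).symm)
  d_d e₁ e₂ e x := (hM.d_d e₁ e₂ e x).trans (congrArg (fun t => -M.actA e x t) Ψ.map_h.symm)
  act_unit e x := (congrArg (M.actA e x) Ψ.map_unit).trans (hM.act_unit e x)

variable {X : CDGData k} {i j l n : ℤ}

variable (X) in
/-- The base of `X` as the base of the opposite of `R ⊕ A`. -/
def toOppR {n : ℤ} : X.R n →ₗ[k] (opp (adjoinUnit X)).R n := LinearMap.id

variable (X) in
/-- The inclusion of `A` into the opposite of `R ⊕ A`. -/
def toOppA {n : ℤ} : X.A n →ₗ[k] (opp (adjoinUnit X)).A n := LinearMap.inr k (X.R n) (X.A n)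

theorem toOppR_one : toOppR X X.one = (opp (adjoinUnit X)).one := rfl
theorem toOppR_mul (e : i + j = n) (r : X.R i) (s : X.R j) :
    toOppR X (X.mul e r s) = (opp (adjoinUnit X)).mul e (toOppR X r) (toOppR X s) := rfl
theorem toOppR_dR (e : i + 1 = n) (r : X.R i) :
    toOppR X (X.dR e r) = (opp (adjoinUnit X)).dR e (toOppR X r) := rfl
theorem toOppR_anchor (e : i + j = n) (a : X.A i) (r : X.R j) :
    toOppR X (X.anchor e a r) = -(opp (adjoinUnit X)).anchor e (toOppA X a) (toOppR X r) :=
  (neg_neg (X.anchor e a r)).symm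

theorem fst_toOppA (a : X.A n) : adjFst X (oppA (adjoinUnit X) (toOppA X a)) = 0 := rfl
theorem snd_toOppA (a : X.A n) : adjSnd X (oppA (adjoinUnit X) (toOppA X a)) = a := rfl
theorem oppR_toOppR (r : X.R n) : adjR X (oppR (adjoinUnit X) (toOppR X r)) = r := rfl

theorem toOppA_dA (e : i + 1 = n) (a : X.A i) :
    toOppA X (X.dA e a) = (opp (adjoinUnit X)).dA e (toOppA X a) := by
  apply oppA_injective
  apply adj_ext
  · rw [oppA_dA, adjFst_dA, fst_toOppA, fst_toOppA, map_zero]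
  · rw [oppA_dA, adjSnd_dA, snd_toOppA, snd_toOppA]

theorem toOppA_h : toOppA X X.h = -(opp (adjoinUnit X)).h := by
  apply oppA_injective
  rw [map_neg, oppA_h, neg_neg]
  rfl

theorem toOppA_bracket (e : i + j = n) (a : X.A i) (b : X.A j) :
    toOppA X (X.bracket e a b) = -(opp (adjoinUnit X)).bracket e (toOppA X a) (toOppA X b) := by
  apply oppA_injective
  rw [map_neg, oppA_bracket, neg_neg]
  apply adj_ext
  · rw [adjFst_bracket, fst_toOppA, fst_toOppA, fst_toOppA, map_zero, map_zero, smul_zero,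
      sub_zero]
  · rw [adjSnd_bracket, snd_toOppA, snd_toOppA, snd_toOppA]

/-- The inclusion of `A` is not linear for the twisted module structure; the defect is the multiple
of the unit added in the opposite. -/
theorem toOppA_smul (hX : IsCDGLieAlgebroid X) (e : i + j = n) (r : X.R i) (a : X.A j) :
    toOppA X (X.smul e r a) = (opp (adjoinUnit X)).smul e (toOppR X r) (toOppA X a) -
      sg k (i * j) • scalar (opp (adjoinUnit X))
        (toOppR X (X.anchor ((add_comm j i).trans e) a r)) := by
  have hY := isUnital_adjoinUnit hX
  have hs (t : X.R n) : oppA _ (scalar (opp (adjoinUnit X)) (toOppR X t)) =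
      scalar (adjoinUnit X) (oppR _ (toOppR X t)) := by
    rw [← smul_unit, oppA_smul, oppA_unit, hY.unit_anchor, map_zero, smul_zero, add_zero, smul_unit]
  apply oppA_injective
  rw [map_sub, map_smul, hs, oppA_smul]
  have : (adjoinUnit X).anchor ((add_comm j i).trans e) (oppA (adjoinUnit X) (toOppA X a))
      (oppR (adjoinUnit X) (toOppR X r)) =
      oppR (adjoinUnit X) (toOppR X (X.anchor ((add_comm j i).trans e) a r)) := rfl
  rw [this, add_sub_cancel_right]
  apply adj_ext
  · rw [adjFst_smul, fst_toOppA, fst_toOppA, map_zero]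
  · rw [adjSnd_smul, snd_toOppA, snd_toOppA, oppR_toOppR]

/-- The left module over `X` given by a right module over the opposite of `R ⊕ A`. -/
def RightModuleData.toLeft (M : RightModuleData (opp (adjoinUnit X)).toCDGData) :
    LeftModuleData X where
  N := M.N
  actR {i j _} e := sg k (i * j) • ((M.actR ((add_comm j i).trans e)).flip ∘ₗ toOppR X)
  actA {i j _} e := sg k (i * j) • ((M.actA ((add_comm j i).trans e)).flip ∘ₗ toOppA X)
  d e := M.d e

variable {M : RightModuleData (opp (adjoinUnit X)).toCDGData}

variable (M) in
/-- The identification of the underlying space of `M.toLeft` with that of `M`. -/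
def leftVal {n : ℤ} : M.toLeft.N n →ₗ[k] M.N n := LinearMap.id

theorem leftVal_injective : Function.Injective (leftVal M (n := n)) := fun _ _ h => h

theorem leftVal_actR (e : i + j = n) (e' : j + i = n) (r : X.R i) (x : M.toLeft.N j) :
    leftVal M (M.toLeft.actR e r x) = sg k (i * j) • M.actR e' (leftVal M x) (toOppR X r) := rfl

theorem leftVal_actA (e : i + j = n) (e' : j + i = n) (a : X.A i) (x : M.toLeft.N j) :
    leftVal M (M.toLeft.actA e a x) = sg k (i * j) • M.actA e' (leftVal M x) (toOppA X a) := rfl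

theorem leftVal_d (e : i + 1 = n) (x : M.toLeft.N i) :
    leftVal M (M.toLeft.d e x) = M.d e (leftVal M x) := rfl

theorem IsUnitalRightCDGModule.act_scalar (hM : IsUnitalRightCDGModule M) (e : i + j = n)
    (x : M.N i) (t : (opp (adjoinUnit X)).R j) :
    M.actA e x (scalar _ t) = M.actR e x t := by
  rw [← smul_unit]
  exact (hM.act_smul e (add_zero n) (add_zero j) e x t _).symm.trans (hM.act_unit _ _)

theorem IsUnitalRightCDGModule.toLeft (hX : IsCDGLieAlgebroid X) (hM : IsUnitalRightCDGModule M) :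
    IsLeftCDGModule M.toLeft where
  one_act {i} e x := by
    apply leftVal_injective
    rw [leftVal_actR e (by omega), toOppR_one, zero_mul, sg_zero, one_smul, hM.act_one]
  mul_act {i j l ij jl n} e₁ e₂ e₃ e₄ r s x := by
    apply leftVal_injective
    rw [leftVal_actR e₂ (by omega), leftVal_actR e₄ (by omega), leftVal_actR e₃ (by omega),
      map_smul, LinearMap.smul_apply, hM.act_mul _ _ (jl := ij) (by omega) (by omega),
      ← toOppR_mul, hX.mul_comm e₁ (by omega), negOnePow_smul_eq (k := k), map_smul, map_smul]
    subst e₁ e₃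
    simp only [mul_add, add_mul, sg_add]
    module
  smul_act {i j l ij jl n} e₁ e₂ e₃ e₄ r a x := by
    apply leftVal_injective
    -- The right action of the twisted product applies r before a. The unit term, which acts as an
    -- element of `R`, is a commutator by `act_anchor`, and it exchanges the two.
    rw [leftVal_actA e₂ (by omega), leftVal_actR e₄ (by omega), leftVal_actA e₃ (by omega),
      map_smul, LinearMap.smul_apply, toOppA_smul hX, map_sub, map_smul, hM.act_scalar,
      toOppR_anchor, map_neg,
      hM.act_anchor (ij := jl) (by omega) (by omega) (il := l + i) (by omega) (by omega),
      ← hM.act_smul (ij := l + i) rfl (by omega), negOnePow_smul_eq (k := k)]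
    subst e₁ e₃
    simp only [mul_add, add_mul, sg_add, mul_comm j i, mul_comm l i, mul_comm l j]
    rcases sg_cases (k := k) (i * j) with h | h <;> rcases sg_cases (k := k) (i * l) with h' | h' <;>
        rcases sg_cases (k := k) (j * l) with h'' | h'' <;> simp only [h, h', h''] <;> module
  act_act {i j l ij jl il n} e₁ e₂ e₃ e₄ e₅ e₆ a r x := by
    apply leftVal_injective
    rw [map_add, negOnePow_smul_eq (k := k), map_smul, leftVal_actA e₂ (by omega),
      leftVal_actR e₁ (by omega), leftVal_actR e₄ (by omega), leftVal_actR e₆ (by omega),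
      leftVal_actA e₅ (by omega), toOppR_anchor, map_neg,
      hM.act_anchor (ij := il) (by omega) (by omega) (il := jl) (by omega) (by omega),
      negOnePow_smul_eq (k := k)]
    simp only [map_smul, LinearMap.smul_apply]
    subst e₁ e₃ e₅
    simp only [mul_add, add_mul, sg_add, mul_comm j i, mul_comm l i, mul_comm l j]
    rcases sg_cases (k := k) (i * j) with h | h <;> rcases sg_cases (k := k) (i * l) with h' | h' <;>
        rcases sg_cases (k := k) (j * l) with h'' | h'' <;> simp only [h, h', h''] <;> module
  bracket_act {i j l ij jl il n} e₁ e₂ e₃ e₄ e₅ e₆ a b x := by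
    apply leftVal_injective
    rw [map_sub, negOnePow_smul_eq (k := k), map_smul, leftVal_actA e₂ (by omega),
      leftVal_actA e₁ (by omega), leftVal_actA e₄ (by omega), leftVal_actA e₆ (by omega),
      leftVal_actA e₅ (by omega), toOppA_bracket, map_neg,
      hM.act_bracket (ij := il) (by omega) (by omega) (il := jl) (by omega) (by omega),
      negOnePow_smul_eq (k := k)]
    simp only [map_smul, LinearMap.smul_apply]
    subst e₁ e₃ e₅
    simp only [mul_add, add_mul, sg_add, mul_comm j i, mul_comm l i, mul_comm l j]
    rcases sg_cases (k := k) (i * j) with h | h <;> rcases sg_cases (k := k) (i * l) with h' | h' <;>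
        rcases sg_cases (k := k) (j * l) with h'' | h'' <;> simp only [h, h', h''] <;> module
  d_actR {i j n i' j' n'} e ei ej en e₁ e₂ r x := by
    apply leftVal_injective
    rw [map_add, negOnePow_smul_eq (k := k), map_smul, leftVal_d, leftVal_actR e (by omega),
      leftVal_actR e₁ (by omega), leftVal_actR e₂ (by omega), leftVal_d, toOppR_dR, map_smul,
      hM.d_actR _ ej ei en (by omega) (by omega), negOnePow_smul_eq (k := k)]
    subst ei ej
    simp only [mul_add, add_mul, sg_add, mul_one, one_mul]
    rcases sg_cases (k := k) i with h | h <;> rcases sg_cases (k := k) j with h' | h' <;>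
        simp only [h, h'] <;> module
  d_actA {i j n i' j' n'} e ei ej en e₁ e₂ r x := by
    apply leftVal_injective
    rw [map_add, negOnePow_smul_eq (k := k), map_smul, leftVal_d, leftVal_actA e (by omega),
      leftVal_actA e₁ (by omega), leftVal_actA e₂ (by omega), leftVal_d, toOppA_dA, map_smul,
      hM.d_actA _ ej ei en (by omega) (by omega), negOnePow_smul_eq (k := k)]
    subst ei ej
    simp only [mul_add, add_mul, sg_add, mul_one, one_mul]
    rcases sg_cases (k := k) i with h | h <;> rcases sg_cases (k := k) j with h' | h' <;>
        simp only [h, h'] <;> module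
  d_d {i j n} e₁ e₂ e x := by
    apply leftVal_injective
    rw [leftVal_d, leftVal_d, leftVal_actA e (by omega), toOppA_h, map_neg,
      hM.d_d e₁ e₂ (by omega), two_mul, sg_add, sg_mul_self, one_smul]

/-- Right CDG-modules over a unital CDG Lie algebroid isomorphic to the opposite of `R ⊕ A` are left
CDG-modules over `A`. -/
theorem isLeftCDGModule_leftOfRight (hX : IsCDGLieAlgebroid X) {P : UnitalCDGData k}
    (Φ : UnitalHom P (opp (adjoinUnit X))) (hΦ : Φ.IsIso) {N : RightModuleData P.toCDGData}
    (hN : IsUnitalRightCDGModule N) : IsLeftCDGModule (leftOfRight Φ hΦ N) := by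
  have h := (hN.restrict (Φ.symm hΦ)).toLeft hX
  -- The left module is the pullback along Φ⁻¹ followed by the change of side; only the form of the
  -- sign differs.
  have e : leftOfRight Φ hΦ N = (N.restrict (Φ.symm hΦ)).toLeft := by
    simp only [leftOfRight, RightModuleData.toLeft, RightModuleData.restrict]
    congr 1
    · funext i j n e
      ext r x
      exact negOnePow_smul_eq (k := k) _ _
    · funext i j n e
      ext a x
      exact negOnePow_smul_eq (k := k) _ _
  exact e ▸ h

end LeftOfRight

end Unital

/-! ### An extension of the trace of operators of finite rank -/

section ExtTrace

variable (k : Type u) [Field k] (V : Type v) [AddCommGroup V] [Module k V]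

/-- The operators of finite rank. -/
def finiteRank : Submodule k (V →ₗ[k] V) where
  carrier := {f | Module.Finite k (LinearMap.range f)}
  zero_mem' := by
    change Module.Finite k (LinearMap.range (0 : V →ₗ[k] V))
    rw [LinearMap.range_zero]
    infer_instance
  add_mem' {f g} (hf : Module.Finite k (LinearMap.range f))
      (hg : Module.Finite k (LinearMap.range g)) :=
    Submodule.finiteDimensional_of_le (S₂ := LinearMap.range f ⊔ LinearMap.range g) (by
      rintro _ ⟨x, rfl⟩
      exact Submodule.add_mem_sup ⟨x, rfl⟩ ⟨x, rfl⟩)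
  smul_mem' t f (hf : Module.Finite k (LinearMap.range f)) :=
    Submodule.finiteDimensional_of_le (S₂ := LinearMap.range f) (by
      rintro _ ⟨x, rfl⟩
      exact Submodule.smul_mem _ _ ⟨x, rfl⟩)

/-- Any linear extension will do. It permits splitting the trace of a finite-rank operator into
summands of infinite rank, whose values cancel whatever the extension is. -/
theorem exists_extTrace : ∃ T : (V →ₗ[k] V) →ₗ[k] k,
    ∀ f : V →ₗ[k] V, Module.Finite k (LinearMap.range f) → T f = finiteRankTrace f := by
  let t : finiteRank k V →ₗ[k] k :=
    { toFun := fun f => finiteRankTrace f.1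
      map_add' := fun f g => finiteRankTrace_add _ _ f.2 g.2
      map_smul' := fun t f => finiteRankTrace_smul _ _ f.2 }
  obtain ⟨T, hT⟩ := LinearMap.exists_extend t
  exact ⟨T, fun f hf => congrArg (fun F => F ⟨f, hf⟩) hT⟩

/-- A linear functional on all operators that extends the trace of operators of finite rank. -/
def extTrace : (V →ₗ[k] V) →ₗ[k] k := (exists_extTrace k V).choose

variable {k V}

theorem extTrace_eq {f : V →ₗ[k] V} (hf : Module.Finite k (LinearMap.range f)) :
    extTrace k V f = finiteRankTrace f := (exists_extTrace k V).choose_spec f hf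

theorem finite_range_comp_left {W : Type*} [AddCommGroup W] [Module k W] {f : V →ₗ[k] W}
    (hf : Module.Finite k (LinearMap.range f)) {U : Type*} [AddCommGroup U] [Module k U]
    (g : W →ₗ[k] U) : Module.Finite k (LinearMap.range (g ∘ₗ f)) := by
  rw [LinearMap.range_comp]
  infer_instance

theorem finite_range_comp_right {W : Type*} [AddCommGroup W] [Module k W] {f : V →ₗ[k] W}
    (hf : Module.Finite k (LinearMap.range f)) {U : Type*} [AddCommGroup U] [Module k U]
    (g : U →ₗ[k] V) : Module.Finite k (LinearMap.range (f ∘ₗ g)) :=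
  Submodule.finiteDimensional_of_le (LinearMap.range_comp_le_range _ _)

/-- Both composites live on finite-dimensional ranges, between which `f` and `g` restrict, so the
usual cyclicity applies. -/
theorem finiteRankTrace_comm {f : V →ₗ[k] V} (hf : Module.Finite k (LinearMap.range f))
    (g : V →ₗ[k] V) : finiteRankTrace (f ∘ₗ g) = finiteRankTrace (g ∘ₗ f) := by
  have := finite_range_comp_left hf g
  rw [finiteRankTrace_eq (f ∘ₗ g) (LinearMap.range f) fun x => ⟨g x, rfl⟩,
    finiteRankTrace_eq (g ∘ₗ f) (LinearMap.range (g ∘ₗ f)) fun x => ⟨x, rfl⟩]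
  let f' : LinearMap.range (g ∘ₗ f) →ₗ[k] LinearMap.range f :=
    f.restrict (q := LinearMap.range f) fun x _ => ⟨x, rfl⟩
  let g' : LinearMap.range f →ₗ[k] LinearMap.range (g ∘ₗ f) :=
    g.restrict (by rintro _ ⟨x, rfl⟩; exact ⟨x, rfl⟩)
  exact (LinearMap.trace_comp_comm' (R := k) f' g').symm

theorem extTrace_comm {f : V →ₗ[k] V} (hf : Module.Finite k (LinearMap.range f))
    (g : V →ₗ[k] V) : extTrace k V (f ∘ₗ g) = extTrace k V (g ∘ₗ f) := by
  rw [extTrace_eq (finite_range_comp_left hf g), extTrace_eq (finite_range_comp_right hf g),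
    finiteRankTrace_comm hf]

theorem finiteRankTrace_eq_zero {f : V →ₗ[k] V} (W : Submodule k V) [Module.Finite k W]
    (h : ∀ x, f x ∈ W) (h' : ∀ x ∈ W, f x = 0) : finiteRankTrace f = 0 := by
  rw [finiteRankTrace_eq f W h]
  convert map_zero (LinearMap.trace k W)
  ext x
  exact h' x x.2

end ExtTrace

/-! ### The critical cocycle -/

section Cocycle

variable {k : Type u} [Field k] {g : Type v} [AddCommGroup g] [Module k g]
  {br : g →ₗ[k] g →ₗ[k] g} {B : Submodule k g} {s : (g ⧸ B) →ₗ[k] g}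
  {hs : ∀ x, B.mkQ (s x) = x}

variable (B s hs) in
/-- The component of `x` in `b`. -/
def compB : g →ₗ[k] B := LinearMap.fst k B (g ⧸ B) ∘ₗ (splitting B s hs).toLinearMap

theorem coe_compB (x : g) : (compB B s hs x : g) = x - s (B.mkQ x) := rfl

theorem compB_add_section (x : g) : (compB B s hs x : g) + s (B.mkQ x) = x := by
  rw [coe_compB, sub_add_cancel]

theorem compB_coe (x : B) : compB B s hs x = x := by
  ext
  rw [coe_compB, (by simp : B.mkQ (x : g) = 0), map_zero, sub_zero]

theorem adCB_apply (x : g) (z : g ⧸ B) : adCB br B s hs x z = compB B s hs (br x (s z)) := rfl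

theorem adBC_apply (x : g) (y : B) : adBC br B x y = B.mkQ (br x y) := rfl

variable [TopologicalSpace g] (hg : IsTateLieAlgebra br) (hB : IsCLattice B)

theorem criticalCocycle_apply (x y : g) : criticalCocycle s hs hg hB x y =
    extTrace k (g ⧸ B) (adBC br B y ∘ₗ adCB br B s hs x) -
      extTrace k (g ⧸ B) (adBC br B x ∘ₗ adCB br B s hs y) := by
  rw [← map_sub, extTrace_eq (adOp_finite s hs hg hB x y)]
  rfl

theorem criticalCocycle_skew (x y : g) :
    criticalCocycle s hs hg hB x y = -criticalCocycle s hs hg hB y x := by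
  rw [criticalCocycle_apply, criticalCocycle_apply, neg_sub]

-- The off-diagonal block of a commutator of 2 × 2 block operators: the Jacobi identity with the
-- middle vector decomposed along `b ⊕ c`.
include hg in
theorem adCB_br (x y : g) : adCB br B s hs (br x y) =
    (compB B s hs ∘ₗ br x ∘ₗ B.subtype) ∘ₗ adCB br B s hs y +
      adCB br B s hs x ∘ₗ (B.mkQ ∘ₗ br y ∘ₗ s) -
      (compB B s hs ∘ₗ br y ∘ₗ B.subtype) ∘ₗ adCB br B s hs x -
      adCB br B s hs y ∘ₗ (B.mkQ ∘ₗ br x ∘ₗ s) := by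
  refine LinearMap.ext fun z => ?_
  have hj : br (br x y) (s z) = br x (br y (s z)) - br y (br x (s z)) := by
    rw [hg.jacobi x y, add_sub_cancel_right]
  simp only [LinearMap.sub_apply, LinearMap.add_apply, LinearMap.comp_apply, adCB_apply,
    Submodule.subtype_apply]
  rw [hj, map_sub]
  conv_lhs => rw [← compB_add_section (hs := hs) (br y (s z)),
    ← compB_add_section (hs := hs) (br x (s z))]
  simp only [map_add]
  abel

include hg in
theorem adBC_br (x y : g) : adBC br B (br x y) =
    adBC br B x ∘ₗ (compB B s hs ∘ₗ br y ∘ₗ B.subtype) +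
      (B.mkQ ∘ₗ br x ∘ₗ s) ∘ₗ adBC br B y -
      adBC br B y ∘ₗ (compB B s hs ∘ₗ br x ∘ₗ B.subtype) -
      (B.mkQ ∘ₗ br y ∘ₗ s) ∘ₗ adBC br B x := by
  refine LinearMap.ext fun z => ?_
  have hj : br (br x y) z = br x (br y z) - br y (br x z) := by
    rw [hg.jacobi x y, add_sub_cancel_right]
  simp only [LinearMap.sub_apply, LinearMap.add_apply, LinearMap.comp_apply, adBC_apply,
    Submodule.subtype_apply]
  rw [hj, map_sub]
  conv_lhs => rw [← compB_add_section (hs := hs) (br y z),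
    ← compB_add_section (hs := hs) (br x z)]
  simp only [map_add]
  abel

/-- The cocycle identity. -/
theorem criticalCocycle_jacobi (x y z : g) :
    criticalCocycle s hs hg hB x (br y z) = criticalCocycle s hs hg hB (br x y) z +
      criticalCocycle s hs hg hB y (br x z) := by
  -- Only the `c → c` blocks have to be moved around the trace, past a product of finite rank. The
  -- terms with `b → b` blocks already stand between the same two factors and cancel.
  have hc (a b c : g) : extTrace k (g ⧸ B) ((B.mkQ ∘ₗ br a ∘ₗ s) ∘ₗ
      (adBC br B b ∘ₗ adCB br B s hs c)) = extTrace k (g ⧸ B) (adBC br B b ∘ₗ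
        (adCB br B s hs c ∘ₗ (B.mkQ ∘ₗ br a ∘ₗ s))) := by
    rw [← extTrace_comm (adBC_comp_finite s hs hg hB c b), LinearMap.comp_assoc]
  simp only [criticalCocycle_apply, adCB_br hg, adBC_br (hs := hs) hg, LinearMap.comp_add,
    LinearMap.comp_sub, LinearMap.add_comp, LinearMap.sub_comp, map_add, map_sub,
    LinearMap.comp_assoc] at hc ⊢
  simp only [hc]
  ring

/-- Elements of a subalgebra have no component from `b` to `c`. -/
theorem criticalCocycle_eq_zero (hBs : ∀ x ∈ B, ∀ y ∈ B, br x y ∈ B) {x y : g} (hx : x ∈ B)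
    (hy : y ∈ B) : criticalCocycle s hs hg hB x y = 0 := by
  have h (x) (hx : x ∈ B) : adBC br B x = 0 := by
    ext z
    simpa [adBC_apply] using hBs x hx z z.2
  rw [criticalCocycle_apply, h x hx, h y hy]
  simp

/-- For `x ∈ b` only one trace remains, of an operator with values in the fixed finite-dimensional
range of `adBC y`. It is zero once that operator kills a finite spanning set of this range, which is
an open condition on `x`. -/
theorem criticalCocycle_eq_zero_of_forall (hBs : ∀ x ∈ B, ∀ y ∈ B, br x y ∈ B) (y : g) :
    ∃ U : Set g, IsOpen U ∧ 0 ∈ U ∧ ∀ x ∈ U, criticalCocycle s hs hg hB x y = 0 := by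
  have hc (y) : Continuous (br y) := hg.continuous.comp (Continuous.prodMk_right y)
  have hc' (y) : Continuous fun x => br x y := hg.continuous.comp (Continuous.prodMk_left y)
  have := adBC_finite hg hB y
  obtain ⟨S, hS⟩ := Module.Finite.iff_fg.1 this
  -- If [x, s z] lies in `b` it is its own `b`-component, and if [y, [x, s z]] lies in `b` too, its
  -- class in `c` is zero.
  let U : Set g := B ∩ ⋂ z ∈ S, (fun x => br x (s z)) ⁻¹' (B ∩ br y ⁻¹' B)
  refine ⟨U, hB.isOpen.inter (isOpen_biInter_finset fun z _ =>
    (hB.isOpen.inter (hB.isOpen.preimage (hc y))).preimage (hc' (s z))), by simp [U], ?_⟩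
  rintro x ⟨hx, hxS⟩
  rw [Set.mem_iInter₂] at hxS
  have h0 : adBC br B x = 0 := by
    ext z
    simpa [adBC_apply] using hBs x hx z z.2
  rw [criticalCocycle_apply, h0, LinearMap.zero_comp, map_zero, sub_zero,
    extTrace_eq (adBC_comp_finite s hs hg hB x y)]
  refine finiteRankTrace_eq_zero (LinearMap.range (adBC br B y)) (fun z => ⟨_, rfl⟩) fun z hz => ?_
  rw [← hS] at hz
  refine Submodule.span_induction (fun z hz => ?_) (map_zero _) (fun z z' _ _ h h' => ?_)
    (fun t z _ h => ?_) hz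
  · obtain ⟨h1, h2⟩ := hxS z hz
    rw [LinearMap.comp_apply, adCB_apply, adBC_apply]
    have h3 : compB B s hs (br x (s z)) = ⟨br x (s z), h1⟩ := compB_coe (hs := hs) ⟨_, h1⟩
    rw [h3]
    exact (Submodule.Quotient.mk_eq_zero B).2 h2
  · rw [map_add, h, h', add_zero]
  · rw [map_smul, h, smul_zero]

theorem criticalCocycle_continuous (hBs : ∀ x ∈ B, ∀ y ∈ B, br x y ∈ B) :
    @Continuous (g × g) k _ ⊥ fun p => criticalCocycle s hs hg hB p.1 p.2 := by
  let _ : TopologicalSpace k := ⊥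
  have : DiscreteTopology k := ⟨rfl⟩
  have := hg.tate.addGroup
  rw [continuous_iff_continuousAt]
  rintro ⟨x, y⟩
  obtain ⟨U, hU, hU0, hUy⟩ := criticalCocycle_eq_zero_of_forall (s := s) (hs := hs) hg hB hBs y
  obtain ⟨U', hU', hU0', hUx⟩ := criticalCocycle_eq_zero_of_forall (s := s) (hs := hs) hg hB hBs x
  rw [ContinuousAt, nhds_discrete k, tendsto_pure]
  have h1 : ∀ᶠ p : g × g in 𝓝 (x, y), p.1 - x ∈ U ∩ B := by
    refine (continuous_fst.sub continuous_const).continuousAt.eventually_mem ?_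
    exact (hU.inter hB.isOpen).mem_nhds (by simp [hU0])
  have h2 : ∀ᶠ p : g × g in 𝓝 (x, y), p.2 - y ∈ U' ∩ B := by
    refine (continuous_snd.sub continuous_const).continuousAt.eventually_mem ?_
    exact (hU'.inter hB.isOpen).mem_nhds (by simp [hU0'])
  filter_upwards [h1, h2] with p hp hp'
  have e1 := hUy _ hp.1
  have e2 := hUx _ hp'.1
  have e3 := criticalCocycle_eq_zero (s := s) (hs := hs) hg hB hBs hp.2 hp'.2
  rw [criticalCocycle_skew] at e2
  simp only [map_sub, LinearMap.sub_apply] at e1 e2 e3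
  -- With increments u of x and v of y, the cocycle changes by ω(u, y) + ω(x, v) + ω(u, v). The last
  -- term vanishes because both increments are kept in `b`, so no uniformity in x or y is needed.
  linear_combination e1 - e2 + e3

end Cocycle

/-! ### The central extension as a Tate Lie algebra -/

section Sharp

variable {k : Type u} [Field k] {g : Type v} [AddCommGroup g] [Module k g]

/-- As an image in the quotient, the finiteness condition visibly passes to sums and images. -/
theorem finiteIndexIn_iff {V : Type*} [AddCommGroup V] [Module k V] {U W : Submodule k V} :
    FiniteIndexIn k U W ↔ Module.Finite k (U.map W.mkQ) := by
  have e := (W.mkQ ∘ₗ U.subtype).quotKerEquivRange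
  rw [LinearMap.range_comp, Submodule.range_subtype] at e
  have hk : LinearMap.ker (W.mkQ ∘ₗ U.subtype) = W.submoduleOf U := by
    rw [LinearMap.ker_comp, Submodule.ker_mkQ]; rfl
  rw [hk] at e
  exact ⟨fun h => have : Module.Finite k (↥U ⧸ W.submoduleOf U) := h; Module.Finite.equiv e,
    fun h => Module.Finite.equiv e.symm⟩

theorem FiniteIndexIn.sup {V : Type*} [AddCommGroup V] [Module k V] {U U' W : Submodule k V}
    (h : FiniteIndexIn k U W) (h' : FiniteIndexIn k U' W) : FiniteIndexIn k (U ⊔ U') W := by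
  rw [finiteIndexIn_iff] at *
  rw [Submodule.map_sup]
  infer_instance

theorem FiniteIndexIn.of_finite {V : Type*} [AddCommGroup V] [Module k V] {U : Submodule k V}
    [Module.Finite k U] (W : Submodule k V) : FiniteIndexIn k U W :=
  finiteIndexIn_iff.2 inferInstance

theorem FiniteIndexIn.map {V V' : Type*} [AddCommGroup V] [Module k V] [AddCommGroup V']
    [Module k V'] {U : Submodule k V} {W : Submodule k V'} (f : V →ₗ[k] V')
    (h : FiniteIndexIn k U (W.comap f)) : FiniteIndexIn k (U.map f) W := by
  rw [finiteIndexIn_iff] at *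
  have e : W.mkQ ∘ₗ f = (W.comap f).mapQ W f le_rfl ∘ₗ (W.comap f).mkQ := by ext; rfl
  rw [← Submodule.map_comp, e, Submodule.map_comp]
  infer_instance

variable [TopologicalSpace g]

theorem isTateSpace_centralExt (hg : IsTateSpace k g) : IsTateSpace k (CentralExt k g) := by
  let _ : TopologicalSpace k := ⊥
  have : DiscreteTopology k := ⟨rfl⟩
  have := hg.t2
  have := hg.addGroup
  have hi : Continuous fun x : g => (x, (0 : k)) := Continuous.prodMk_left 0
  refine ⟨inferInstanceAs (T2Space (g × k)), inferInstanceAs (IsTopologicalAddGroup (g × k)),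
    fun F hF hc => ?_, ?_⟩
  · change Filter (g × k) at F
    change Tendsto (fun p : (g × k) × (g × k) => p.1 - p.2) (F ×ˢ F) (𝓝 0) at hc
    have h1 : Tendsto (fun p : (g × k) × (g × k) => p.1.1 - p.2.1) (F ×ˢ F) (𝓝 0) :=
      (continuous_fst.tendsto _).comp hc
    have h2 : Tendsto (fun p : (g × k) × (g × k) => p.1.2 - p.2.2) (F ×ˢ F) (𝓝 0) :=
      (continuous_snd.tendsto _).comp hc
    obtain ⟨x, hx⟩ := hg.complete (F.map Prod.fst) (hF.map _) (by
      rw [Filter.prod_map_map_eq, tendsto_map'_iff]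
      exact h1)
    -- The `K`-coordinate is discrete, so along a Cauchy filter it is constant on some member; any
    -- point of that member supplies the limit.
    rw [nhds_discrete, tendsto_pure,
      Filter.eventually_prod_self_iff (r := fun a b : g × k => a.2 - b.2 = 0)] at h2
    obtain ⟨S, hS, h2⟩ := h2
    obtain ⟨p, hp⟩ := hF.nonempty_of_mem hS
    refine ⟨((x, p.2) : g × k), ?_⟩
    change F ≤ 𝓝 (x, p.2)
    rw [nhds_prod_eq]
    refine le_trans (b := F.map Prod.fst ×ˢ F.map Prod.snd) ?_ (Filter.prod_mono hx ?_)
    · exact Filter.le_prod.2 ⟨tendsto_map, tendsto_map⟩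
    · rw [nhds_discrete]
      refine tendsto_pure.2 (Filter.mem_of_superset hS fun q hq => ?_)
      exact sub_eq_zero.1 (h2 q hq p hp)
  · obtain ⟨𝓑, hb, hn, hf⟩ := hg.base
    let inl : g →ₗ[k] CentralExt k g := LinearMap.inl k g k
    have himg (U : Submodule k g) (hU : IsOpen (U : Set g)) :
        IsOpen ((U.map inl : Submodule k (CentralExt k g)) : Set (CentralExt k g)) := by
      have e : ((U.map inl : Submodule k (CentralExt k g)) : Set (CentralExt k g)) =
          (fun p : CentralExt k g => p.1) ⁻¹' (U : Set g) ∩ (fun p => p.2) ⁻¹' {(0 : k)} := by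
        ext ⟨x, t⟩
        constructor
        · rintro ⟨y, hy, hxy⟩
          obtain ⟨rfl, rfl⟩ := Prod.ext_iff.1 hxy
          exact ⟨hy, rfl⟩
        · rintro ⟨hx, ht⟩
          exact ⟨x, hx, Prod.ext rfl ht.symm⟩
      rw [e]
      exact (hU.preimage (continuous_fst : Continuous (Prod.fst : g × k → g))).inter
        ((isOpen_discrete _).preimage (continuous_snd : Continuous (Prod.snd : g × k → k)))
    -- The subspaces `U × 0` are open since `{0}` is open in `k K`, and commensurability is
    -- inherited from `g`.
    refine ⟨(fun U => U.map inl) '' 𝓑, ?_, ?_, ?_⟩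
    · rintro _ ⟨U, hU, rfl⟩
      exact himg U (hb U hU)
    · intro N hN
      have : (fun x : g => (x, (0 : k))) ⁻¹' N ∈ 𝓝 (0 : g) := hi.continuousAt.preimage_mem_nhds hN
      obtain ⟨U, hU, hUN⟩ := hn _ this
      refine ⟨_, ⟨U, hU, rfl⟩, ?_⟩
      rintro _ ⟨x, hx, rfl⟩
      exact hUN hx
    · rintro _ ⟨U₁, h₁, rfl⟩ _ ⟨U₂, h₂, rfl⟩
      refine FiniteIndexIn.map inl ?_
      change FiniteIndexIn k U₁ ((U₂.map inl).comap inl)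
      rw [Submodule.comap_map_eq_of_injective (f := inl) fun x y h => congrArg Prod.fst h]
      exact hf U₁ h₁ U₂ h₂

theorem isCLattice_sharpSub {B : Submodule k g} (hB : IsCLattice B) :
    IsCLattice (sharpSub k B) := by
  let _ : TopologicalSpace k := ⊥
  have hi : Continuous fun x : g => (x, (0 : k)) := Continuous.prodMk_left 0
  refine ⟨hB.isOpen.preimage (continuous_fst : Continuous (Prod.fst : g × k → g)), fun U hU => ?_⟩
  let inl : g →ₗ[k] CentralExt k g := LinearMap.inl k g k
  let inr : k →ₗ[k] CentralExt k g := LinearMap.inr k g k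
  have e : sharpSub k B = B.map inl ⊔ (⊤ : Submodule k k).map inr := by
    apply le_antisymm
    · rintro ⟨x, t⟩ hx
      have h : ((x, t) : g × k) = (x, 0) + (0, t) := by simp
      have h' : inl x + inr t ∈ B.map inl ⊔ (⊤ : Submodule k k).map inr :=
        Submodule.add_mem_sup ⟨x, hx, rfl⟩ ⟨t, trivial, rfl⟩
      exact (congrArg (· ∈ B.map inl ⊔ (⊤ : Submodule k k).map inr) h).mpr h'
    · refine sup_le ?_ ?_
      · rintro _ ⟨x, hx, rfl⟩
        exact hx
      · rintro _ ⟨x, hx, rfl⟩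
        exact B.zero_mem
  rw [e]
  exact (FiniteIndexIn.map inl (hB.bounded _ (hU.preimage hi))).sup (FiniteIndexIn.of_finite _)

variable {br : g →ₗ[k] g →ₗ[k] g} (hg : IsTateLieAlgebra br) {B : Submodule k g}
  (hB : IsCLattice B) {s : (g ⧸ B) →ₗ[k] g} {hs : ∀ x, B.mkQ (s x) = x}

theorem isTateLieAlgebra_sharpBr (hBs : ∀ x ∈ B, ∀ y ∈ B, br x y ∈ B) :
    IsTateLieAlgebra (sharpBr hg hB s hs) where
  tate := isTateSpace_centralExt hg.tate
  self x := Prod.ext (hg.self x.1) (criticalCocycle_self s hs hg hB x.1)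
  jacobi x y z := Prod.ext (hg.jacobi x.1 y.1 z.1) (criticalCocycle_jacobi hg hB x.1 y.1 z.1)
  continuous := by
    let _ : TopologicalSpace k := ⊥
    have h : Continuous fun p : (g × k) × (g × k) => (p.1.1, p.2.1) :=
      (continuous_fst.comp continuous_fst).prodMk (continuous_fst.comp continuous_snd)
    have h1 : Continuous fun p : (g × k) × (g × k) => br p.1.1 p.2.1 := hg.continuous.comp h
    have hω := criticalCocycle_continuous (s := s) (hs := hs) hg hB hBs
    generalize hc : criticalCocycle s hs hg hB = ω at hω
    have h2 : Continuous fun p : (g × k) × (g × k) => ω p.1.1 p.2.1 := hω.comp h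
    rw [sharpBr, hc]
    exact h1.prodMk h2

theorem splitG_isLiePair (hBs : ∀ x ∈ B, ∀ y ∈ B, br x y ∈ B) :
    (splitG hg s hs).IsLiePair where
  jacobi := hg.jacobi
  closed x y := by
    change B.mkQ (br ((x : g) + s 0) ((y : g) + s 0)) = 0
    rw [map_zero, add_zero, add_zero]
    exact (Submodule.Quotient.mk_eq_zero B).2 (hBs x x.2 y y.2)

theorem splitGSharp_isLiePair (hBs : ∀ x ∈ B, ∀ y ∈ B, br x y ∈ B) :
    (splitGSharp hg hB s hs).IsLiePair where
  jacobi := (isTateLieAlgebra_sharpBr hg hB hBs).jacobi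
  closed x y := by
    change B.mkQ (br ((x.1 : g) + s 0) ((y.1 : g) + s 0)) = 0
    rw [map_zero, add_zero, add_zero]
    exact (Submodule.Quotient.mk_eq_zero B).2 (hBs x.1 x.1.2 y.1 y.1.2)

end Sharp

/-! ### Cochains with values in endomorphisms -/

section EndCochains

variable {k : Type u} [Field k] {c V W Z : Type*} [AddCommGroup c] [Module k c]
  [AddCommGroup V] [Module k V] [AddCommGroup W] [Module k W] [AddCommGroup Z] [Module k Z]

local notation "Λ" => ExteriorAlgebra k c

theorem extTrace_smulRight (ρ : c →ₗ[k] k) (v : c) :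
    extTrace k c (ρ.smulRight v) = ρ v := by
  have hv (x : c) : ρ.smulRight v x ∈ k ∙ v :=
    Submodule.smul_mem _ _ (Submodule.mem_span_singleton_self v)
  rw [extTrace_eq (Submodule.finiteDimensional_of_le (S₂ := k ∙ v) ?_),
    finiteRankTrace_eq _ (k ∙ v) hv]
  · exact LinearMap.trace_smulRight (ρ ∘ₗ (k ∙ v).subtype)
      (⟨v, Submodule.mem_span_singleton_self v⟩ : k ∙ v)
  · rintro _ ⟨x, rfl⟩
    exact hv x

/-- The chain rule: differentiating u(f) differentiates either the coefficients of the field or the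
derivative of f. The minus sign is the anticommutation of the two contractions. -/
theorem jac_comp_coder (f : Λ →ₗ[k] V) {i : ℤ} {u : Λ →ₗ[k] c} (hu : u ∈ Coch k c c i) :
    jac k c V (f ∘ₗ coder u) =
      conv (LinearMap.llcomp k c c V).flip (jac k c c u) (jac k c V f) -
        sg k i • (jac k c V f ∘ₗ coder u) := by
  rw [comp_coder f, jac_conv _ hu, comp_coder (jac k c V f) u, sub_eq_add_neg, ← smul_neg]
  congr 2
  refine (conv_congr_apply (-LinearMap.id) fun ξ η => LinearMap.ext fun y => ?_).symm
  refine (map_neg f _).symm.trans (congrArg f ?_)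
  exact (wedge_wedge (u ξ) y η).symm

theorem coch_one_ext {f g : Λ →ₗ[k] V} (hf : f ∈ Coch k c V 1) (hg : g ∈ Coch k c V 1)
    (h : ∀ x, f (ExteriorAlgebra.ι k x * 1) = g (ExteriorAlgebra.ι k x * 1)) : f = g := by
  refine coch_ext hf hg fun m hm ξ hξ => ?_
  obtain rfl : m = 1 := by exact_mod_cast hm
  rw [show ⋀[k]^1 c = _ from pow_one _] at hξ
  obtain ⟨x, rfl⟩ := hξ
  simpa using h x

theorem ιInv_ι_mul_one (x : c) : ExteriorAlgebra.ιInv (ExteriorAlgebra.ι k x * 1) = x := by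
  rw [mul_one]; exact ExteriorAlgebra.ι_leftInverse x

theorem jac_ιInv : jac k c c ExteriorAlgebra.ιInv =
    LinearMap.toSpanSingleton k (c →ₗ[k] c) LinearMap.id ∘ₗ
      ExteriorAlgebra.algebraMapInv.toLinearMap :=
  LinearMap.ext fun ξ => LinearMap.ext fun y => ιInv_wedge y ξ

theorem conv_apply_mem {β : V →ₗ[k] W →ₗ[k] Z} {f : Λ →ₗ[k] V} {g : Λ →ₗ[k] W}
    {U : Submodule k Z} (h : ∀ ξ η, β (f ξ) (g η) ∈ U) (ξ : Λ) : conv β f g ξ ∈ U := by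
  rw [← Submodule.Quotient.mk_eq_zero U]
  have e : U.mkQ ∘ₗ conv β f g = conv (0 : V →ₗ[k] W →ₗ[k] Z ⧸ U) f g :=
    conv_congr_apply U.mkQ fun ξ η => (Submodule.Quotient.mk_eq_zero U).2 (h ξ η)
  exact (LinearMap.congr_fun e ξ).trans (by rw [conv_bil_zero]; rfl)

variable (k c) in
/-- The bilinear form `(A, A') ↦ tr (A A')` on the endomorphisms of `c`. -/
def trMul : Module.End k c →ₗ[k] Module.End k c →ₗ[k] k :=
  (LinearMap.mul k (Module.End k c)).compr₂ (extTrace k c)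

theorem extTrace_comp_conv_mul (F F' : Λ →ₗ[k] Module.End k c) :
    extTrace k c ∘ₗ conv (LinearMap.mul k (Module.End k c)) F F' = conv (trMul k c) F F' :=
  conv_congr_apply _ fun _ _ => rfl

/-- Traces of super commutators vanish when one factor has finite-rank values; the other factor is
arbitrary. -/
theorem conv_trMul_comm {i j : ℤ} {F F' : Λ →ₗ[k] Module.End k c}
    (hF : F ∈ Coch k c _ i) (hF' : F' ∈ Coch k c _ j)
    (h : ∀ ξ, Module.Finite k (LinearMap.range (F ξ))) :
    conv (trMul k c) F F' = sg k (i * j) • conv (trMul k c) F' F := by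
  have e : conv (trMul k c) F F' = conv (trMul k c).flip F F' :=
    conv_congr fun ξ η => extTrace_comm (h ξ) (F' η)
  rw [e, conv_comm _ hF hF', LinearMap.flip_flip]

end EndCochains

/-! ### The divergence of cochains with values in `b` -/

namespace SplitBracket

variable {k : Type u} [Field k] {G b c : Type*} [AddCommGroup G] [Module k G]
    [AddCommGroup b] [Module k b] [AddCommGroup c] [Module k c] (S : SplitBracket k G b c)

local notation "Λ" => ExteriorAlgebra k c

/-- For `z ∈ c` and `A : c → b`, the operator `y ↦ μ₁(A y, z)` on `c`. -/
def mu1Op : c →ₗ[k] (c →ₗ[k] b) →ₗ[k] Module.End k c :=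
  LinearMap.mk₂ k (fun z A => S.mu1.flip z ∘ₗ A)
    (by intros; ext; simp) (by intros; ext; simp) (by intros; ext; simp) (by intros; ext; simp)

/-- For `a : Λ c → b`, the cochain `ξ ↦ (y ↦ ∑ μ₁(a(y ∧ ξ''), ξ'_1))`. -/
def trOp (a : Λ →ₗ[k] b) : Λ →ₗ[k] Module.End k c :=
  conv S.mu1Op ExteriorAlgebra.ιInv (jac k c b a)

/-- The divergence `ξ ↦ tr_c (y ↦ ∑ μ₁(a(y ∧ ξ''), ξ'_1))` of a cochain `a : Λ c → b`. -/
def dvg : (Λ →ₗ[k] b) →ₗ[k] (Λ →ₗ[k] k) where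
  toFun a := extTrace k c ∘ₗ S.trOp a
  map_add' a a' := by rw [trOp, map_add, map_add, LinearMap.comp_add]; rfl
  map_smul' t a := by rw [trOp, map_smul, map_smul, LinearMap.comp_smul]; rfl

theorem dvg_apply (a : Λ →ₗ[k] b) : S.dvg a = extTrace k c ∘ₗ S.trOp a := rfl

variable {S} {i j n : ℤ} {a a' : ExteriorAlgebra k c →ₗ[k] b}

theorem trOp_mem (ha : a ∈ Coch k c b i) : S.trOp a ∈ Coch k c _ i :=
  conv_mem_coch _ (by omega) ιInv_mem_coch (jac_mem_coch (sub_add_cancel i 1) ha)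

theorem dvg_mem (ha : a ∈ Coch k c b i) : S.dvg a ∈ Coch k c k i :=
  comp_mem_coch _ (trOp_mem ha)

theorem finite_trOp (hfin : ∀ z, Module.Finite k (LinearMap.range (S.mu1.flip z)))
    (a : Λ →ₗ[k] b) (ξ : Λ) : Module.Finite k (LinearMap.range (S.trOp a ξ)) :=
  conv_apply_mem (U := finiteRank k c)
    (fun _ η => finite_range_comp_right (hfin _) (jac k c b a η)) ξ

/-- Contracting `corC a` with y either hits the argument of a or consumes the factor in `c`; the
second possibility is the linear action μ₁ ∘ a. So `trOp a` compares the linear action of a with the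
Jacobian of its vector field, neither of which need have a trace. -/
theorem trOp_eq (ha : a ∈ Coch k c b i) :
    S.trOp a = S.mu1 ∘ₗ a - sg k i • jac k c c (S.corC a) := by
  have e (β : b →ₗ[k] (c →ₗ[k] c) →ₗ[k] (c →ₗ[k] c)) (hβ : ∀ x A, β x A = S.mu1 x ∘ₗ A) :
      conv β a (jac k c c ExteriorAlgebra.ιInv) = S.mu1 ∘ₗ a := by
    rw [jac_ιInv, conv_congr (β' := (LinearMap.lsmul k (c →ₗ[k] c)).flip) (f' := S.mu1 ∘ₗ a)
      (g' := ExteriorAlgebra.algebraMapInv.toLinearMap), conv_counit]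
    · exact LinearMap.ext fun ξ => one_smul k _
    · intro ξ η
      rw [hβ]
      ext y
      simp
  have h : jac k c c (S.corC a) = sg k i • (S.mu1 ∘ₗ a - S.trOp a) := by
    rw [corC, jac_conv _ ha, conv_comm' (β' := S.mu1Op) (fun _ _ => rfl)
      (jac_mem_coch (sub_add_cancel i 1) ha) ιInv_mem_coch, e _ fun _ _ => rfl, mul_one, sg_sub,
      sg_one, mul_neg_one, trOp]
    module
  rw [h, smul_smul, sg_mul_self, one_smul, sub_sub_cancel]

/-- The derivative of r contributes a rank-one operator, whose trace is r differentiated along the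
vector field of a. As in ordinary calculus, div(rX) = r div X + X(r). -/
theorem dvg_smul {r : Λ →ₗ[k] k} (hr : r ∈ Coch k c k i) (ha : a ∈ Coch k c b j) :
    S.dvg (conv (LinearMap.lsmul k b) r a) = conv (LinearMap.mul k k) r (S.dvg a) +
      sg k (i * j) • (r ∘ₗ coder (S.corC a)) := by
  let γ : c →ₗ[k] (c →ₗ[k] k) →ₗ[k] (b →ₗ[k] k) :=
    LinearMap.mk₂ k (fun z ρ => ρ ∘ₗ S.mu1.flip z) (by intros; ext; simp) (by intros; ext; simp)
      (by intros; ext; simp) (by intros; ext; simp)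
  have htr (U : Λ →ₗ[k] (c →ₗ[k] b)) : extTrace k c ∘ₗ conv S.mu1Op ExteriorAlgebra.ιInv U =
      conv (S.mu1Op.compr₂ (extTrace k c)) ExteriorAlgebra.ιInv U :=
    conv_congr_apply _ fun _ _ => rfl
  rw [dvg_apply, trOp, htr, jac_conv _ hr, map_add, map_smul, add_comm]
  congr 1
  · rw [conv_left_comm (β' := LinearMap.lsmul k k) (γ' := S.mu1Op.compr₂ (extTrace k c))
      (fun z t A => ?_) ιInv_mem_coch hr, smul_smul, one_mul, sg_mul_self, one_smul, ← htr]
    · rfl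
    · change extTrace k c (S.mu1Op z (t • A)) = t • extTrace k c (S.mu1Op z A)
      rw [map_smul, map_smul]
  · rw [conv_comm _ (jac_mem_coch (sub_add_cancel i 1) hr) ha, map_smul,
      conv_left_comm (β' := LinearMap.applyₗ) (γ' := γ) (fun z x ρ => ?_) ιInv_mem_coch ha,
      smul_smul, ← sg_add, comp_coder, corC, conv_assoc (β' := LinearMap.applyₗ) (γ' := γ)
        fun _ _ _ => rfl]
    · congr 2
      ring
    · refine Eq.trans (congrArg (extTrace k c) (LinearMap.ext fun y => ?_))
        (extTrace_smulRight ρ (S.mu1 x z))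
      change S.mu1 (ρ y • x) z = ρ y • S.mu1 x z
      rw [map_smul, LinearMap.smul_apply]

theorem br_inB_inC (x : b) (z : c) :
    S.br (S.inB x) (S.inC z) = S.inB (S.mu2 x z) + S.inC (S.mu1 x z) :=
  (S.inB_prB_add _).symm

theorem IsLiePair.prC_br_inB (hS : S.IsLiePair) (x : b) (y : G) :
    S.prC (S.br (S.inB x) y) = S.mu1 x (S.prC y) := by
  conv_lhs => rw [← S.inB_prB_add y, map_add, map_add, hS.closed, zero_add]
  rfl

theorem IsLiePair.mu1_muB (hS : S.IsLiePair) (x y : b) :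
    S.mu1 (S.muB x y) = S.mu1 x ∘ₗ S.mu1 y - S.mu1 y ∘ₗ S.mu1 x := by
  refine LinearMap.ext fun z => ?_
  have h := congrArg S.prC (hS.jacobi (S.inB x) (S.inB y) (S.inC z))
  rw [map_add, ← hS.inB_muB] at h
  simp only [hS.prC_br_inB, S.prC_inC] at h
  rw [LinearMap.sub_apply, LinearMap.comp_apply, LinearMap.comp_apply]
  exact eq_sub_of_add_eq h.symm

theorem IsLiePair.mu1_conv_muB (hS : S.IsLiePair) (ha : a ∈ Coch k c b i)
    (ha' : a' ∈ Coch k c b j) : S.mu1 ∘ₗ conv S.muB a a' =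
      conv (LinearMap.mul k (Module.End k c)) (S.mu1 ∘ₗ a) (S.mu1 ∘ₗ a') -
        sg k (i * j) • conv (LinearMap.mul k (Module.End k c)) (S.mu1 ∘ₗ a') (S.mu1 ∘ₗ a) := by
  have e := conv_comm' (β := (LinearMap.mul k (Module.End k c)).flip)
    (β' := LinearMap.mul k (Module.End k c)) (fun _ _ => rfl) (comp_mem_coch S.mu1 ha)
    (comp_mem_coch S.mu1 ha')
  rw [← e, eq_sub_iff_add_eq]
  have e1 : S.mu1 ∘ₗ conv S.muB a a' = conv (S.muB.compr₂ S.mu1) a a' :=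
    conv_congr_apply _ fun _ _ => rfl
  have e2 : conv (LinearMap.mul k (Module.End k c)).flip (S.mu1 ∘ₗ a) (S.mu1 ∘ₗ a') =
      conv ((LinearMap.mul k (Module.End k c)).flip.compl₁₂ S.mu1 S.mu1) a a' :=
    conv_congr fun _ _ => rfl
  rw [e1, e2, ← conv_bil_add]
  refine conv_congr fun ξ η => ?_
  change S.mu1 (S.muB (a ξ) (a' η)) + S.mu1 (a' η) ∘ₗ S.mu1 (a ξ) =
    S.mu1 (a ξ) ∘ₗ S.mu1 (a' η)
  rw [hS.mu1_muB, sub_add_cancel]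

theorem llcomp_flip_conv {F F' : Λ →ₗ[k] (c →ₗ[k] c)} (hF : F ∈ Coch k c _ i)
    (hF' : F' ∈ Coch k c _ j) : conv (LinearMap.llcomp k c c c).flip F F' =
      sg k (i * j) • conv (LinearMap.mul k (Module.End k c)) F' F :=
  conv_comm' (fun _ _ => rfl) hF hF'

theorem jac_corC_mem (ha : a ∈ Coch k c b i) : jac k c c (S.corC a) ∈ Coch k c (c →ₗ[k] c) i :=
  jac_mem_coch rfl (S.corC_mem rfl ha)

/-- The linear actions contribute their commutator because `b` acts on `c`. The Jacobians contribute
theirs by the chain rule, and the remaining terms are derivatives of `trOp`. -/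
theorem IsLiePair.trOp_bracket (hS : S.IsLiePair) (ha : a ∈ Coch k c b i)
    (ha' : a' ∈ Coch k c b j) : S.trOp (S.bracketTot i j a a') =
      conv (LinearMap.mul k (Module.End k c)) (S.mu1 ∘ₗ a) (S.mu1 ∘ₗ a') -
      sg k (i * j) • conv (LinearMap.mul k (Module.End k c)) (S.mu1 ∘ₗ a') (S.mu1 ∘ₗ a) -
      sg k (i + j) • (conv (LinearMap.mul k (Module.End k c)) (jac k c c (S.corC a))
          (jac k c c (S.corC a')) - sg k (i * j) • conv (LinearMap.mul k (Module.End k c))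
            (jac k c c (S.corC a')) (jac k c c (S.corC a))) -
      S.trOp a' ∘ₗ coder (S.corC a) + sg k (i * j) • (S.trOp a ∘ₗ coder (S.corC a')) := by
  rw [trOp_eq (bracketTot_mem rfl ha ha'), hS.corC_bracket ha ha', bracketTot_apply,
    LinearMap.comp_add, LinearMap.comp_sub _ _ S.mu1, hS.mu1_conv_muB ha ha',
    LinearMap.comp_smul, map_add, map_neg, map_smul, jac_comp_coder _ (S.corC_mem rfl ha),
    jac_comp_coder _ (S.corC_mem rfl ha'), llcomp_flip_conv (jac_corC_mem ha) (jac_corC_mem ha'),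
    llcomp_flip_conv (jac_corC_mem ha') (jac_corC_mem ha), ← LinearMap.comp_assoc,
    ← LinearMap.comp_assoc, trOp_eq ha, trOp_eq ha']
  simp only [LinearMap.sub_comp, LinearMap.smul_comp, sg_add, sg_one, mul_comm j i]
  rcases sg_cases (k := k) (i * j) with h | h <;> rcases sg_cases (k := k) i with h' | h' <;>
    rcases sg_cases (k := k) j with h'' | h'' <;> simp only [h, h', h''] <;> module

/-- With the linear action written as `trOp` plus the Jacobian, the commutators of Jacobians cancel.
Every commutator left has a factor `trOp` of finite rank, hence zero trace. -/
theorem IsLiePair.dvg_bracket (hS : S.IsLiePair)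
    (hfin : ∀ z, Module.Finite k (LinearMap.range (S.mu1.flip z)))
    (ha : a ∈ Coch k c b i) (ha' : a' ∈ Coch k c b j) :
    S.dvg (S.bracketTot i j a a') = - S.dvg a' ∘ₗ coder (S.corC a) +
      sg k (i * j) • (S.dvg a ∘ₗ coder (S.corC a')) := by
  have eN : S.mu1 ∘ₗ a = S.trOp a + sg k i • jac k c c (S.corC a) := by
    rw [trOp_eq ha, sub_add_cancel]
  have eN' : S.mu1 ∘ₗ a' = S.trOp a' + sg k j • jac k c c (S.corC a') := by
    rw [trOp_eq ha', sub_add_cancel]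
  have h1 := conv_trMul_comm (trOp_mem (S := S) ha) (trOp_mem (S := S) ha') (finite_trOp hfin a)
  have h2 := conv_trMul_comm (trOp_mem (S := S) ha) (jac_corC_mem (S := S) ha')
    (finite_trOp hfin a)
  have h3 := conv_trMul_comm (trOp_mem (S := S) ha') (jac_corC_mem (S := S) ha)
    (finite_trOp hfin a')
  rw [dvg_apply, hS.trOp_bracket ha ha', eN, eN', dvg_apply, dvg_apply, LinearMap.comp_assoc,
    LinearMap.comp_assoc]
  rw [mul_comm j i] at h3
  simp only [map_add, map_smul, LinearMap.add_apply, LinearMap.smul_apply, LinearMap.comp_add,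
    LinearMap.comp_sub, LinearMap.comp_smul, extTrace_comp_conv_mul, h1, h2, h3, sg_add]
  rcases sg_cases (k := k) (i * j) with h | h <;> simp only [h] <;> module

variable (S) in
/-- For `z ∈ c`, the operator `y ↦ [y, z]_c` on `c`. -/
def adC : c →ₗ[k] Module.End k c := (S.br.compl₁₂ S.inC S.inC).compr₂ S.prC |>.flip

variable (S) in
/-- For `z ∈ c`, the operator `y ↦ [y, z]_b` from `c` to `b`. -/
def adH : c →ₗ[k] (c →ₗ[k] b) := (S.br.compl₁₂ S.inC S.inC).compr₂ S.prB |>.flip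

theorem jac_muC : jac k c c S.muC = S.adC ∘ₗ ExteriorAlgebra.ιInv := by
  refine coch_one_ext (jac_mem_coch (by norm_num) S.muC_mem) (comp_mem_coch _ ιInv_mem_coch)
    fun x => LinearMap.ext fun y => ?_
  rw [jac_apply, muC, liftAlternating_two_apply, LinearMap.comp_apply, ιInv_ι_mul_one]
  rfl

theorem jac_hStar : jac k c b S.hStar = S.adH ∘ₗ ExteriorAlgebra.ιInv := by
  refine coch_one_ext (jac_mem_coch (by norm_num) S.hStar_mem) (comp_mem_coch _ ιInv_mem_coch)
    fun x => LinearMap.ext fun y => ?_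
  rw [jac_apply, hStar, liftAlternating_two_apply, LinearMap.comp_apply, ιInv_ι_mul_one]
  rfl

/-- The `c`-component of the Jacobi identity for one element of `b` and two of `c`: the bracket of
`c` is preserved by `b` up to terms in which μ₂ enters. -/
theorem IsLiePair.mu1_adC (hS : S.IsLiePair) (x : b) (y z : c) :
    S.mu1 x (S.adC z y) = S.adC z (S.mu1 x y) + S.mu1 (S.mu2 x y) z +
      (S.adC (S.mu1 x z) y - S.mu1 (S.mu2 x z) y) := by
  have h := congrArg S.prC (hS.jacobi (S.inB x) (S.inC y) (S.inC z))
  rw [hS.prC_br_inB, S.br_inB_inC x y, S.br_inB_inC x z] at h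
  simp only [map_add, LinearMap.add_apply, hS.prC_br_inB, S.prC_inC] at h
  rw [bil_skew S.self (S.inC y) (S.inB _), map_neg, hS.prC_br_inB, S.prC_inC] at h
  refine h.trans ?_
  change _ = S.prC (S.br (S.inC (S.mu1 x y)) (S.inC z)) + S.mu1 (S.mu2 x y) z +
    (S.prC (S.br (S.inC y) (S.inC (S.mu1 x z))) - S.mu1 (S.mu2 x z) y)
  abel

theorem IsLiePair.mu1_corB (hS : S.IsLiePair) (ha : a ∈ Coch k c b i)
    (β : b →ₗ[k] c →ₗ[k] Module.End k c) (hβ : ∀ x y, β x y = S.mu1.flip y ∘ₗ S.mu2 x) :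
    S.mu1 ∘ₗ S.corB a - S.adC ∘ₗ S.corC a =
      conv β a ExteriorAlgebra.ιInv -
        conv (LinearMap.mul k (Module.End k c)) (S.mu1 ∘ₗ a) (S.adC ∘ₗ ExteriorAlgebra.ιInv) +
        sg k i • conv (LinearMap.mul k (Module.End k c)) (S.adC ∘ₗ ExteriorAlgebra.ιInv)
          (S.mu1 ∘ₗ a) := by
  have e := conv_comm' (β := (LinearMap.mul k (Module.End k c)).flip)
    (β' := LinearMap.mul k (Module.End k c)) (fun _ _ => rfl) (comp_mem_coch S.mu1 ha)
    (comp_mem_coch S.adC ιInv_mem_coch)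
  rw [mul_one] at e
  rw [← e, sub_add_eq_add_sub, sub_eq_sub_iff_add_eq_add]
  have e1 : S.mu1 ∘ₗ S.corB a = conv (S.mu2.compr₂ S.mu1) a ExteriorAlgebra.ιInv :=
    conv_congr_apply _ fun _ _ => rfl
  have e2 : S.adC ∘ₗ S.corC a = conv (S.mu1.compr₂ S.adC) a ExteriorAlgebra.ιInv :=
    conv_congr_apply _ fun _ _ => rfl
  have e3 (γ : Module.End k c →ₗ[k] Module.End k c →ₗ[k] Module.End k c) :
      conv γ (S.mu1 ∘ₗ a) (S.adC ∘ₗ ExteriorAlgebra.ιInv) =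
      conv (γ.compl₁₂ S.mu1 S.adC) a ExteriorAlgebra.ιInv :=
    conv_congr fun _ _ => rfl
  rw [e1, e2, e3, e3, ← conv_bil_add, ← conv_bil_add, ← conv_bil_add]
  refine conv_congr fun ξ η => LinearMap.ext fun y => ?_
  have h := hS.mu1_adC (a ξ) y (ExteriorAlgebra.ιInv η)
  generalize a ξ = x at h ⊢
  generalize ExteriorAlgebra.ιInv η = z at h ⊢
  change S.mu1 (S.mu2 x z) y + S.mu1 x (S.adC z y) =
    β x z y + S.adC z (S.mu1 x y) + S.adC (S.mu1 x z) y
  rw [h, hβ]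
  change _ = S.mu1 (S.mu2 x y) z + _ + _
  abel

/-- The computation parallels that for brackets, with the field ∂, whose Jacobian is `adC`, in place
of a'. Since `c` is not a `b`-stable complement, `mu1_corB` leaves the finite-rank operator μ₁(μ₂(x,
-), y), and its trace is the anomaly. -/
theorem IsLiePair.dvg_dA [CharZero k] (hS : S.IsLiePair)
    (hfin : ∀ z, Module.Finite k (LinearMap.range (S.mu1.flip z))) (ha : a ∈ Coch k c b i)
    {τ : b →ₗ[k] c →ₗ[k] k}
    (hτ : ∀ x y, τ x y = -extTrace k c (S.mu1.flip y ∘ₗ S.mu2 x)) :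
    S.dvg (S.dATot i a) = S.dvg a ∘ₗ S.bd - sg k i • conv τ a ExteriorAlgebra.ιInv := by
  let β : b →ₗ[k] c →ₗ[k] Module.End k c :=
    LinearMap.mk₂ k (fun x y => S.mu1.flip y ∘ₗ S.mu2 x)
      (by intros; ext; simp) (by intros; ext; simp) (by intros; ext; simp) (by intros; ext; simp)
  have hβ : extTrace k c ∘ₗ conv β a ExteriorAlgebra.ιInv = -conv τ a ExteriorAlgebra.ιInv := by
    rw [← neg_eq_iff_eq_neg, ← LinearMap.neg_comp]
    exact conv_congr_apply _ fun ξ η => (hτ _ _).symm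
  have h1 := conv_trMul_comm (trOp_mem (S := S) ha) (comp_mem_coch S.adC ιInv_mem_coch)
    (finite_trOp hfin a)
  have hN := hS.mu1_corB ha β fun _ _ => rfl
  have hμ : jac k c c S.muC ∈ Coch k c (c →ₗ[k] c) 1 := jac_mem_coch (by norm_num) S.muC_mem
  have eN : S.mu1 ∘ₗ a = S.trOp a + sg k i • jac k c c (S.corC a) := by
    rw [trOp_eq ha, sub_add_cancel]
  have hd : S.mu1 ∘ₗ S.dATot i a = (S.mu1 ∘ₗ a) ∘ₗ S.bd + sg k i • (S.mu1 ∘ₗ S.corB a) := by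
    rw [LinearMap.comp_assoc, ← LinearMap.comp_smul, ← LinearMap.comp_add]
    rfl
  have hC : (S.adC ∘ₗ ExteriorAlgebra.ιInv) ∘ₗ coder (S.corC a) = S.adC ∘ₗ S.corC a := by
    rw [LinearMap.comp_assoc, ιInv_comp_coder]
  rw [dvg_apply, trOp_eq (dATot_mem rfl ha), hS.corC_dA ha, hd, map_sub, map_smul, bd_eq,
    jac_comp_coder _ S.muC_mem, jac_comp_coder _ (S.corC_mem rfl ha),
    llcomp_flip_conv hμ (jac_corC_mem ha), llcomp_flip_conv (jac_corC_mem ha) hμ, jac_muC,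
    hC, eq_add_of_sub_eq hN, eN, dvg_apply]
  simp only [map_add, map_smul, LinearMap.add_apply, LinearMap.smul_apply, LinearMap.comp_add,
    LinearMap.comp_sub, LinearMap.comp_smul, LinearMap.add_comp, LinearMap.smul_comp,
    LinearMap.neg_comp, LinearMap.comp_neg, LinearMap.comp_assoc, extTrace_comp_conv_mul, sg_add,
    sg_one, sg_two, mul_one, one_mul, hβ] at h1 ⊢
  rcases sg_cases (k := k) i with h | h <;> simp only [h] at h1 ⊢
  · linear_combination (norm := module) -h1
  · linear_combination (norm := module) h1

theorem dvg_hStar_apply (x y : c) : S.dvg S.hStar (ExteriorAlgebra.ι k x *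
    (ExteriorAlgebra.ι k y * 1)) =
      extTrace k c (S.mu1.flip x ∘ₗ S.adH y) - extTrace k c (S.mu1.flip y ∘ₗ S.adH x) := by
  have e : S.trOp S.hStar =
      conv (S.mu1Op.compl₂ S.adH) ExteriorAlgebra.ιInv ExteriorAlgebra.ιInv := by
    rw [trOp, jac_hStar]
    exact conv_congr fun _ _ => rfl
  rw [dvg_apply, LinearMap.comp_apply, e, conv_ιInv_ιInv_apply, map_sub]
  rfl

end SplitBracket

/-! ### A unital CDG Lie algebroid as a quotient -/

section Quotient

variable {k : Type u} [Field k] {X : UnitalCDGData k}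

/-- The morphism `R ⊕ A → A`, `(r, a) ↦ r • unit + a`. -/
def ofAdjoinUnit (hX : IsUnitalCDGLieAlgebroid X) : UnitalHom (adjoinUnit X.toCDGData) X where
  onR n := adjR X.toCDGData
  onA n := scalar X ∘ₗ adjFst X.toCDGData + adjSnd X.toCDGData
  map_one := rfl
  map_mul e r s := rfl
  map_smul e r a := by
    change scalar X (X.mul e (adjR X.toCDGData r) (adjFst X.toCDGData a)) +
      X.smul e (adjR X.toCDGData r) (adjSnd X.toCDGData a) =
      X.smul e (adjR X.toCDGData r) (scalar X (adjFst X.toCDGData a) + adjSnd X.toCDGData a)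
    rw [map_add, hX.smul_scalar]
  map_bracket {i j n} e a b := by
    rw [LinearMap.add_apply, LinearMap.comp_apply, adjFst_bracket, adjSnd_bracket]
    change scalar X (_ - _) + _ = X.bracket e
      (scalar X (adjFst X.toCDGData a) + adjSnd X.toCDGData a)
      (scalar X (adjFst X.toCDGData b) + adjSnd X.toCDGData b)
    generalize adjFst X.toCDGData a = r, adjSnd X.toCDGData a = a,
      adjFst X.toCDGData b = t, adjSnd X.toCDGData b = b
    rw [map_add, map_add, LinearMap.add_apply, LinearMap.add_apply, hX.bracket_scalar,
      hX.bracket_scalar, hX.anchor_scalar, hX.bracket_skew e ((add_comm j i).trans e) (scalar X r),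
      hX.bracket_scalar, negOnePow_smul_eq (k := k), map_sub, map_smul, map_zero]
    abel
  map_anchor e a r := by
    change X.anchor e (adjSnd X.toCDGData a) (adjR X.toCDGData r) =
      X.anchor e (scalar X (adjFst X.toCDGData a) + adjSnd X.toCDGData a) (adjR X.toCDGData r)
    rw [map_add, LinearMap.add_apply, hX.anchor_scalar, zero_add]
  map_dR e r := rfl
  map_dA e a := by
    change scalar X (X.dR e (adjFst X.toCDGData a)) + X.dA e (adjSnd X.toCDGData a) =
      X.dA e (scalar X (adjFst X.toCDGData a) + adjSnd X.toCDGData a)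
    rw [map_add, hX.dA_scalar]
  map_h := by
    rw [LinearMap.add_apply, LinearMap.comp_apply, adjFst_h, map_zero, zero_add, adjSnd_h]
  map_unit := by
    rw [LinearMap.add_apply, LinearMap.comp_apply, adjFst_unit, adjSnd_unit, add_zero]
    exact hX.one_smul _ _

theorem ofAdjoinUnit_inr (hX : IsUnitalCDGLieAlgebroid X) (n : ℤ) (a : X.A n) :
    (ofAdjoinUnit hX).onA n (0, a) = a := by
  refine Eq.trans (congrArg (· + a) (map_zero (scalar X))) (zero_add a)

theorem ofAdjoinUnit_eq_zero_iff (hX : IsUnitalCDGLieAlgebroid X) (n : ℤ)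
    (p : (adjoinUnit X.toCDGData).A n) : (ofAdjoinUnit hX).onA n p = 0 ↔
      ∃ r : X.R n, p = (adjoinUnit X.toCDGData).smul (add_zero n) r (-X.one, X.unit) := by
  change scalar X (adjFst X.toCDGData p) + adjSnd X.toCDGData p = 0 ↔ _
  constructor
  · intro h
    -- If r · 1 + a = 0 then (r, a) is -r times (-1, unit).
    refine ⟨-adjFst X.toCDGData p, adj_ext ?_ ?_⟩
    · change adjFst X.toCDGData p = X.mul (add_zero n) (-adjFst X.toCDGData p) (-X.one)
      rw [map_neg, map_neg, LinearMap.neg_apply, neg_neg, hX.mul_one]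
    · change adjSnd X.toCDGData p = scalar X (-adjFst X.toCDGData p)
      rw [eq_neg_of_add_eq_zero_right h, ← map_neg]
  · rintro ⟨r, rfl⟩
    change scalar X (X.mul (add_zero n) r (-X.one)) + scalar X r = 0
    rw [map_neg, hX.mul_one, map_neg, neg_add_cancel]

end Quotient

/-! ### Central elements of `b` as units -/

namespace SplitBracket

variable {k : Type u} [Field k] {G b c : Type*} [AddCommGroup G] [Module k G]
    [AddCommGroup b] [Module k b] [AddCommGroup c] [Module k c] {S : SplitBracket k G b c}

local notation "Λ" => ExteriorAlgebra k c

variable (S) in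
/-- The CDG Lie algebroid of a pair, with a constant cochain as the unit. -/
def unital (x : b) : UnitalCDGData k where
  toCDGData := S.cdg
  unit := constA x

variable (S) in
theorem valA_unit (x : b) : S.valA (S.unital x).unit = constCoch x := constA_coe x

theorem constCoch_comp_coder {V : Type*} [AddCommGroup V] [Module k V] (x : V) (u : Λ →ₗ[k] c) :
    constCoch x ∘ₗ coder u = 0 := by
  rw [constCoch, LinearMap.comp_assoc, counit_comp_coder, LinearMap.comp_zero]

theorem corC_constCoch {x : b} (hx : S.br (S.inB x) = 0) : S.corC (constCoch x) = 0 := by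
  have h : S.mu1 x = 0 := LinearMap.ext fun y => by
    change S.prC (S.br (S.inB x) (S.inC y)) = 0
    rw [hx, LinearMap.zero_apply, map_zero]
  rw [corC, conv_constCoch, h, LinearMap.zero_comp]

theorem corB_constCoch {x : b} (hx : S.br (S.inB x) = 0) : S.corB (constCoch x) = 0 := by
  have h : S.mu2 x = 0 := LinearMap.ext fun y => by
    change S.prB (S.br (S.inB x) (S.inC y)) = 0
    rw [hx, LinearMap.zero_apply, map_zero]
  rw [corB, conv_constCoch, h, LinearMap.zero_comp]

/-- For `x` central in `G` the maps `muB x`, `mu1 x` and `mu2 x` vanish, and coderivations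
annihilate constant cochains. -/
theorem IsLiePair.isUnital [CharZero k] (hS : S.IsLiePair) {x : b} (hx : S.br (S.inB x) = 0) :
    IsUnitalCDGLieAlgebroid (S.unital x) where
  toIsCDGLieAlgebroid := hS.isCDGLieAlgebroid
  unit_bracket {i n} e a := by
    apply valA_injective
    have h : S.muB x = 0 := LinearMap.ext fun y => by
      change S.prB (S.br (S.inB x) (S.inB y)) = 0
      rw [hx, LinearMap.zero_apply, map_zero]
    refine (valA_bracket e _ a).trans ?_
    rw [valA_unit, bracketTot_apply, conv_constCoch, h, corC_constCoch hx, map_zero,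
      constCoch_comp_coder, LinearMap.zero_comp, LinearMap.comp_zero, smul_zero, sub_zero, add_zero]
    exact (map_zero S.valA).symm
  unit_anchor e r := by
    apply valR_injective
    refine (valR_anchor e _ r).trans ?_
    rw [valA_unit, corC_constCoch hx, map_zero, LinearMap.comp_zero, neg_zero]
    exact (map_zero S.valR).symm
  dA_unit e := by
    apply valA_injective
    refine (valA_dA e _).trans ?_
    rw [valA_unit, dATot, bd_eq, constCoch_comp_coder, corB_constCoch hx, smul_zero, add_zero]
    exact (map_zero S.valA).symm

theorem IsLiePair.isUnitalRightCDGModule [CharZero k] (hS : S.IsLiePair) {M : Type*}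
    [AddCommGroup M] [Module k M] {ρ : G →ₗ[k] Module.End k M}
    (hρ : ∀ x y, ρ (S.br x y) = ρ x * ρ y - ρ y * ρ x) {x : b} (hx : S.br (S.inB x) = 0)
    (hρx : ρ (S.inB x) = -1) : IsUnitalRightCDGModule (P := S.unital x) (S.rightModule ρ) where
  toIsRightCDGModule := hS.isRightCDGModule hρ
  act_unit e y := by
    apply valN_injective
    have h : S.mu1 x = 0 := LinearMap.ext fun y => by
      change S.prC (S.br (S.inB x) (S.inC y)) = 0
      rw [hx, LinearMap.zero_apply, map_zero]
    refine (valN_actA e y _).trans ?_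
    rw [valA_unit, actOp_constCoch ρ x h hρx, LinearMap.neg_apply, neg_neg, LinearMap.id_apply]

/-! ### The isomorphism with the opposite -/

/-- `S'` is the central extension of `S`, split over `b`, by a cocycle that is minus the trace of
`z ↦ μ₁(μ₂(x, z), y)` on `b ⊗ c` and minus the divergence of the curvature on `c ∧ c`. -/
structure IsCriticalExt {G' : Type*} [AddCommGroup G'] [Module k G']
    (S' : SplitBracket k G' (b × k) c) (S : SplitBracket k G b c) : Prop where
  finite : ∀ z, Module.Finite k (LinearMap.range (S.mu1.flip z))
  muB : ∀ p q, S'.muB p q = (S.muB p.1 q.1, 0)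
  mu1 : ∀ p z, S'.mu1 p z = S.mu1 p.1 z
  mu2 : ∀ p z, S'.mu2 p z = (S.mu2 p.1 z, -extTrace k c (S.mu1.flip z ∘ₗ S.mu2 p.1))
  prC : ∀ y z, S'.prC (S'.br (S'.inC y) (S'.inC z)) = S.prC (S.br (S.inC y) (S.inC z))
  prB : ∀ y z, S'.prB (S'.br (S'.inC y) (S'.inC z)) = (S.prB (S.br (S.inC y) (S.inC z)),
    extTrace k c (S.mu1.flip z ∘ₗ S.adH y) - extTrace k c (S.mu1.flip y ∘ₗ S.adH z))

namespace IsCriticalExt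

variable {G' : Type*} [AddCommGroup G'] [Module k G'] {S' : SplitBracket k G' (b × k) c}
  (h : IsCriticalExt S' S) {i j n : ℤ} {a a' : ExteriorAlgebra k c →ₗ[k] b × k}

local notation "p₁" => LinearMap.fst k b k
local notation "p₂" => LinearMap.snd k b k

include h

theorem corC_eq (a : Λ →ₗ[k] b × k) : S'.corC a = S.corC (p₁ ∘ₗ a) :=
  conv_congr fun _ _ => h.mu1 _ _

theorem muC_eq : S'.muC = S.muC := by
  refine coch_two_ext S'.muC_mem S.muC_mem fun x y => ?_
  rw [muC, muC, liftAlternating_two_apply, liftAlternating_two_apply]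
  exact h.prC x y

theorem bd_eq' : S'.bd = S.bd := by
  rw [bd_eq, bd_eq, h.muC_eq]

theorem fst_hStar : p₁ ∘ₗ S'.hStar = S.hStar := by
  refine coch_two_ext (comp_mem_coch _ S'.hStar_mem) S.hStar_mem fun x y => ?_
  rw [LinearMap.comp_apply, hStar, hStar, liftAlternating_two_apply, liftAlternating_two_apply]
  exact congrArg Prod.fst (h.prB x y)

/-- On `c ∧ c` the cocycle is the negative of the divergence of h, so Φ carries the curvature to an
element with zero component in `R`. -/
theorem snd_hStar : p₂ ∘ₗ S'.hStar = -S.dvg S.hStar := by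
  refine coch_two_ext (comp_mem_coch _ S'.hStar_mem) (neg_mem (dvg_mem S.hStar_mem)) fun x y => ?_
  rw [LinearMap.neg_apply, dvg_hStar_apply, LinearMap.comp_apply, hStar, liftAlternating_two_apply,
    neg_sub]
  exact congrArg Prod.snd (h.prB x y)

theorem fst_bracketTot : p₁ ∘ₗ S'.bracketTot i j a a' = S.bracketTot i j (p₁ ∘ₗ a) (p₁ ∘ₗ a') := by
  rw [bracketTot_apply, bracketTot_apply, h.corC_eq, h.corC_eq, LinearMap.comp_add,
    LinearMap.comp_sub, LinearMap.comp_smul, LinearMap.comp_assoc, LinearMap.comp_assoc,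
    conv_congr_apply (β' := S.muB) (f' := p₁ ∘ₗ a) (g' := p₁ ∘ₗ a') p₁ fun _ _ =>
      congrArg Prod.fst (h.muB _ _)]

theorem snd_bracketTot : p₂ ∘ₗ S'.bracketTot i j a a' =
    -(p₂ ∘ₗ a' ∘ₗ coder (S.corC (p₁ ∘ₗ a))) +
      sg k (i * j) • (p₂ ∘ₗ a ∘ₗ coder (S.corC (p₁ ∘ₗ a'))) := by
  rw [bracketTot_apply, h.corC_eq, h.corC_eq, LinearMap.comp_add, LinearMap.comp_sub,
    LinearMap.comp_smul, conv_congr_apply (β' := (0 : b × k →ₗ[k] b × k →ₗ[k] k)) (f' := a)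
    (g' := a') p₂ fun _ _ => congrArg Prod.snd (h.muB _ _), conv_bil_zero, zero_sub]

theorem fst_dATot : p₁ ∘ₗ S'.dATot i a = S.dATot i (p₁ ∘ₗ a) := by
  rw [dATot, dATot, h.bd_eq', LinearMap.comp_add, LinearMap.comp_smul, LinearMap.comp_assoc]
  congr 2
  exact conv_congr_apply _ fun _ _ => congrArg Prod.fst (h.mu2 _ _)

/-- The `K`-component of μ₂ cancels the anomaly of `dvg_dA`, so that t + `dvg a` is differentiated
by `d_R` alone. -/
theorem snd_add_dvg_dATot [CharZero k] (hS : S.IsLiePair) (ha : a ∈ Coch k c (b × k) i) :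
    p₂ ∘ₗ S'.dATot i a + S.dvg (p₁ ∘ₗ S'.dATot i a) =
      (p₂ ∘ₗ a + S.dvg (p₁ ∘ₗ a)) ∘ₗ S.bd := by
  let τ : b →ₗ[k] c →ₗ[k] k :=
    LinearMap.mk₂ k (fun x y => -extTrace k c (S.mu1.flip y ∘ₗ S.mu2 x))
      (by intros; simp [LinearMap.comp_add]; abel) (by intros; simp [LinearMap.comp_smul])
      (by intros; simp [LinearMap.add_comp]; abel) (by intros; simp [LinearMap.smul_comp])
  have e : p₂ ∘ₗ S'.corB a = conv τ (p₁ ∘ₗ a) ExteriorAlgebra.ιInv :=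
    conv_congr_apply _ fun _ _ => congrArg Prod.snd (h.mu2 _ _)
  rw [h.fst_dATot, hS.dvg_dA h.finite (comp_mem_coch _ ha) (τ := τ) fun _ _ => rfl, dATot, h.bd_eq',
    LinearMap.comp_add, LinearMap.comp_smul, e, LinearMap.add_comp, LinearMap.comp_assoc]
  abel

omit h in
theorem fst_conv_lsmul (r : Λ →ₗ[k] k) (a : Λ →ₗ[k] b × k) :
    p₁ ∘ₗ conv (LinearMap.lsmul k (b × k)) r a = conv (LinearMap.lsmul k b) r (p₁ ∘ₗ a) :=
  conv_congr_apply _ fun _ _ => rfl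

omit h in
theorem snd_conv_lsmul (r : Λ →ₗ[k] k) (a : Λ →ₗ[k] b × k) :
    p₂ ∘ₗ conv (LinearMap.lsmul k (b × k)) r a = conv (LinearMap.mul k k) r (p₂ ∘ₗ a) :=
  conv_congr_apply _ fun _ _ => rfl

end IsCriticalExt

section Iso

variable {G' : Type*} [AddCommGroup G'] [Module k G'] (S' : SplitBracket k G' (b × k) c)
  (S : SplitBracket k G b c) {i j n : ℤ}

/-- The component in `R` of the isomorphism `A^♯ → A^opp`. -/
def sharpToR (n : ℤ) : S'.cdg.A n →ₗ[k] S.cdg.R n where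
  toFun a := (⟨LinearMap.snd k b k ∘ₗ S'.valA a + S.dvg (LinearMap.fst k b k ∘ₗ S'.valA a),
    add_mem (comp_mem_coch _ (valA_mem a)) (dvg_mem (comp_mem_coch _ (valA_mem a)))⟩ :
      Coch k c k n)
  map_add' a a' := S.valR_injective <| by
    change LinearMap.snd k b k ∘ₗ S'.valA (a + a') + S.dvg (LinearMap.fst k b k ∘ₗ S'.valA (a + a'))
      = (LinearMap.snd k b k ∘ₗ S'.valA a + S.dvg (LinearMap.fst k b k ∘ₗ S'.valA a)) +
        (LinearMap.snd k b k ∘ₗ S'.valA a' + S.dvg (LinearMap.fst k b k ∘ₗ S'.valA a'))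
    rw [map_add, LinearMap.comp_add, LinearMap.comp_add, map_add]
    abel
  map_smul' t a := S.valR_injective <| by
    change LinearMap.snd k b k ∘ₗ S'.valA (t • a) + S.dvg (LinearMap.fst k b k ∘ₗ S'.valA (t • a))
      = t • (LinearMap.snd k b k ∘ₗ S'.valA a + S.dvg (LinearMap.fst k b k ∘ₗ S'.valA a))
    rw [map_smul, LinearMap.comp_smul, LinearMap.comp_smul, map_smul, smul_add]

/-- The component in `A` of the isomorphism `A^♯ → A^opp`. -/
def sharpToA (n : ℤ) : S'.cdg.A n →ₗ[k] S.cdg.A n where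
  toFun a := (⟨-(LinearMap.fst k b k ∘ₗ S'.valA a), neg_mem (comp_mem_coch _ (valA_mem a))⟩ :
    Coch k c b n)
  map_add' a a' := S.valA_injective <| by
    change -(LinearMap.fst k b k ∘ₗ S'.valA (a + a')) =
      -(LinearMap.fst k b k ∘ₗ S'.valA a) + -(LinearMap.fst k b k ∘ₗ S'.valA a')
    rw [map_add, LinearMap.comp_add, neg_add]
  map_smul' t a := S.valA_injective <| by
    change -(LinearMap.fst k b k ∘ₗ S'.valA (t • a)) = t • -(LinearMap.fst k b k ∘ₗ S'.valA a)
    rw [map_smul, LinearMap.comp_smul, smul_neg]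

/-- The isomorphism `A^♯ → A^opp` on underlying spaces. -/
def sharpToOpp (n : ℤ) : S'.cdg.A n →ₗ[k] (opp (adjoinUnit S.cdg)).A n :=
  (sharpToR S' S n).prod (sharpToA S' S n)

/-- The identification of the bases. -/
def baseToOpp (n : ℤ) : S'.cdg.R n →ₗ[k] (opp (adjoinUnit S.cdg)).R n := LinearMap.id

variable {S' S}

theorem valR_sharpToR (a : S'.cdg.A n) : S.valR (sharpToR S' S n a) =
    LinearMap.snd k b k ∘ₗ S'.valA a + S.dvg (LinearMap.fst k b k ∘ₗ S'.valA a) := rfl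

theorem valA_sharpToA (a : S'.cdg.A n) : S.valA (sharpToA S' S n a) =
    -(LinearMap.fst k b k ∘ₗ S'.valA a) := rfl

theorem fst_sharpToOpp (a : S'.cdg.A n) :
    adjFst S.cdg (oppA (adjoinUnit S.cdg) (sharpToOpp S' S n a)) = sharpToR S' S n a := rfl

theorem snd_sharpToOpp (a : S'.cdg.A n) :
    adjSnd S.cdg (oppA (adjoinUnit S.cdg) (sharpToOpp S' S n a)) = sharpToA S' S n a := rfl

theorem valR_baseToOpp (r : S'.cdg.R n) :
    S.valR (adjR S.cdg (oppR (adjoinUnit S.cdg) (baseToOpp S' S n r))) = S'.valR r := rfl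

theorem baseToOpp_ext {r r' : (opp (adjoinUnit S.cdg)).R n}
    (h : S.valR (adjR S.cdg (oppR (adjoinUnit S.cdg) r)) =
      S.valR (adjR S.cdg (oppR (adjoinUnit S.cdg) r'))) : r = r' := valR_injective h

theorem toOpp_ext {a a' : (opp (adjoinUnit S.cdg)).A n}
    (h : S.valR (adjFst S.cdg (oppA (adjoinUnit S.cdg) a)) =
      S.valR (adjFst S.cdg (oppA (adjoinUnit S.cdg) a')))
    (h' : S.valA (adjSnd S.cdg (oppA (adjoinUnit S.cdg) a)) =
      S.valA (adjSnd S.cdg (oppA (adjoinUnit S.cdg) a'))) : a = a' :=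
  oppA_injective (adj_ext (valR_injective h) (valA_injective h'))

theorem corC_neg (a : Λ →ₗ[k] b) : S.corC (-a) = -S.corC a := by
  rw [corC, map_neg, LinearMap.neg_apply, corC]

theorem fst_scalar_adjoinUnit [CharZero k] (hS : S.IsLiePair) (t : (adjoinUnit S.cdg).R n) :
    adjFst S.cdg (scalar (adjoinUnit S.cdg) t) = adjR S.cdg t :=
  hS.isCDGLieAlgebroid.mul_one (add_zero n) t

theorem snd_scalar_adjoinUnit (t : (adjoinUnit S.cdg).R n) :
    adjSnd S.cdg (scalar (adjoinUnit S.cdg) t) = 0 :=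
  map_zero (S.cdg.smul (add_zero n) (adjR S.cdg t))

namespace IsCriticalExt

variable [CharZero k] (h : IsCriticalExt S' S) (hS : S.IsLiePair)

-- The second term of `dvg_smul` is precisely the twist in the module structure of the opposite, the
-- component of Φ in `A` being -a.
include hS in
theorem sharpToOpp_smul (e : i + j = n) (r : S'.cdg.R i) (a : S'.cdg.A j) :
    sharpToOpp S' S n (S'.cdg.smul e r a) =
      (opp (adjoinUnit S.cdg)).smul e (baseToOpp S' S i r) (sharpToOpp S' S j a) := by
  apply toOpp_ext
  · rw [fst_sharpToOpp, valR_sharpToR, valA_smul, fst_conv_lsmul, snd_conv_lsmul,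
      dvg_smul (valR_mem r) (comp_mem_coch _ (valA_mem a)), oppA_smul, map_add, map_smul,
      fst_scalar_adjoinUnit hS, adjR_anchor, adjFst_smul, map_add, map_smul, valR_mul, valR_anchor,
      valR_baseToOpp, snd_sharpToOpp, fst_sharpToOpp, valR_sharpToR, valA_sharpToA, corC_neg,
      map_neg, LinearMap.comp_neg, neg_neg, map_add]
    abel
  · rw [snd_sharpToOpp, valA_sharpToA, valA_smul, fst_conv_lsmul, oppA_smul, map_add, map_smul,
      snd_scalar_adjoinUnit, smul_zero, add_zero, adjSnd_smul, valA_smul, valR_baseToOpp,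
      snd_sharpToOpp, valA_sharpToA, map_neg]

include h hS

omit [CharZero k] in
theorem sharpToOpp_bracket (e : i + j = n) (a : S'.cdg.A i) (a' : S'.cdg.A j) :
    sharpToOpp S' S n (S'.cdg.bracket e a a') =
      (opp (adjoinUnit S.cdg)).bracket e (sharpToOpp S' S i a) (sharpToOpp S' S j a') := by
  apply toOpp_ext
  · rw [fst_sharpToOpp, valR_sharpToR, valA_bracket, h.snd_bracketTot, h.fst_bracketTot,
      hS.dvg_bracket h.finite (comp_mem_coch _ (valA_mem a)) (comp_mem_coch _ (valA_mem a')),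
      oppA_bracket, map_neg, map_neg, adjFst_bracket, map_sub, map_smul, valR_anchor, valR_anchor,
      fst_sharpToOpp, fst_sharpToOpp, snd_sharpToOpp, snd_sharpToOpp, valR_sharpToR,
      valR_sharpToR, valA_sharpToA, valA_sharpToA, corC_neg, corC_neg]
    simp only [map_neg, LinearMap.comp_neg, LinearMap.add_comp, LinearMap.neg_comp, smul_add,
      smul_neg, neg_neg, LinearMap.comp_assoc]
    abel
  · rw [snd_sharpToOpp, valA_sharpToA, valA_bracket, h.fst_bracketTot, oppA_bracket, map_neg,
      map_neg, adjSnd_bracket, valA_bracket, snd_sharpToOpp, snd_sharpToOpp, valA_sharpToA,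
      valA_sharpToA, map_neg, map_neg, LinearMap.neg_apply, neg_neg]

omit [CharZero k] hS in
theorem baseToOpp_anchor (e : i + j = n) (a : S'.cdg.A i) (r : S'.cdg.R j) :
    baseToOpp S' S n (S'.cdg.anchor e a r) =
      (opp (adjoinUnit S.cdg)).anchor e (sharpToOpp S' S i a) (baseToOpp S' S j r) := by
  apply baseToOpp_ext
  rw [valR_baseToOpp, valR_anchor, oppR_anchor, map_neg, map_neg, adjR_anchor, valR_anchor,
    valR_baseToOpp, snd_sharpToOpp, valA_sharpToA, h.corC_eq, corC_neg, map_neg,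
    LinearMap.comp_neg, neg_neg]

omit [CharZero k] hS in
theorem baseToOpp_dR (e : i + 1 = n) (r : S'.cdg.R i) : baseToOpp S' S n (S'.cdg.dR e r) =
    (opp (adjoinUnit S.cdg)).dR e (baseToOpp S' S i r) := by
  apply baseToOpp_ext
  rw [valR_baseToOpp, valR_dR, oppR_dR, adjR_dR, valR_dR, valR_baseToOpp, h.bd_eq']

theorem sharpToOpp_dA (e : i + 1 = n) (a : S'.cdg.A i) : sharpToOpp S' S n (S'.cdg.dA e a) =
    (opp (adjoinUnit S.cdg)).dA e (sharpToOpp S' S i a) := by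
  apply toOpp_ext
  · rw [fst_sharpToOpp, valR_sharpToR, valA_dA, h.snd_add_dvg_dATot hS (valA_mem a), oppA_dA,
      adjFst_dA, valR_dR, fst_sharpToOpp, valR_sharpToR]
  · rw [snd_sharpToOpp, valA_sharpToA, valA_dA, h.fst_dATot, oppA_dA, adjSnd_dA, valA_dA,
      snd_sharpToOpp, valA_sharpToA, dATot, dATot, corB, corB, map_neg, LinearMap.neg_apply,
      LinearMap.neg_comp, smul_neg, neg_add]

omit [CharZero k] hS in
theorem sharpToOpp_h : sharpToOpp S' S 2 S'.cdg.h = (opp (adjoinUnit S.cdg)).h := by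
  apply toOpp_ext
  · rw [fst_sharpToOpp, valR_sharpToR, valA_h, h.fst_hStar, h.snd_hStar, neg_add_cancel, oppA_h,
      map_neg, adjFst_h, neg_zero, map_zero]
  · rw [snd_sharpToOpp, valA_sharpToA, valA_h, h.fst_hStar, oppA_h, map_neg, adjSnd_h, map_neg,
      valA_h]

omit [CharZero k] hS h in
theorem sharpToOpp_unit {x : S'.cdg.A 0} (hx : S'.valA x = constCoch ((0, 1) : b × k)) :
    sharpToOpp S' S 0 x = (opp (adjoinUnit S.cdg)).unit := by
  have e1 : LinearMap.fst k b k ∘ₗ constCoch ((0, 1) : b × k) = (0 : Λ →ₗ[k] b) := by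
    ext; simp [constCoch]
  have e2 : LinearMap.snd k b k ∘ₗ constCoch ((0, 1) : b × k) =
      (ExteriorAlgebra.algebraMapInv.toLinearMap : Λ →ₗ[k] k) :=
    LinearMap.ext fun ξ => mul_one _
  apply toOpp_ext
  · rw [fst_sharpToOpp, valR_sharpToR, hx, e1, e2, map_zero, add_zero, oppA_unit,
      adjFst_unit, valR_one]
  · rw [snd_sharpToOpp, valA_sharpToA, hx, e1, neg_zero, oppA_unit, adjSnd_unit, map_zero]

/-- The isomorphism of the central extension with the opposite. -/
def hom : UnitalHom (S'.unital ((0, 1) : b × k)) (opp (adjoinUnit S.cdg)) where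
  onR := baseToOpp S' S
  onA := sharpToOpp S' S
  map_one := rfl
  map_mul _ _ _ := rfl
  map_smul e r a := sharpToOpp_smul hS e r a
  map_bracket e a a' := h.sharpToOpp_bracket hS e a a'
  map_anchor e a r := h.baseToOpp_anchor e a r
  map_dR e r := h.baseToOpp_dR e r
  map_dA e a := h.sharpToOpp_dA hS e a
  map_h := h.sharpToOpp_h
  map_unit := sharpToOpp_unit (S'.valA_unit (0, 1))

end IsCriticalExt

theorem sharpToOpp_bijective (n : ℤ) : Function.Bijective (sharpToOpp S' S n) := by
  constructor
  · refine (injective_iff_map_eq_zero _).2 fun a ha => S'.valA_injective ?_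
    have h2 : -(LinearMap.fst k b k ∘ₗ S'.valA a) = 0 := by
      rw [← valA_sharpToA (S := S), ← snd_sharpToOpp, ha]; rfl
    have h1 : LinearMap.snd k b k ∘ₗ S'.valA a = 0 := by
      have := valR_sharpToR (S := S) a
      rw [neg_eq_zero.1 h2, map_zero, add_zero, ← fst_sharpToOpp, ha] at this
      exact this.symm
    rw [map_zero]
    exact LinearMap.ext fun ξ => Prod.ext (LinearMap.congr_fun (neg_eq_zero.1 h2) ξ)
      (LinearMap.congr_fun h1 ξ)
  · intro p
    let t : S.cdg.R n := p.1
    let α : S.cdg.A n := p.2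
    -- Φ is triangular, (a, t) ↦ (t + dvg a, -a), and this is the solution for a given (t, α).
    let f : Λ →ₗ[k] b × k := (-S.valA α).prod (S.valR t + S.dvg (S.valA α))
    have hf : f ∈ Coch k c (b × k) n := by
      have : f = LinearMap.inl k b k ∘ₗ (-S.valA α) +
          LinearMap.inr k b k ∘ₗ (S.valR t + S.dvg (S.valA α)) :=
        LinearMap.ext fun ξ => Prod.ext (add_zero _).symm (zero_add _).symm
      rw [this]
      exact add_mem (comp_mem_coch _ (neg_mem (valA_mem α)))
        (comp_mem_coch _ (add_mem (valR_mem t) (dvg_mem (valA_mem α))))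
    obtain ⟨a, ha⟩ : ∃ a : S'.cdg.A n, S'.valA a = f := ⟨(⟨f, hf⟩ : Coch k c (b × k) n), rfl⟩
    refine ⟨a, toOpp_ext ?_ ?_⟩
    · rw [fst_sharpToOpp, valR_sharpToR, ha]
      change (S.valR t + S.dvg (S.valA α)) + S.dvg (-S.valA α) = S.valR t
      rw [map_neg, add_neg_cancel_right]
    · rw [snd_sharpToOpp, valA_sharpToA, ha]
      exact neg_neg (S.valA α)

end Iso

end SplitBracket

/-! ### The critical extension -/

section Critical

variable {k : Type u} [Field k] {g : Type v} [AddCommGroup g] [Module k g]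
  [TopologicalSpace g] {br : g →ₗ[k] g →ₗ[k] g} (hg : IsTateLieAlgebra br)
  {B : Submodule k g} (hB : IsCLattice B) {s : (g ⧸ B) →ₗ[k] g} {hs : ∀ x, B.mkQ (s x) = x}

theorem splitG_inB (x : B) : (splitG hg s hs).inB x = x := by
  change (x : g) + s 0 = x
  rw [map_zero, add_zero]

theorem splitG_inC (z : g ⧸ B) : (splitG hg s hs).inC z = s z :=
  zero_add (s z)

theorem splitG_mu1 (x : B) (z : g ⧸ B) : (splitG hg s hs).mu1 x z = B.mkQ (br x (s z)) := by
  change B.mkQ (br ((splitG hg s hs).inB x) ((splitG hg s hs).inC z)) = _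
  rw [splitG_inB, splitG_inC]

theorem splitG_mu2 (x : B) : (splitG hg s hs).mu2 x = adCB br B s hs x := by
  refine LinearMap.ext fun z => ?_
  change compB B s hs (br ((splitG hg s hs).inB x) ((splitG hg s hs).inC z)) = _
  rw [splitG_inB, splitG_inC, adCB_apply]

/-- Skew-symmetry identifies the operators in the divergence with the blocks in ω₀; finiteness of
rank comes with the identification. -/
theorem splitG_mu1_flip (z : g ⧸ B) : (splitG hg s hs).mu1.flip z = -adBC br B (s z) := by
  refine LinearMap.ext fun x => ?_
  rw [LinearMap.flip_apply, splitG_mu1, LinearMap.neg_apply, adBC_apply, ← map_neg,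
    LinearMap.IsAlt.neg hg.self]

theorem splitG_adH (z : g ⧸ B) : (splitG hg s hs).adH z = -adCB br B s hs (s z) := by
  refine LinearMap.ext fun w => ?_
  change compB B s hs (br ((splitG hg s hs).inC w) ((splitG hg s hs).inC z)) = _
  rw [splitG_inC, splitG_inC, LinearMap.neg_apply, adCB_apply, ← map_neg,
    LinearMap.IsAlt.neg hg.self]

theorem splitGSharp_inB (p : B × k) :
    (splitGSharp hg hB s hs).inB p = (((p.1 : g), p.2) : g × k) := by
  change (((p.1 : g) + s 0, p.2) : g × k) = _
  rw [map_zero, add_zero]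

theorem splitGSharp_inC (z : g ⧸ B) :
    (splitGSharp hg hB s hs).inC z = ((s z, 0) : g × k) :=
  Prod.ext (zero_add (s z)) rfl

theorem splitGSharp_br (p q : g × k) :
    (splitGSharp hg hB s hs).br p q = ((br p.1 q.1, criticalCocycle s hs hg hB p.1 q.1) : g × k) :=
  rfl

theorem splitGSharp_prB (p : g × k) :
    (splitGSharp hg hB s hs).prB p = (compB B s hs p.1, p.2) := rfl

theorem splitGSharp_prC (p : g × k) : (splitGSharp hg hB s hs).prC p = B.mkQ p.1 := rfl

theorem splitGSharp_inB_centralK : (splitGSharp hg hB s hs).inB ((0, 1) : B × k) = centralK k g :=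
  splitGSharp_inB hg hB _

theorem br_centralK : (splitGSharp hg hB s hs).br (centralK k g) = 0 := by
  refine LinearMap.ext fun q => ?_
  refine (splitGSharp_br hg hB (0, 1) q).trans ?_
  rw [map_zero, map_zero]
  rfl

/-- For `x ∈ b` the block `adBC x` is zero, so on `b × c` one of the two traces in ω₀ survives, and
on `b × b` none; on `c × c` both do, the signs from skew-symmetry cancelling in pairs. -/
theorem splitGSharp_isCriticalExt (hBs : ∀ x ∈ B, ∀ y ∈ B, br x y ∈ B) :
    (splitGSharp hg hB s hs).IsCriticalExt (splitG hg s hs) where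
  finite z := by
    rw [splitG_mu1_flip, LinearMap.range_neg]
    exact adBC_finite hg hB _
  muB p q := by
    change (splitGSharp hg hB s hs).prB ((splitGSharp hg hB s hs).br
      ((splitGSharp hg hB s hs).inB p) ((splitGSharp hg hB s hs).inB q)) =
      (compB B s hs (br ((splitG hg s hs).inB p.1) ((splitG hg s hs).inB q.1)), 0)
    rw [splitGSharp_inB, splitGSharp_inB, splitG_inB, splitG_inB, splitGSharp_br, splitGSharp_prB,
      criticalCocycle_eq_zero hg hB hBs p.1.2 q.1.2]
  mu1 p z := by
    change (splitGSharp hg hB s hs).prC ((splitGSharp hg hB s hs).br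
      ((splitGSharp hg hB s hs).inB p) ((splitGSharp hg hB s hs).inC z)) = _
    rw [splitGSharp_inB, splitGSharp_inC, splitGSharp_br, splitGSharp_prC, splitG_mu1]
  mu2 p z := by
    have h : adBC br B p.1 = 0 := by
      ext z
      simpa [adBC_apply] using hBs p.1 p.1.2 z z.2
    change (splitGSharp hg hB s hs).prB ((splitGSharp hg hB s hs).br
      ((splitGSharp hg hB s hs).inB p) ((splitGSharp hg hB s hs).inC z)) = _
    rw [splitGSharp_inB, splitGSharp_inC, splitGSharp_br, splitGSharp_prB, splitG_mu2, adCB_apply,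
      splitG_mu1_flip, criticalCocycle_apply, h, LinearMap.zero_comp, map_zero, sub_zero,
      LinearMap.neg_comp, map_neg, neg_neg]
  prC y z := by
    rw [splitGSharp_inC, splitGSharp_inC, splitGSharp_br, splitGSharp_prC, splitG_inC, splitG_inC]
    rfl
  prB y z := by
    rw [splitGSharp_inC, splitGSharp_inC, splitGSharp_br, splitGSharp_prB, splitG_inC, splitG_inC,
      splitG_mu1_flip, splitG_mu1_flip, splitG_adH, splitG_adH, criticalCocycle_apply,
      LinearMap.neg_comp, LinearMap.neg_comp, LinearMap.comp_neg, LinearMap.comp_neg, neg_neg,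
      neg_neg]
    rfl

end Critical

end Semiinf

end

/-! ### The proposition -/

theorem mainTheorem2 {k : Type u} [Field k] [CharZero k]
    {g : Type v} [LieRing g] [LieAlgebra k g] [TopologicalSpace g]
    (hg : IsTateLieAlgebra (lieBr k g))
    (b : LieSubalgebra k g) (hb : IsCLattice b.toSubmodule)
    (s : (g ⧸ b.toSubmodule) →ₗ[k] g) (hs : ∀ x, b.toSubmodule.mkQ (s x) = x) :
    -- `g^♯` is a Tate Lie algebra and `b ⊕ k K` is a subalgebra of it that is a c-lattice
    IsTateLieAlgebra (sharpBr hg hb s hs) ∧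
    IsCLattice (sharpSub k b.toSubmodule) ∧
    (∀ x ∈ sharpSub k b.toSubmodule, ∀ y ∈ sharpSub k b.toSubmodule,
      sharpBr hg hb s hs x y ∈ sharpSub k b.toSubmodule) ∧
    -- the main construction gives CDG Lie algebroids for both pairs
    IsCDGLieAlgebroid (algebroid hg s hs) ∧
    IsUnitalCDGLieAlgebroid (algebroidSharp hg hb s hs) ∧
    IsUnitalCDGLieAlgebroid (opp (adjoinUnit (algebroid hg s hs))) ∧
    -- `A^♯` is the quotient of `R ⊕ Ã^♯` by the `R`-submodule generated by `K - 1`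
    (∃ Q : UnitalHom (adjoinUnit (algebroidTilde hg hb s hs)) (algebroidSharp hg hb s hs),
      (∀ n r, Q.onR n r = r) ∧ (∀ n a, Q.onA n (0, a) = a) ∧
      ∀ n p, Q.onA n p = 0 ↔ ∃ r : (algebroidTilde hg hb s hs).R n,
        p = (adjoinUnit (algebroidTilde hg hb s hs)).smul (add_zero n) r
          (-(algebroidTilde hg hb s hs).one, (algebroidSharp hg hb s hs).unit)) ∧
    -- `A^♯` is isomorphic to the opposite of `A`
    ∃ (Φ : UnitalHom (algebroidSharp hg hb s hs) (opp (adjoinUnit (algebroid hg s hs))))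
      (hΦ : Φ.IsIso),
      (∀ n r, Φ.onR n r = r) ∧
      (∀ (n : ℤ) (a : Coch k (g ⧸ b.toSubmodule) (b.toSubmodule × k) n),
        (Φ.onA n a).2.1 = -(LinearMap.fst k b.toSubmodule k ∘ₗ a.1)) ∧
      -- right CDG-modules over `A^♯` become left CDG-modules over `A`
      (∀ N : RightModuleData.{u, w, max u v, max u v} (algebroidSharp hg hb s hs).toCDGData,
        IsUnitalRightCDGModule N → IsLeftCDGModule (leftOfRight Φ hΦ N)) ∧
      -- in particular `M^♯ ⊗ Λ(c)` does
      ∀ (M : Type w) [AddCommGroup M] [Module k M] (ρ : CentralExt k g →ₗ[k] Module.End k M),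
        (∀ x y, ρ (sharpBr hg hb s hs x y) = ρ x * ρ y - ρ y * ρ x) →
        (∀ m, IsOpen {x | ρ x m = 0}) →
        (∀ m, ρ (centralK k g) m = -m) →
        IsUnitalRightCDGModule (P := algebroidSharp hg hb s hs)
          ((splitGSharp hg hb s hs).rightModule ρ) ∧
        IsLeftCDGModule (leftOfRight (P := algebroidSharp hg hb s hs) Φ hΦ
          ((splitGSharp hg hb s hs).rightModule ρ)) := by
  have hBs : ∀ x ∈ b.toSubmodule, ∀ y ∈ b.toSubmodule, lieBr k g x y ∈ b.toSubmodule :=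
    fun x hx y hy => b.lie_mem hx hy
  have hS : (splitG hg s hs).IsLiePair := splitG_isLiePair hg hBs
  have hS' : (splitGSharp hg hb s hs).IsLiePair := splitGSharp_isLiePair hg hb hBs
  have hK : (splitGSharp hg hb s hs).br
      ((splitGSharp hg hb s hs).inB ((0, 1) : b.toSubmodule × k)) = 0 := by
    rw [splitGSharp_inB_centralK, br_centralK]
  have hP : IsUnitalCDGLieAlgebroid (algebroidSharp hg hb s hs) := hS'.isUnital hK
  have hX : IsCDGLieAlgebroid (algebroid hg s hs) := hS.isCDGLieAlgebroid
  have hE := splitGSharp_isCriticalExt (s := s) (hs := hs) hg hb hBs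
  let Φ : UnitalHom (algebroidSharp hg hb s hs) (opp (adjoinUnit (algebroid hg s hs))) := hE.hom hS
  have hΦ : Φ.IsIso := ⟨fun _ => Function.bijective_id, SplitBracket.sharpToOpp_bijective⟩
  refine ⟨isTateLieAlgebra_sharpBr hg hb hBs, isCLattice_sharpSub hb,
    fun x hx y hy => hBs x.1 hx y.1 hy, hX, hP, isUnital_opp (isUnital_adjoinUnit hX),
    ⟨ofAdjoinUnit hP, fun _ _ => rfl, ofAdjoinUnit_inr hP, ofAdjoinUnit_eq_zero_iff hP⟩,
    Φ, hΦ, fun _ _ => rfl, fun _ _ => rfl,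
    fun N hN => isLeftCDGModule_leftOfRight hX Φ hΦ hN, fun M _ _ ρ hρ _ hK1 => ?_⟩
  have hM : IsUnitalRightCDGModule (P := algebroidSharp hg hb s hs)
      ((splitGSharp hg hb s hs).rightModule ρ) := by
    -- The right action is minus the left one, so `K` acting by -1 on the left makes the unit act by
    -- the identity.
    refine hS'.isUnitalRightCDGModule hρ hK (LinearMap.ext fun m => ?_)
    rw [splitGSharp_inB_centralK, hK1]
    rfl
  exact ⟨hM, isLeftCDGModule_leftOfRight hX Φ hΦ hM⟩
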